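/- **Setting.** Let $n,d\ge 1$, $\alpha\in(0,2)$, and let $\kappa\ge1$, $\underline\alpha,\overline\alpha>0$, $\lambda\ge1$. Points of $\mathbb R^{nd}$ and $nd\times nd$ matrices are written in $d$-dimensional blocks. *Drift.* $A_t=(a^{i,j}_t)_{1\le i,j\le n}$, $t\ge0$, is measurable in $t$, with $a^{i,j}_t\in\mathbb R^{d\times d}$, $a^{i,j}_t=0$ for $i>j+1$, $\|a_t^{i,j}\|\le\overline\alpha$, and $\underline\alpha|\xi|^2\le\langle a^{i,i-1}_t\xi,\xi\rangle\le\overline\alpha|\xi|^2$ for $2\le i\le n$, $\xi\in\mathbb R^d$, $t\ge 0$. $R_{s,t}$ is its resolvent, $R_{s,t}=I+\int_t^sA_uR_{u,t}\,du$, and $B=(I_{d}\ 0\ \cdots\ 0)^*$. *Noise.* $\mu$ is a symmetric measure on $S^{d-1}$ with a Lipschitz density with respect to the surface measure and $\lambda^{-1}|u|^\alpha\le\int_{S^{d-1}}|\langle u,\varsigma\rangle|^\alpha\mu(d\varsigma)\le\lambda|u|^\alpha$ for $u\in\mathbb R^d$; $\mu=C_\alpha\tilde\mu$ with $C_\alpha=\int_0^\infty(1-\cos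 r)r^{-1-\alpha}dr$, and $\nu(dz)=\rho^{-1-\alpha}d\rho\,\tilde\mu(d\varsigma)$, $z=\rho\varsigma$. Either (stable case) $g\equiv1$ and $Z$ is the Lévy process with $\mathbb E e^{i\langle p,Z_t\rangle}=\exp(-t\int|\langle p,\varsigma\rangle|^\alpha\mu(d\varsigma))$; or (tempered case) $Z$ is the Lévy process with generator $\int\{\phi(x+z)-\phi(x)-\frac{\langle\nabla\phi(x),z\rangle}{1+|z|^2}\}g(|z|)\nu(dz)$, where $g:[0,\infty)\to(0,\infty)$ is non-increasing, $C^1$, also $C^2$ on some $[0,a]$, $a>0$, if $\alpha\ge1$, and for some constant $c_0>0$, $g(r)+r\sup_{u\in[\kappa^{-1},\kappa]}g'(ur)\le c_0\,\theta(r)$ for all $r>0$, for a positive bounded non-increasing function $\theta$ on $(0,\infty)$ with $\theta(r)\le D\theta(2r)$ for some $D\ge 1$ and all $r>0$, and $(1+r)\theta(r)\to0$ as $r\to\infty$. *Scales.* $\mathbb M_u=\mathrm{Diag}(I,uI,\dots,u^{n-1}I)$, $\mathbb T^\alpha_u=u^{1/\alpha}\mathbb M_u$. **Statement.** There are constants $T_0\in(0,1]$,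 $C>0$, $c>0$, $\bar\lambda\ge1$, depending only on $n,d,\alpha,\kappa,\underline\alpha,\overline\alpha,\lambda,g$, such that the following holds for all $A$, $\mu$ and $Z$ as above. (i) Let $t\ge0$, $s\in(t,t+T_0]$ and let $(\sigma_u)_{u\ge t}$ be a measurable deterministic $\mathbb R^{d\times d}$-valued function with $\kappa^{-1}|\xi|^2\le\langle\xi,\sigma_u\sigma_u^*\xi\rangle\le\kappa|\xi|^2$ for all $\xi\in\mathbb R^d$. Then $\Lambda_s=\int_t^sR_{s,u}B\sigma_u\,dZ_u$ has a density $p_{\Lambda_s}$ given for all $z\in\mathbb R^{nd}$ by $$p_{\Lambda_s}(z)=\frac{\det(\mathbb M_{s-t})^{-1}}{(2\pi)^{nd}}\int_{\mathbb R^{nd}}e^{-i\langle q,\mathbb M_{s-t}^{-1}z\rangle}\exp\Big(-(s-t)\int_{\mathbb R^{nd}}\{1-\cos\langle q,\xi\rangle\}\,\nu_S(d\xi)\Big)dq,$$ the outer integrand being integrable, where $\nu_S$ is a symmetric Lévy measure on $\mathbb R^{nd}$ that may depend on $t,s,A,\sigma,\mu$ and such that for every Borel set $\mathcal A\subset\mathbb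 R^{nd}$ $$\nu_S(\mathcal A)\le\int_0^\infty\frac{d\rho}{\rho^{1+\alpha}}\int_{S^{nd-1}}\mathbf 1_{\mathcal A}(\rho\eta)\,g(c\rho)\,\bar\mu(d\eta),$$ with equality in the stable case. Here $\bar\mu$ is a finite symmetric measure on $S^{nd-1}$ with $\bar\lambda^{-1}|u|^\alpha\le\int_{S^{nd-1}}|\langle u,\eta\rangle|^\alpha\bar\mu(d\eta)\le\bar\lambda|u|^\alpha$ for $u\in\mathbb R^{nd}$ and, if $n\ge2$, the support of $\bar\mu$ has Hausdorff dimension $d$. Moreover $p_{\Lambda_s}(z)\le C\det(\mathbb T^\alpha_{s-t})^{-1}$ for all $z\in\mathbb R^{nd}$. (ii) Let $\sigma:[0,\infty)\times\mathbb R^{nd}\to\mathbb R^{d\times d}$ be measurable in time, with $\|\sigma(t,x)-\sigma(t,y)\|\le H|x-y|^\eta$ for some $H>0$, $\eta\in(0,1]$, and $\kappa^{-1}|\xi|^2\le\langle\xi,\sigma\sigma^*(t,z)\xi\rangle\le\kappa|\xi|^2$. For $T\ge0$, $x,y\in\mathbb R^{nd}$ and $s>t\ge0$, the frozen process $\tilde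 X_s=R_{s,t}x+\int_t^sR_{s,u}B\sigma(u,R_{u,T}y)\,dZ_u$ has a density. If $s\le t+T_0$, this density is $z\mapsto p(z-R_{s,t}x)$ with $p$ as in (i), that is, with a measure $\nu_S$ and a bound as there. -/

import Mathlib

open MeasureTheory ProbabilityTheory Filter Topology Set
open scoped NNReal ENNReal Matrix

noncomputable section

namespace StableChain

/-- The state space `ℝ^{nd}`, with the coordinates grouped in `n` blocks of size `d`
(the block index `i : Fin n` starts at `0`). -/
abbrev ESp (n d : ℕ) : Type := EuclideanSpace ℝ (Fin n × Fin d)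

/-- The unit sphere of a Euclidean space. -/
abbrev USphere (ι : Type) [Fintype ι] : Type :=
  Metric.sphere (0 : EuclideanSpace ℝ ι) 1

/-! ### The linear system -/

/-- The `(i, j)` block, a `d × d` matrix, of an `nd × nd` matrix. -/
def blk {n d : ℕ} (M : Matrix (Fin n × Fin d) (Fin n × Fin d) ℝ) (i j : Fin n) :
    Matrix (Fin d) (Fin d) ℝ :=
  Matrix.of fun k l => M (i, k) (j, l)

/-- Assumptions on the drift `t ↦ A_t`, `t ≥ 0`: measurable in time, vanishing below the first block
subdiagonal, with blocks of operator norm at most `aUp`, and with uniformly positive subdiagonal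
blocks (the Hörmander-like condition). -/
structure DriftCondition (n d : ℕ) (aLow aUp : ℝ)
    (A : ℝ → Matrix (Fin n × Fin d) (Fin n × Fin d) ℝ) : Prop where
  measurable : ∀ i j, Measurable fun t => A t i j
  hessenberg : ∀ t, 0 ≤ t → ∀ i j : Fin n, (j : ℕ) + 1 < i → blk (A t) i j = 0
  bounded : ∀ t, 0 ≤ t → ∀ i j : Fin n,
    ‖Matrix.toEuclideanCLM (𝕜 := ℝ) (blk (A t) i j)‖ ≤ aUp
  hormander : ∀ t, 0 ≤ t → ∀ i j : Fin n, (j : ℕ) + 1 = i → ∀ ξ : EuclideanSpace ℝ (Fin d),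
    aLow * ‖ξ‖ ^ 2 ≤ inner ℝ (Matrix.toEuclideanCLM (𝕜 := ℝ) (blk (A t) i j) ξ) ξ ∧
    inner ℝ (Matrix.toEuclideanCLM (𝕜 := ℝ) (blk (A t) i j) ξ) ξ ≤ aUp * ‖ξ‖ ^ 2

/-- `R s t` is the resolvent of `d/ds R_{s,t} = A_s R_{s,t}`, `R_{t,t} = I`. As `A` is only
measurable in time, the equation is understood in its integrated form. -/
def IsResolvent {n d : ℕ} (A : ℝ → Matrix (Fin n × Fin d) (Fin n × Fin d) ℝ)
    (R : ℝ → ℝ → Matrix (Fin n × Fin d) (Fin n × Fin d) ℝ) : Prop :=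
  ∀ t, 0 ≤ t → (∀ i j, ContinuousOn (fun s => R s t i j) (Ici 0)) ∧
    ∀ s, 0 ≤ s → ∀ i j,
      R s t i j = (1 : Matrix (Fin n × Fin d) (Fin n × Fin d) ℝ) i j
        + ∫ u in t..s, (A u * R u t) i j

/-- The injection `B = (I_d, 0, …, 0)^*` of `ℝ^d` into `ℝ^{nd}`. -/
def injB (n d : ℕ) : Matrix (Fin n × Fin d) (Fin d) ℝ :=
  Matrix.of fun i l => if (i.1 : ℕ) = 0 ∧ i.2 = l then 1 else 0

/-- `𝕄_u = Diag(I, u I, …, u^{n-1} I)`. -/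
def scaleM (n d : ℕ) (u : ℝ) : Matrix (Fin n × Fin d) (Fin n × Fin d) ℝ :=
  Matrix.diagonal fun i => u ^ (i.1 : ℕ)

/-- `𝕋_u^α = Diag(u^{1/α} I, u^{1+1/α} I, …, u^{n-1+1/α} I)`. -/
def scaleT (n d : ℕ) (α u : ℝ) : Matrix (Fin n × Fin d) (Fin n × Fin d) ℝ :=
  Matrix.diagonal fun i => u ^ (((i.1 : ℕ) : ℝ) + 1 / α)

/-! ### The diffusion coefficient -/

/-- `κ⁻¹ |ξ|² ≤ ⟨ξ, S S^* ξ⟩ ≤ κ |ξ|²` for all `ξ`. -/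
def IsElliptic {d : ℕ} (κ : ℝ) (S : Matrix (Fin d) (Fin d) ℝ) : Prop :=
  ∀ ξ : EuclideanSpace ℝ (Fin d),
    κ⁻¹ * ‖ξ‖ ^ 2 ≤ inner ℝ ξ (Matrix.toEuclideanCLM (𝕜 := ℝ) (S * Sᵀ) ξ) ∧
    inner ℝ ξ (Matrix.toEuclideanCLM (𝕜 := ℝ) (S * Sᵀ) ξ) ≤ κ * ‖ξ‖ ^ 2

/-- Assumptions on the coefficient `σ(t, x)`: measurable in time, Hölder continuous in space
uniformly in time, and uniformly elliptic. -/
structure SigmaCondition (n d : ℕ) (κ : ℝ)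
    (σ : ℝ → ESp n d → Matrix (Fin d) (Fin d) ℝ) : Prop where
  measurable : ∀ x i j, Measurable fun t => σ t x i j
  holder : ∃ H > 0, ∃ η : ℝ, 0 < η ∧ η ≤ 1 ∧ ∀ x y, ∀ t, 0 ≤ t →
    ‖Matrix.toEuclideanCLM (𝕜 := ℝ) (σ t x - σ t y)‖ ≤ H * ‖x - y‖ ^ η
  elliptic : ∀ t, 0 ≤ t → ∀ x, IsElliptic κ (σ t x)

/-! ### The driving noise -/

/-- The constant `C_α = ∫_0^∞ (1 - cos r) r^{-1-α} dr` that relates the spectral measure `μ` of a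
symmetric stable process to the spherical part `μ̃` of its Lévy measure: `μ = C_α μ̃`. -/
def stableConst (α : ℝ) : ℝ := ∫ r in Ioi (0 : ℝ), (1 - Real.cos r) / r ^ (1 + α)

/-- The measure `A ↦ ∫_0^∞ dρ / ρ^{1+α} ∫_{sphere} 1_A(ρ η) w(ρ) m(dη)`. -/
def polarMeasure {ι : Type} [Fintype ι] (α : ℝ) (w : ℝ → ℝ) (m : Measure (USphere ι)) :
    Measure (EuclideanSpace ℝ ι) :=
  (((volume.restrict (Ioi (0 : ℝ))).withDensity
      fun ρ => ENNReal.ofReal (w ρ / ρ ^ (1 + α))).prod m).map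
    fun x => x.1 • (x.2 : EuclideanSpace ℝ ι)

/-- The Lévy measure `ν(dz) = dρ / ρ^{1+α} μ̃(dς)`, `z = ρ ς`, of the symmetric `α`-stable process
with spectral measure `μ = C_α μ̃`. -/
def stableLevy {ι : Type} [Fintype ι] (α : ℝ) (μ : Measure (USphere ι)) :
    Measure (EuclideanSpace ℝ ι) :=
  polarMeasure α (fun _ => 1) ((ENNReal.ofReal (stableConst α))⁻¹ • μ)

/-- `λ⁻¹ |u|^α ≤ ∫ |⟨u, ς⟩|^α m(dς) ≤ λ |u|^α` for all `u`. -/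
def IsNondegenerate {ι : Type} [Fintype ι] (α lam : ℝ) (m : Measure (USphere ι)) : Prop :=
  ∀ u : EuclideanSpace ℝ ι,
    lam⁻¹ * ‖u‖ ^ α ≤ ∫ s : USphere ι, |inner ℝ u (s : EuclideanSpace ℝ ι)| ^ α ∂m ∧
    ∫ s : USphere ι, |inner ℝ u (s : EuclideanSpace ℝ ι)| ^ α ∂m ≤ lam * ‖u‖ ^ α

/-- Assumptions on the spectral measure of the noise: a symmetric measure on the unit sphere with a
Lipschitz density with respect to the surface measure, and nondegenerate. -/
structure SpectralCondition (d : ℕ) (α lam : ℝ) (μ : Measure (USphere (Fin d))) : Prop where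
  symmetric : μ.IsNegInvariant
  density : ∃ (h : USphere (Fin d) → ℝ≥0) (L : ℝ≥0), LipschitzWith L h ∧
    μ = (volume : Measure (EuclideanSpace ℝ (Fin d))).toSphere.withDensity fun s => (h s : ℝ≥0∞)
  nondegenerate : IsNondegenerate α lam μ

/-- Assumptions on the tempering function `g : ℝ⁺ → ℝ⁺ \ {0}` (only the values on `[0, ∞)`
matter). -/
structure TemperingCondition (α κ : ℝ) (g : ℝ → ℝ) : Prop where
  pos : ∀ r, 0 ≤ r → 0 < g r
  antitone : AntitoneOn g (Ici 0)
  contDiff_one : ContDiffOn ℝ 1 g (Ici 0)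
  contDiff_two : 1 ≤ α → ∃ a > 0, ContDiffOn ℝ 2 g (Icc 0 a)
  decay : ∃ c > 0, ∃ θ : ℝ → ℝ,
    (∀ r, 0 < r → 0 < θ r) ∧ AntitoneOn θ (Ioi 0) ∧ (∃ K, ∀ r, 0 < r → θ r ≤ K) ∧
    (∃ D, 1 ≤ D ∧ ∀ r, 0 < r → θ r ≤ D * θ (2 * r)) ∧
    Tendsto (fun r => (1 + r) * θ r) atTop (𝓝 0) ∧
    ∀ r, 0 < r → ∀ u ∈ Icc κ⁻¹ κ, g r + r * deriv g (u * r) ≤ c * θ r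

variable {Ω : Type*} [MeasurableSpace Ω]

/-- Lévy processes (started from `0`) with values in a Euclidean space. -/
structure IsLevyProcess {ι : Type} [Fintype ι] (P : Measure Ω)
    (Z : ℝ≥0 → Ω → EuclideanSpace ℝ ι) : Prop where
  measurable : ∀ u, Measurable (Z u)
  zero : ∀ᵐ ω ∂P, Z 0 ω = 0
  indep : HasIndepIncrements Z P
  stationary : ∀ u h, IdentDistrib (fun ω => Z (u + h) ω - Z u ω) (Z h) P P
  stochCont : ∀ u, TendstoInMeasure P Z (𝓝 u) (Z u)

/-- The symmetric `α`-stable process with spectral measure `μ`: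
`𝔼 exp(i⟨p, Z_t⟩) = exp(-t ∫ |⟨p, ς⟩|^α μ(dς))`. -/
def IsSymmetricStable {ι : Type} [Fintype ι] (P : Measure Ω) (α : ℝ) (μ : Measure (USphere ι))
    (Z : ℝ≥0 → Ω → EuclideanSpace ℝ ι) : Prop :=
  IsLevyProcess P Z ∧ ∀ (t : ℝ≥0) (p : EuclideanSpace ℝ ι),
    charFun (P.map (Z t)) p =
      Complex.exp (-(((t : ℝ) *
        ∫ s : USphere ι, |inner ℝ p (s : EuclideanSpace ℝ ι)| ^ α ∂μ : ℝ) : ℂ))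

/-- The Lévy process with generator
`L φ(x) = ∫ (φ(x+z) - φ(x) - ⟨∇φ(x), z⟩ / (1+|z|²)) N(dz)`, given by its Lévy–Khintchine
exponent. -/
def IsPureJumpLevy {ι : Type} [Fintype ι] (P : Measure Ω) (N : Measure (EuclideanSpace ℝ ι))
    (Z : ℝ≥0 → Ω → EuclideanSpace ℝ ι) : Prop :=
  IsLevyProcess P Z ∧ ∀ (t : ℝ≥0) (p : EuclideanSpace ℝ ι),
    charFun (P.map (Z t)) p =
      Complex.exp ((t : ℝ) * ∫ z, (Complex.exp (Complex.I * (inner ℝ p z : ℝ)) - 1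
        - Complex.I * (inner ℝ p z / (1 + ‖z‖ ^ 2) : ℝ)) ∂N)

/-- The driving noise: either `g = 1` and `Z` is the symmetric stable process with spectral measure
`μ`, or `g` is a tempering function and `Z` is the tempered stable process whose Lévy measure is
`g(|z|) ν(dz)`, with `ν` the Lévy measure of the stable process. -/
def IsDrivingNoise {d : ℕ} (P : Measure Ω) (α κ : ℝ) (μ : Measure (USphere (Fin d))) (g : ℝ → ℝ)
    (Z : ℝ≥0 → Ω → EuclideanSpace ℝ (Fin d)) : Prop :=
  ((∀ r, 0 ≤ r → g r = 1) ∧ IsSymmetricStable P α μ Z) ∨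
  (TemperingCondition α κ g ∧
    IsPureJumpLevy P ((stableLevy α μ).withDensity fun z => ENNReal.ofReal (g ‖z‖)) Z)

/-! ### Stochastic integrals of deterministic functions -/

/-- The step function equal to `F i` on `(τ i, τ (i+1)]`, `i < N`, and to `0` elsewhere. -/
def stepFun {m k : Type} (N : ℕ) (τ : ℕ → ℝ≥0) (F : ℕ → Matrix m k ℝ) (u : ℝ) : Matrix m k ℝ :=
  ∑ i ∈ Finset.range N, (Ioc (τ i : ℝ) (τ (i + 1))).indicator (fun _ => F i) u

/-- The integral `∑ i < N, F i (Z_{τ (i+1)} - Z_{τ i})` of a step function. -/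
def stepIntegral {m k : Type} [Fintype m] [Fintype k] [DecidableEq k] (N : ℕ) (τ : ℕ → ℝ≥0)
    (F : ℕ → Matrix m k ℝ) (Z : ℝ≥0 → Ω → EuclideanSpace ℝ k) (ω : Ω) : EuclideanSpace ℝ m :=
  ∑ i ∈ Finset.range N, Matrix.toEuclideanLin (F i) (Z (τ (i + 1)) ω - Z (τ i) ω)

/-- `X = ∫_t^s f(u) dZ_u` for a bounded measurable deterministic `f`: `X` is the limit in
probability of the integrals of uniformly bounded step functions that converge to `f` almost
everywhere on `(t, s]`. -/
def HasStochIntegral {m k : Type} [Fintype m] [Fintype k] [DecidableEq k] (P : Measure Ω)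
    (Z : ℝ≥0 → Ω → EuclideanSpace ℝ k) (f : ℝ → Matrix m k ℝ) (t s : ℝ≥0)
    (X : Ω → EuclideanSpace ℝ m) : Prop :=
  ∃ (N : ℕ → ℕ) (τ : ℕ → ℕ → ℝ≥0) (F : ℕ → ℕ → Matrix m k ℝ),
    (∀ j, Monotone (τ j) ∧ τ j 0 = t ∧ τ j (N j) = s) ∧
    (∃ K : ℝ, ∀ j i a b, |F j i a b| ≤ K) ∧
    (∀ᵐ u ∂(volume.restrict (Ioc (t : ℝ) s)),
      Tendsto (fun j => stepFun (N j) (τ j) (F j) u) atTop (𝓝 (f u))) ∧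
    TendstoInMeasure P (fun j => stepIntegral (N j) (τ j) (F j) Z) atTop X

/-! ### Densities -/

/-- The random variable `X` has the density `p` with respect to the Lebesgue measure. -/
def HasDensity {ι : Type} [Fintype ι] (P : Measure Ω) (X : Ω → EuclideanSpace ℝ ι)
    (p : EuclideanSpace ℝ ι → ℝ) : Prop :=
  AEMeasurable X P ∧ Measurable p ∧ (∀ z, 0 ≤ p z) ∧
    P.map X = volume.withDensity fun z => ENNReal.ofReal (p z)

/-- `exp(-u ∫ (1 - cos⟨q, ξ⟩) ν(dξ))`: the characteristic function, at time `u`, of the symmetric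
pure jump Lévy process with Lévy measure `ν`. -/
def levyFourier {ι : Type} [Fintype ι] (u : ℝ) (ν : Measure (EuclideanSpace ℝ ι))
    (q : EuclideanSpace ℝ ι) : ℝ :=
  Real.exp (-u * ∫ ξ, (1 - Real.cos (inner ℝ q ξ)) ∂ν)

/-- `ν` is a symmetric Lévy measure. -/
structure IsSymmetricLevyMeasure {ι : Type} [Fintype ι]
    (ν : Measure (EuclideanSpace ℝ ι)) : Prop where
  symmetric : ν.IsNegInvariant
  zero : ν {0} = 0
  finite : ∫⁻ ξ, ENNReal.ofReal (min 1 (‖ξ‖ ^ 2)) ∂ν < ∞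

/-- The properties of the measure `ν` on `ℝ^{nd}`: it is a symmetric Lévy measure, dominated by
`dρ / ρ^{1+α} g(c ρ) m(dη)` (with equality in the stable case `g = 1`), where `m` is a symmetric
bounded measure on the sphere of `ℝ^{nd}`, nondegenerate with constant `lam`, and whose support has
dimension `d` (as soon as `n ≥ 2`). -/
structure IsStableLike (n d : ℕ) (α : ℝ) (g : ℝ → ℝ) (c lam : ℝ) (ν : Measure (ESp n d))
    (m : Measure (USphere (Fin n × Fin d))) : Prop where
  levy : IsSymmetricLevyMeasure ν
  dominated : ν ≤ polarMeasure α (fun ρ => g (c * ρ)) m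
  stable_eq : (∀ r, 0 ≤ r → g r = 1) → ν = polarMeasure α (fun ρ => g (c * ρ)) m
  finite : IsFiniteMeasure m
  symmetric : m.IsNegInvariant
  nondegenerate : IsNondegenerate α lam m
  dim_support : 2 ≤ n → dimH m.support = d

/-- `p` is given by Fourier inversion as the density of `𝕄_u S_u`, where `S` is the symmetric Lévy
process with Lévy measure `ν`, and it satisfies the diagonal bound `p ≤ C det(𝕋_u^α)⁻¹`. -/
structure IsMultiScaleDensity (n d : ℕ) (α C u : ℝ) (ν : Measure (ESp n d))
    (p : ESp n d → ℝ) : Prop where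
  integrable : Integrable (levyFourier u ν)
  inversion : ∀ z, (p z : ℂ) =
    (((scaleM n d u).det⁻¹ / (2 * Real.pi) ^ (n * d) : ℝ) : ℂ) *
      ∫ q : ESp n d,
        Complex.exp (-Complex.I *
          (inner ℝ q (Matrix.toEuclideanCLM (𝕜 := ℝ) (scaleM n d u)⁻¹ z) : ℝ)) *
        (levyFourier u ν q : ℂ)
  diagonal : ∀ z, p z ≤ C * (scaleT n d α u).det⁻¹

end StableChain

end

noncomputable section

set_option linter.unusedSectionVars false

namespace StableChain

/-! ### Linear flows in a Banach algebra -/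

lemma gronwall_integral_right {f : ℝ → ℝ} (hf : Continuous f) {t b C K : ℝ} (hK : 0 ≤ K)
    (h : ∀ x ∈ Icc t b, f x ≤ C + K * ∫ y in t..x, f y) :
    ∀ x ∈ Icc t b, f x ≤ C * Real.exp (K * (x - t)) := by
  intro x hx
  have hd : ∀ y, HasDerivAt (fun x => C + K * ∫ y in t..x, f y) (K * f y) y := fun y =>
    ((intervalIntegral.integral_hasDerivAt_right (hf.intervalIntegrable _ _)
      hf.aestronglyMeasurable.stronglyMeasurableAtFilter hf.continuousAt).const_mul K).const_add C
  have key := le_gronwallBound_of_liminf_deriv_right_le (f := fun x => C + K * ∫ y in t..x, f y)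
    (f' := fun y => K * f y) (δ := C) (K := K) (ε := 0) (a := t) (b := b)
    (fun y _ => (hd y).continuousAt.continuousWithinAt)
    (fun y _ r hr => (hd y).hasDerivWithinAt.liminf_right_slope_le hr) (by simp)
    (fun y hy => by
      have := h y ⟨hy.1, hy.2.le⟩
      simpa using mul_le_mul_of_nonneg_left this hK) x hx
  rw [gronwallBound_ε0] at key
  exact (h x hx).trans key

lemma gronwall_integral {f : ℝ → ℝ} (hf : Continuous f) {a b t C K : ℝ} (hK : 0 ≤ K)
    (h : ∀ x ∈ Icc a b, f x ≤ C + K * |∫ y in t..x, f y|) (hf0 : ∀ x, 0 ≤ f x) :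
    ∀ x ∈ Icc a b, t ∈ Icc a b → f x ≤ C * Real.exp (K * |x - t|) := by
  intro x hx ht
  rcases le_total t x with htx | htx
  · have := gronwall_integral_right hf hK (t := t) (b := b) (C := C) (fun y hy => by
      have := h y ⟨ht.1.trans hy.1, hy.2⟩
      rwa [abs_of_nonneg (intervalIntegral.integral_nonneg hy.1 fun z _ => hf0 z)] at this)
      x ⟨htx, hx.2⟩
    rwa [abs_of_nonneg (sub_nonneg.2 htx)]
  · have := gronwall_integral_right (hf.comp continuous_neg) hK (t := -t) (b := -a) (C := C)
      (fun y hy => by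
      have := h (-y) ⟨by linarith [hy.2], by linarith [hy.1, ht.2]⟩
      rw [intervalIntegral.integral_symm, abs_neg, abs_of_nonneg
        (intervalIntegral.integral_nonneg (by linarith [hy.1]) fun z _ => hf0 z)] at this
      simpa [intervalIntegral.integral_comp_neg] using this)
      (-x) ⟨by linarith, by linarith [hx.1]⟩
    rw [abs_of_nonpos (sub_nonpos.2 htx)]
    simpa [show -x + t = -(x - t) by ring, add_comm, sub_eq_add_neg] using this

variable {𝔸 : Type*} [NormedRing 𝔸] [NormedAlgebra ℝ 𝔸] [CompleteSpace 𝔸]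

/-- `R` is the resolvent on `[a, b]` of the linear equation with coefficient `A`, which is
measurable and bounded by `K`. -/
structure IsFlow (a b K : ℝ) (A : ℝ → 𝔸) (R : ℝ → ℝ → 𝔸) : Prop where
  meas : AEStronglyMeasurable A (volume.restrict (Icc a b))
  bound : ∀ u ∈ Icc a b, ‖A u‖ ≤ K
  cont : ∀ t ∈ Icc a b, ContinuousOn (fun s => R s t) (Icc a b)
  eq : ∀ t ∈ Icc a b, ∀ s ∈ Icc a b, R s t = 1 + ∫ u in t..s, A u * R u t

namespace IsFlow
variable {a b K : ℝ} {A : ℝ → 𝔸} {R : ℝ → ℝ → 𝔸}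

lemma uIcc_sub {s t : ℝ} (ht : t ∈ Icc a b) (hs : s ∈ Icc a b) : uIoc t s ⊆ Icc a b :=
  uIoc_subset_uIcc.trans (uIcc_subset_Icc ht hs)

lemma norm_le_exp {X : ℝ → 𝔸} {C : ℝ} (hK : 0 ≤ K) (hX : ContinuousOn X (Icc a b))
    (hA : ∀ u ∈ Icc a b, ‖A u‖ ≤ K) {t : ℝ} (ht : t ∈ Icc a b) (c : 𝔸) (hc : ‖c‖ ≤ C)
    (h : ∀ s ∈ Icc a b, X s = c + ∫ u in t..s, A u * X u) :
    ∀ s ∈ Icc a b, ‖X s‖ ≤ C * Real.exp (K * |s - t|) := by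
  intro s hs
  have hab : a ≤ b := ht.1.trans ht.2
  set f : ℝ → ℝ := fun s => ‖X (projIcc a b hab s)‖ with hf
  have hfc : Continuous f := (hX.domRestrict.comp continuous_projIcc).norm
  have hfX : ∀ u ∈ Icc a b, f u = ‖X u‖ := fun u hu => by simp [hf, projIcc_of_mem hab hu]
  have := gronwall_integral hfc (a := a) (b := b) (t := t) (C := C) hK (fun x hx => by
    rw [hfX x hx, h x hx]
    refine (norm_add_le _ _).trans (add_le_add hc ?_)
    have h1 : ‖∫ u in t..x, A u * X u‖ ≤ |∫ u in t..x, K * f u| := by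
      refine intervalIntegral.norm_integral_le_abs_of_norm_le ?_
        ((hfc.const_mul K).intervalIntegrable _ _)
      refine (ae_restrict_mem measurableSet_uIoc).mono fun u hu => ?_
      have hu' := uIcc_sub ht hx hu
      rw [hfX u hu']
      exact (norm_mul_le _ _).trans (mul_le_mul_of_nonneg_right (hA u hu') (norm_nonneg _))
    rw [intervalIntegral.integral_const_mul, abs_mul, abs_of_nonneg hK] at h1
    exact h1) (fun x => norm_nonneg _) s hs ht
  rwa [hfX s hs] at this


lemma K_nonneg (F : IsFlow a b K A R) (hab : a ≤ b) : 0 ≤ K := (norm_nonneg _).trans (F.bound a ⟨le_rfl, hab⟩)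

lemma intervalIntegrable_mul' (hA : AEStronglyMeasurable A (volume.restrict (Icc a b)))
    (hb : ∀ u ∈ Icc a b, ‖A u‖ ≤ K) {X : ℝ → 𝔸} (hX : ContinuousOn X (Icc a b)) {t s : ℝ}
    (ht : t ∈ Icc a b) (hs : s ∈ Icc a b) :
    IntervalIntegrable (fun u => A u * X u) volume t s := by
  rw [intervalIntegrable_iff]
  refine IntegrableOn.mono_set ?_ (uIcc_sub ht hs)
  obtain ⟨C, hC⟩ := isCompact_Icc.exists_bound_of_continuousOn hX
  refine Integrable.of_bound (C := K * C)
    (hA.mul (hX.aestronglyMeasurable_of_isCompact isCompact_Icc measurableSet_Icc)) ?_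
  refine (ae_restrict_mem measurableSet_Icc).mono fun u hu => ?_
  exact (norm_mul_le _ _).trans (mul_le_mul (hb u hu) (hC u hu) (norm_nonneg _)
    ((norm_nonneg _).trans (hb u hu)))

lemma intervalIntegrable_mul (F : IsFlow a b K A R) {X : ℝ → 𝔸} (hX : ContinuousOn X (Icc a b))
    {t s : ℝ} (ht : t ∈ Icc a b) (hs : s ∈ Icc a b) :
    IntervalIntegrable (fun u => A u * X u) volume t s :=
  intervalIntegrable_mul' F.meas F.bound hX ht hs

lemma intervalIntegrable (F : IsFlow a b K A R) {t s : ℝ} (ht : t ∈ Icc a b) (hs : s ∈ Icc a b) :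
    IntervalIntegrable A volume t s := by
  simpa using F.intervalIntegrable_mul (X := fun _ => 1) continuousOn_const ht hs

lemma self (F : IsFlow a b K A R) {t : ℝ} (ht : t ∈ Icc a b) : R t t = 1 := by
  simpa using F.eq t ht t ht

lemma norm_le (F : IsFlow a b K A R) {t s : ℝ} (ht : t ∈ Icc a b) (hs : s ∈ Icc a b) :
    ‖R s t‖ ≤ ‖(1 : 𝔸)‖ * Real.exp (K * (b - a)) := by
  have hK := F.K_nonneg (ht.1.trans ht.2)
  refine (norm_le_exp hK (F.cont t ht) F.bound ht 1 le_rfl (F.eq t ht) s hs).trans ?_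
  gcongr
  rw [abs_le]; constructor <;> linarith [ht.1, ht.2, hs.1, hs.2]

lemma cocycle (F : IsFlow a b K A R) {s u v : ℝ} (hs : s ∈ Icc a b) (hu : u ∈ Icc a b) (hv : v ∈ Icc a b) :
    R s u * R u v = R s v := by
  have hc : ContinuousOn (fun s => R s u * R u v - R s v) (Icc a b) :=
    ((F.cont u hu).mul continuousOn_const).sub (F.cont v hv)
  have := norm_le_exp (F.K_nonneg (hu.1.trans hu.2)) hc F.bound hu 0 (C := 0) (by simp)
    (fun x hx => ?_) s hs
  · rw [zero_mul, norm_le_zero_iff, sub_eq_zero] at this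
    exact this
  have h1 := F.intervalIntegrable_mul (F.cont u hu) hu hx
  have h2 := F.intervalIntegrable_mul (F.cont v hv) hu hx
  have h3 := F.intervalIntegrable_mul (F.cont v hv) hv hu
  have hmul : ∫ r in u..x, A r * R r u * R u v = (∫ r in u..x, A r * R r u) * R u v :=
    ((ContinuousLinearMap.mul ℝ 𝔸).flip (R u v)).intervalIntegral_comp_comm h1
  have e : (fun r => A r * (R r u * R u v - R r v))
      = fun r => A r * R r u * R u v - A r * R r v := by ext r; noncomm_ring
  rw [e, intervalIntegral.integral_sub (h1.mul_const (R u v)) h2,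
    hmul]
  nth_rewrite 1 [F.eq u hu x hx]
  rw [F.eq v hv x hx, F.eq v hv u hu, ← intervalIntegral.integral_add_adjacent_intervals h3 h2]
  noncomm_ring

lemma norm_sub_one_le (F : IsFlow a b K A R) {t s : ℝ} (ht : t ∈ Icc a b) (hs : s ∈ Icc a b) :
    ‖R s t - 1‖ ≤ K * (‖(1 : 𝔸)‖ * Real.exp (K * (b - a))) * |s - t| := by
  rw [F.eq t ht s hs, add_sub_cancel_left]
  refine intervalIntegral.norm_integral_le_of_norm_le_const fun u hu => ?_
  have hu' := uIcc_sub ht hs hu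
  exact (norm_mul_le _ _).trans (mul_le_mul (F.bound u hu') (F.norm_le ht hu') (norm_nonneg _)
    ((norm_nonneg _).trans (F.bound u hu')))

lemma norm_sub_integral_le (F : IsFlow a b K A R) {t s : ℝ} (ht : t ∈ Icc a b)
    (hs : s ∈ Icc a b) :
    ‖R s t - 1 - ∫ u in t..s, A u‖
      ≤ K * (K * (‖(1 : 𝔸)‖ * Real.exp (K * (b - a)))) * |s - t| ^ 2 := by
  have hK := F.K_nonneg (ht.1.trans ht.2)
  rw [F.eq t ht s hs, add_sub_cancel_left, ← intervalIntegral.integral_sub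
    (F.intervalIntegrable_mul (F.cont t ht) ht hs) (F.intervalIntegrable ht hs), pow_two,
    ← mul_assoc]
  refine intervalIntegral.norm_integral_le_of_norm_le_const fun u hu => ?_
  have hu' := uIcc_sub ht hs hu
  rw [← mul_sub_one, mul_assoc]
  refine (norm_mul_le _ _).trans (mul_le_mul (F.bound u hu') ?_ (norm_nonneg _) hK)
  exact (F.norm_sub_one_le ht hu').trans (mul_le_mul_of_nonneg_left
    (abs_sub_left_of_mem_uIcc (uIoc_subset_uIcc hu)) (by positivity))

lemma norm_sub_le (F : IsFlow a b K A R) {s u v : ℝ} (hs : s ∈ Icc a b) (hu : u ∈ Icc a b)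
    (hv : v ∈ Icc a b) :
    ‖R s u - R s v‖ ≤ ‖(1 : 𝔸)‖ * Real.exp (K * (b - a)) *
      (K * (‖(1 : 𝔸)‖ * Real.exp (K * (b - a)))) * |u - v| := by
  have : R s u - R s v = R s v * (R v u - 1) := by rw [mul_sub_one, F.cocycle hs hv hu]
  rw [this, mul_assoc, abs_sub_comm]
  exact (norm_mul_le _ _).trans (mul_le_mul (F.norm_le hv hs) (F.norm_sub_one_le hu hv)
    (norm_nonneg _) (by positivity))

lemma mul_eq_one (F : IsFlow a b K A R) {s u : ℝ} (hs : s ∈ Icc a b) (hu : u ∈ Icc a b) :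
    R s u * R u s = 1 := by
  rw [F.cocycle hs hu hs, F.self hs]

lemma rescale (F : IsFlow a b K A R) {S S' : 𝔸} (h1 : S' * S = 1) (h2 : S * S' = 1) {t τ K' : ℝ}
    (hτ : 0 < τ) (ha : a ≤ t) (hb : t + τ ≤ b)
    (hK : ∀ v ∈ Icc (0 : ℝ) 1, ‖τ • (S' * A (t + τ * v) * S)‖ ≤ K') :
    IsFlow 0 1 K' (fun v => τ • (S' * A (t + τ * v) * S))
      (fun v w => S' * R (t + τ * v) (t + τ * w) * S) := by
  have hm : ∀ v ∈ Icc (0 : ℝ) 1, t + τ * v ∈ Icc a b := fun v hv => by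
    constructor <;> nlinarith [hv.1, hv.2]
  refine ⟨?_, hK, fun w hw => ?_, fun w hw v hv => ?_⟩
  · have hq : Measure.QuasiMeasurePreserving (fun v : ℝ => t + τ * v)
        (volume.restrict (Icc 0 1)) (volume.restrict (Icc a b)) := by
      refine Measure.QuasiMeasurePreserving.restrict ⟨by fun_prop, ?_⟩ hm
      have e : (fun v : ℝ => t + τ * v) = (fun v => t + v) ∘ (fun v => τ * v) := rfl
      rw [e, ← Measure.map_map (by fun_prop) (by fun_prop), Real.map_volume_mul_left hτ.ne',
        Measure.map_smul, map_add_left_eq_self]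
      exact Measure.smul_absolutelyContinuous
    have h3 := F.meas.comp_quasiMeasurePreserving hq
    exact (((continuous_const.mul continuous_id).mul continuous_const).const_smul
      τ).comp_aestronglyMeasurable h3
  · exact (continuousOn_const.mul ((F.cont _ (hm w hw)).comp (by fun_prop) hm)).mul
      continuousOn_const
  · have hI := F.intervalIntegrable_mul (F.cont _ (hm w hw)) (hm w hw) (hm v hv)
    have h4 := intervalIntegral.smul_integral_comp_add_mul (a := w) (b := v)
      (fun u => A u * R u (t + τ * w)) τ t
    have h5 : IntervalIntegrable (fun x => A (t + τ * x) * R (t + τ * x) (t + τ * w)) volume w v := by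
      have := (hI.comp_add_left t).comp_mul_left (c := τ)
      simpa [hτ.ne', mul_div_assoc, mul_div_cancel_left₀] using this
    have h6 : ∫ x in w..v, S' * (A (t + τ * x) * R (t + τ * x) (t + τ * w)) * S
        = S' * (∫ x in w..v, A (t + τ * x) * R (t + τ * x) (t + τ * w)) * S :=
      (((ContinuousLinearMap.mul ℝ 𝔸).flip S).comp
        (ContinuousLinearMap.mul ℝ 𝔸 S')).intervalIntegral_comp_comm h5
    have h7 : ∀ x, τ • (S' * A (t + τ * x) * S) * (S' * R (t + τ * x) (t + τ * w) * S)
        = τ • (S' * (A (t + τ * x) * R (t + τ * x) (t + τ * w)) * S) := fun x => by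
      rw [smul_mul_assoc]
      congr 1
      calc _ = S' * A (t + τ * x) * (S * S') * R (t + τ * x) (t + τ * w) * S := by noncomm_ring
        _ = _ := by rw [h2]; noncomm_ring
    simp only [h7]
    rw [intervalIntegral.integral_smul, h6, F.eq _ (hm w hw) _ (hm v hv), ← h4, mul_add, add_mul,
      mul_one, h1, mul_smul_comm, smul_mul_assoc]

end IsFlow
end StableChain

namespace StableChain
open scoped Matrix.Norms.L2Operator

/-! ### Matrices -/
section Matrices
variable {m k : Type*} [Fintype m] [Fintype k] [DecidableEq k]

lemma norm_le_sum_abs (x : EuclideanSpace ℝ m) : ‖x‖ ≤ ∑ i, |x i| := by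
  rw [EuclideanSpace.norm_eq, Real.sqrt_le_iff]
  refine ⟨by positivity, ?_⟩
  simpa using Finset.sum_sq_le_sq_sum_of_nonneg (s := Finset.univ) (f := fun i => |x i|)
    (fun i _ => abs_nonneg _)

lemma abs_coord_le (x : EuclideanSpace ℝ m) (i : m) : |x i| ≤ ‖x‖ := PiLp.norm_apply_le x i

lemma toEuclideanLin_coord (M : Matrix m k ℝ) (x : EuclideanSpace ℝ k) (i : m) :
    Matrix.toEuclideanLin M x i = ∑ j, M i j * x j := rfl

lemma norm_toEuclideanLin_le (M : Matrix m k ℝ) (x : EuclideanSpace ℝ k) :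
    ‖Matrix.toEuclideanLin M x‖ ≤ ‖M‖ * ‖x‖ :=
  Matrix.l2_opNorm_mulVec M x

lemma l2_norm_le_sum_abs (M : Matrix m k ℝ) : ‖M‖ ≤ ∑ i, ∑ j, |M i j| := by
  rw [Matrix.l2_opNorm_def]
  refine ContinuousLinearMap.opNorm_le_bound _ (by positivity) fun x => ?_
  refine (norm_le_sum_abs _).trans ?_
  rw [Finset.sum_mul]
  refine Finset.sum_le_sum fun i _ => ?_
  change |∑ j, M i j * x j| ≤ _
  refine (Finset.abs_sum_le_sum_abs _ _).trans ?_
  rw [Finset.sum_mul]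
  refine Finset.sum_le_sum fun j _ => ?_
  rw [abs_mul]
  exact mul_le_mul_of_nonneg_left (abs_coord_le x j) (abs_nonneg _)

lemma abs_entry_le (M : Matrix m k ℝ) (i : m) (j : k) : |M i j| ≤ ‖M‖ := by
  have h1 := norm_toEuclideanLin_le M (EuclideanSpace.single j 1)
  have h2 := abs_coord_le (Matrix.toEuclideanLin M (EuclideanSpace.single j 1)) i
  rw [toEuclideanLin_coord] at h2
  simp at h1 h2
  linarith

lemma inner_toEuclideanLin [DecidableEq m] (M : Matrix m k ℝ) (x : EuclideanSpace ℝ m)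
    (y : EuclideanSpace ℝ k) :
    inner ℝ x (Matrix.toEuclideanLin M y) = inner ℝ (Matrix.toEuclideanLin Mᵀ x) y := by
  simp only [PiLp.inner_apply, toEuclideanLin_coord, RCLike.inner_apply, conj_trivial,
    Finset.sum_mul, Finset.mul_sum, Matrix.transpose_apply]
  rw [Finset.sum_comm]
  refine Finset.sum_congr rfl fun i _ => Finset.sum_congr rfl fun j _ => by ring

lemma l2_norm_transpose [DecidableEq m] (M : Matrix m k ℝ) : ‖Mᵀ‖ = ‖M‖ := by
  rw [← Matrix.conjTranspose_eq_transpose_of_trivial, Matrix.l2_opNorm_conjTranspose]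

end Matrices

end StableChain

namespace StableChain
open scoped Matrix.Norms.L2Operator

/-! ### Blocks of vectors -/
section Blocks
variable {n d : ℕ}

/-- The `i`-th block of a vector of `ℝ^{nd}`. -/
def blkv (x : ESp n d) (i : Fin n) : EuclideanSpace ℝ (Fin d) := WithLp.toLp 2 fun k => x (i, k)

/-- The vector of `ℝ^{nd}` with `i`-th block `e` and all other blocks zero. -/
def emb (i : Fin n) (e : EuclideanSpace ℝ (Fin d)) : ESp n d :=
  WithLp.toLp 2 fun p => if p.1 = i then e p.2 else 0

lemma emb_coord (i : Fin n) (e : EuclideanSpace ℝ (Fin d)) (p) :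
    emb i e p = if p.1 = i then e p.2 else 0 := rfl

lemma blkv_coord (x : ESp n d) (i : Fin n) (k) : blkv x i k = x (i, k) := rfl

lemma inner_emb (x : ESp n d) (i : Fin n) (e : EuclideanSpace ℝ (Fin d)) :
    inner ℝ x (emb i e) = inner ℝ (blkv x i) e := by
  simp only [PiLp.inner_apply, Fintype.sum_prod_type, emb_coord, blkv_coord, RCLike.inner_apply,
    conj_trivial]
  rw [Finset.sum_eq_single i (fun b _ hb => by simp [hb]) (by simp)]
  simp

lemma blkv_emb (i : Fin n) (e : EuclideanSpace ℝ (Fin d)) : blkv (emb i e) i = e := by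
  ext k; simp [blkv_coord, emb_coord]

lemma norm_emb (i : Fin n) (e : EuclideanSpace ℝ (Fin d)) : ‖emb i e‖ = ‖e‖ := by
  rw [← sq_eq_sq₀ (norm_nonneg _) (norm_nonneg _), ← real_inner_self_eq_norm_sq, inner_emb,
    blkv_emb, real_inner_self_eq_norm_sq]

lemma sum_emb_blkv (x : ESp n d) : ∑ i, emb i (blkv x i) = x := by
  ext p
  simp [emb_coord, blkv_coord]

lemma norm_blkv_le (x : ESp n d) (i : Fin n) : ‖blkv x i‖ ≤ ‖x‖ := by
  by_cases h : ‖blkv x i‖ = 0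
  · rw [h]; positivity
  have h1 := real_inner_le_norm x (emb i (blkv x i))
  rw [inner_emb, real_inner_self_eq_norm_sq, norm_emb, pow_two] at h1
  exact le_of_mul_le_mul_right h1 (lt_of_le_of_ne (norm_nonneg _) (Ne.symm h))

lemma norm_le_sum_blkv (x : ESp n d) : ‖x‖ ≤ ∑ i, ‖blkv x i‖ := by
  conv_lhs => rw [← sum_emb_blkv x]
  exact (norm_sum_le _ _).trans (by simp [norm_emb])

lemma blkv_sub (x y : ESp n d) (i : Fin n) : blkv (x - y) i = blkv x i - blkv y i := rfl

lemma blkv_smul (c : ℝ) (x : ESp n d) (i : Fin n) : blkv (c • x) i = c • blkv x i := rfl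

lemma inner_emb_mul_emb (M : Matrix (Fin n × Fin d) (Fin n × Fin d) ℝ) (i j : Fin n)
    (ξ η : EuclideanSpace ℝ (Fin d)) :
    inner ℝ (emb i ξ) (Matrix.toEuclideanLin M (emb j η))
      = inner ℝ ξ (Matrix.toEuclideanLin (blk M i j) η) := by
  rw [real_inner_comm, inner_emb, real_inner_comm]
  congr 1
  ext k
  rw [blkv_coord, toEuclideanLin_coord, toEuclideanLin_coord, Fintype.sum_prod_type,
    Finset.sum_eq_single j (fun b _ hb => by simp [hb, emb_coord]) (by simp)]
  simp [emb_coord, blk]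

/-- The bilinear form `⟨x, M y⟩`, as a linear form in `M`. -/
def matForm (x y : ESp n d) : Matrix (Fin n × Fin d) (Fin n × Fin d) ℝ →L[ℝ] ℝ :=
  LinearMap.toContinuousLinearMap
    { toFun := fun M => inner ℝ x (Matrix.toEuclideanLin M y)
      map_add' := fun M N => by simp [inner_add_right]
      map_smul' := fun c M => by simp [inner_smul_right] }

lemma matForm_apply (x y : ESp n d) (M) :
    matForm x y M = inner ℝ x (Matrix.toEuclideanLin M y) := rfl

lemma matForm_le (x y : ESp n d) (M) : |matForm x y M| ≤ ‖x‖ * (‖M‖ * ‖y‖) := by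
  rw [matForm_apply]
  exact (abs_real_inner_le_norm _ _).trans
    (mul_le_mul_of_nonneg_left (norm_toEuclideanLin_le _ _) (norm_nonneg _))

end Blocks

/-! ### Observability of the chain -/

/-- A flow on `[0, 1]` of a block Hessenberg system with uniformly positive subdiagonal. -/
structure IsChainFlow (n d : ℕ) (K aLow : ℝ) (A : ℝ → Matrix (Fin n × Fin d) (Fin n × Fin d) ℝ)
    (R : ℝ → ℝ → Matrix (Fin n × Fin d) (Fin n × Fin d) ℝ) : Prop where
  flow : IsFlow 0 1 K A R
  hess : ∀ t ∈ Icc (0 : ℝ) 1, ∀ i j : Fin n, (j : ℕ) + 1 < i → ∀ ξ η,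
    matForm (emb i ξ) (emb j η) (A t) = 0
  horm : ∀ t ∈ Icc (0 : ℝ) 1, ∀ i j : Fin n, (j : ℕ) + 1 = i → ∀ ξ,
    aLow * ‖ξ‖ ^ 2 ≤ matForm (emb i ξ) (emb j ξ) (A t)

/-- A bound on the resolvents on `[0, 1]`. -/
def flowBound (n d : ℕ) (K : ℝ) : ℝ :=
  ‖(1 : Matrix (Fin n × Fin d) (Fin n × Fin d) ℝ)‖ * Real.exp (K * (1 - 0))

lemma flowBound_nonneg (n d : ℕ) (K : ℝ) : 0 ≤ flowBound n d K := by unfold flowBound; positivity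

namespace IsChainFlow
variable {n d : ℕ} {K aLow : ℝ} {A : ℝ → Matrix (Fin n × Fin d) (Fin n × Fin d) ℝ}
  {R : ℝ → ℝ → Matrix (Fin n × Fin d) (Fin n × Fin d) ℝ}

lemma hess_integral (F : IsChainFlow n d K aLow A R) {v w : ℝ} (hv : v ∈ Icc (0 : ℝ) 1)
    (hw : w ∈ Icc (0 : ℝ) 1) {i j : Fin n} (hij : (j : ℕ) + 1 < i) (ξ η) :
    matForm (emb i ξ) (emb j η) (∫ u in v..w, A u) = 0 := by
  rw [← ContinuousLinearMap.intervalIntegral_comp_comm _ (F.flow.intervalIntegrable hv hw)]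
  rw [intervalIntegral.integral_congr (g := fun _ => (0 : ℝ))
    (fun u hu => F.hess u (uIcc_subset_Icc hv hw hu) i j hij ξ η)]
  simp

lemma horm_integral (F : IsChainFlow n d K aLow A R) {v w : ℝ} (hv : v ∈ Icc (0 : ℝ) 1)
    (hw : w ∈ Icc (0 : ℝ) 1) (hvw : v ≤ w) {i j : Fin n} (hij : (j : ℕ) + 1 = i) (ξ) :
    aLow * (w - v) * ‖ξ‖ ^ 2 ≤ matForm (emb i ξ) (emb j ξ) (∫ u in v..w, A u) := by
  have hI := F.flow.intervalIntegrable hv hw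
  rw [← ContinuousLinearMap.intervalIntegral_comp_comm _ hI]
  have h1 : aLow * (w - v) * ‖ξ‖ ^ 2 = ∫ u in v..w, aLow * ‖ξ‖ ^ 2 := by
    rw [intervalIntegral.integral_const, smul_eq_mul]; ring
  rw [h1]
  refine intervalIntegral.integral_mono_on hvw intervalIntegrable_const ?_ fun u hu =>
    F.horm u ⟨hv.1.trans hu.1, hu.2.trans hw.2⟩ i j hij ξ
  exact ⟨(matForm _ _).integrable_comp hI.1, (matForm _ _).integrable_comp hI.2⟩

lemma norm_integral_le (F : IsChainFlow n d K aLow A R) {v w : ℝ} (hv : v ∈ Icc (0 : ℝ) 1)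
    (hw : w ∈ Icc (0 : ℝ) 1) (hvw : v ≤ w) : ‖∫ u in v..w, A u‖ ≤ K * (w - v) := by
  have := intervalIntegral.norm_integral_le_of_norm_le_const (a := v) (b := w) (C := K) (f := A)
    (fun u hu => F.flow.bound u (IsFlow.uIcc_sub hv hw hu))
  rwa [abs_of_nonneg (sub_nonneg.2 hvw)] at this

/-- The adjoint trajectory `v ↦ R_{1,v}^* q`. -/
def adj (R : ℝ → ℝ → Matrix (Fin n × Fin d) (Fin n × Fin d) ℝ) (q : ESp n d) (v : ℝ) : ESp n d :=
  Matrix.toEuclideanLin (R 1 v)ᵀ q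

lemma norm_adj_le (F : IsChainFlow n d K aLow A R) (q : ESp n d) {v : ℝ}
    (hv : v ∈ Icc (0 : ℝ) 1) : ‖adj R q v‖ ≤ flowBound n d K * ‖q‖ := by
  refine (norm_toEuclideanLin_le _ _).trans ?_
  rw [l2_norm_transpose]
  exact mul_le_mul_of_nonneg_right (F.flow.norm_le hv ⟨zero_le_one, le_rfl⟩) (norm_nonneg _)

lemma norm_adj_sub_le (F : IsChainFlow n d K aLow A R) (q : ESp n d) {v w : ℝ}
    (hv : v ∈ Icc (0 : ℝ) 1) (hw : w ∈ Icc (0 : ℝ) 1) :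
    ‖adj R q v - adj R q w‖
      ≤ flowBound n d K * (K * flowBound n d K) * |v - w| * ‖q‖ := by
  have : adj R q v - adj R q w = Matrix.toEuclideanLin (R 1 v - R 1 w)ᵀ q := by
    simp [adj, Matrix.transpose_sub]
  rw [this]
  refine (norm_toEuclideanLin_le _ _).trans ?_
  rw [l2_norm_transpose]
  exact mul_le_mul_of_nonneg_right (F.flow.norm_sub_le ⟨zero_le_one, le_rfl⟩ hv hw) (norm_nonneg _)

lemma inner_adj (F : IsChainFlow n d K aLow A R) (q x : ESp n d) {v w : ℝ}
    (hv : v ∈ Icc (0 : ℝ) 1) (hw : w ∈ Icc (0 : ℝ) 1) :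
    inner ℝ (adj R q v) x = matForm (adj R q w) x (R w v) := by
  rw [matForm_apply, adj, adj, ← F.flow.cocycle ⟨zero_le_one, le_rfl⟩ hw hv, Matrix.transpose_mul,
    inner_toEuclideanLin]
  simp

/-- If the first blocks of the adjoint trajectory are small, so is the next one. -/
lemma adj_step (F : IsChainFlow n d K aLow A R) (q : ESp n d) {v w : ℝ}
    (hv : v ∈ Icc (0 : ℝ) 1) (hw : w ∈ Icc (0 : ℝ) 1) (hvw : v ≤ w) {i j : Fin n}
    (hij : (j : ℕ) + 1 = i) {ε : ℝ} (h1 : ‖blkv (adj R q v) j‖ ≤ ε)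
    (h2 : ∀ l ≤ j, ‖blkv (adj R q w) l‖ ≤ ε) :
    aLow * (w - v) * ‖blkv (adj R q w) i‖ ≤ 2 * ε + n * (K * (w - v) * ε)
      + flowBound n d K * ‖q‖ * (K * (K * flowBound n d K) * (w - v) ^ 2) := by
  set e := blkv (adj R q w) i with he
  have hε : 0 ≤ ε := (norm_nonneg _).trans h1
  have hK := F.flow.K_nonneg zero_le_one
  have hwv : 0 ≤ w - v := sub_nonneg.2 hvw
  rcases eq_or_lt_of_le (norm_nonneg e) with h0 | h0
  · rw [← h0, mul_zero]
    have := flowBound_nonneg n d K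
    positivity
  set 𝓐 := ∫ u in v..w, A u with hA
  set E := R w v - 1 - 𝓐 with hE
  have hR : R w v = 1 + 𝓐 + E := by rw [hE]; abel
  have hEn : ‖E‖ ≤ K * (K * flowBound n d K) * (w - v) ^ 2 := by
    have := F.flow.norm_sub_integral_le hv hw
    rwa [abs_of_nonneg hwv] at this
  have e1 : inner ℝ (adj R q v) (emb j e) = inner ℝ (adj R q w) (emb j e)
      + matForm (adj R q w) (emb j e) 𝓐 + matForm (adj R q w) (emb j e) E := by
    rw [F.inner_adj q _ hv hw, hR, map_add, map_add]
    congr 2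
    simp [matForm_apply]
  have e2 : matForm (adj R q w) (emb j e) 𝓐
      = ∑ l, matForm (emb l (blkv (adj R q w) l)) (emb j e) 𝓐 := by
    simp only [matForm_apply]
    rw [← sum_inner, sum_emb_blkv]
  have e3 : ∀ l, (if l = i then aLow * (w - v) * ‖e‖ ^ 2 else 0) - K * (w - v) * ε * ‖e‖
      ≤ matForm (emb l (blkv (adj R q w) l)) (emb j e) 𝓐 := fun l => by
    have hp : 0 ≤ K * (w - v) * ε * ‖e‖ := by positivity
    split_ifs with hl
    · rw [hl]
      linarith [F.horm_integral hv hw hvw hij e]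
    · rcases lt_or_ge j l with hjl | hjl
      · have : (j : ℕ) + 1 < l := by
          have h3 : (j : ℕ) < l := hjl
          have h4 : (l : ℕ) ≠ i := fun h => hl (Fin.ext h)
          omega
        rw [F.hess_integral hv hw this]
        linarith
      · have h3 := (abs_le.1 (matForm_le (emb l (blkv (adj R q w) l)) (emb j e) 𝓐)).1
        rw [norm_emb, norm_emb] at h3
        have h4 := F.norm_integral_le hv hw hvw
        have h5 : ‖blkv (adj R q w) l‖ * (‖𝓐‖ * ‖e‖) ≤ ε * (K * (w - v) * ‖e‖) := by
          gcongr
          exact h2 l hjl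
        linarith
  have e4 := Finset.sum_le_sum fun l (_ : l ∈ Finset.univ) => e3 l
  rw [← e2, Finset.sum_sub_distrib, Finset.sum_ite_eq' Finset.univ i] at e4
  simp only [Finset.mem_univ, if_true, Finset.sum_const, Finset.card_univ, Fintype.card_fin,
    nsmul_eq_mul] at e4
  have e5 : inner ℝ (adj R q v) (emb j e) ≤ ε * ‖e‖ := by
    rw [inner_emb]
    exact (real_inner_le_norm _ _).trans (mul_le_mul_of_nonneg_right h1 (norm_nonneg _))
  have e6 : -(ε * ‖e‖) ≤ inner ℝ (adj R q w) (emb j e) := by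
    rw [inner_emb]
    have := (abs_le.1 (abs_real_inner_le_norm (blkv (adj R q w) j) e)).1
    have := mul_le_mul_of_nonneg_right (h2 j le_rfl) (norm_nonneg e)
    linarith
  have e7 : -(flowBound n d K * ‖q‖ * (K * (K * flowBound n d K) * (w - v) ^ 2 * ‖e‖))
      ≤ matForm (adj R q w) (emb j e) E := by
    have h3 := (abs_le.1 (matForm_le (adj R q w) (emb j e) E)).1
    rw [norm_emb] at h3
    have h4 : ‖adj R q w‖ * (‖E‖ * ‖e‖) ≤ flowBound n d K * ‖q‖
        * (K * (K * flowBound n d K) * (w - v) ^ 2 * ‖e‖) := by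
      exact mul_le_mul (F.norm_adj_le q hw) (by gcongr) (by positivity)
        ((norm_nonneg _).trans (F.norm_adj_le q hw))
    linarith
  refine le_of_mul_le_mul_right ?_ h0
  linarith

/-- Smallness of the first block of the adjoint trajectory propagates to the other blocks. -/
lemma adj_small (n d : ℕ) {K aLow : ℝ} (haLow : 0 < aLow) (hK : 0 ≤ K) (k : ℕ) {η : ℝ}
    (hη : 0 < η) : ∃ ε > 0, ∀ A R, IsChainFlow n d K aLow A R → ∀ q : ESp n d, ‖q‖ = 1 →
      (∀ v ∈ Icc (0 : ℝ) 1, ∀ i : Fin n, (i : ℕ) = 0 → ‖blkv (adj R q v) i‖ ≤ ε) →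
      ∀ i : Fin n, (i : ℕ) ≤ k → ∀ v ∈ Icc ((k : ℝ) / n) 1, ‖blkv (adj R q v) i‖ ≤ η := by
  induction k generalizing η with
  | zero =>
    refine ⟨η, hη, fun A R F q hq h i hi v hv => h v ?_ i (by omega)⟩
    simpa using hv
  | succ k ih =>
    rcases Nat.eq_zero_or_pos n with hn | hn
    · subst hn
      exact ⟨1, one_pos, fun A R F q hq h i => i.elim0⟩
    have hn' : (0 : ℝ) < n := by exact_mod_cast hn
    set L := flowBound n d K
    have hL : 0 ≤ L := flowBound_nonneg n d K
    set D := L * (K * (K * L)) with hD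
    have hD0 : 0 ≤ D := by positivity
    set h := min (1 / (n : ℝ)) (aLow * η / (2 * (D + 1))) with hh
    have hpos : 0 < h := by positivity
    have hDh : D * h ≤ aLow * η / 2 := by
      have : h ≤ aLow * η / (2 * (D + 1)) := min_le_right _ _
      calc D * h ≤ (D + 1) * (aLow * η / (2 * (D + 1))) := by gcongr; linarith
        _ = aLow * η / 2 := by field_simp
    set ε' := min η (aLow * h * η / (2 * (2 + n * (K * h)))) with hε'
    have hε'0 : 0 < ε' := by positivity
    have hε'1 : (2 + n * (K * h)) * ε' ≤ aLow * h * η / 2 := by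
      have : ε' ≤ aLow * h * η / (2 * (2 + n * (K * h))) := min_le_right _ _
      calc _ ≤ (2 + n * (K * h)) * (aLow * h * η / (2 * (2 + n * (K * h)))) := by gcongr
        _ = _ := by field_simp
    obtain ⟨ε, hε, H⟩ := ih hε'0
    refine ⟨ε, hε, fun A R F q hq h0 i hi w hw => ?_⟩
    have hh1 : h ≤ 1 / n := min_le_left _ _
    have hk0 : (0 : ℝ) ≤ k / n := by positivity
    have hkn : ((k + 1 : ℕ) : ℝ) / n = k / n + 1 / n := by push_cast; ring
    rw [hkn] at hw
    have hw1 : w ∈ Icc ((k : ℝ) / n) 1 := ⟨by linarith [hw.1], hw.2⟩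
    have hv1 : w - h ∈ Icc ((k : ℝ) / n) 1 := ⟨by linarith [hw.1], by linarith [hw.2]⟩
    have IH := H A R F q hq h0
    rcases Nat.lt_or_ge k i with hki | hki
    · have hik : k + 1 = (i : ℕ) := by omega
      have hkn' : k < n := by omega
      have hstep := F.adj_step q (v := w - h) (w := w) (i := i) (j := ⟨k, hkn'⟩) (ε := ε')
        ⟨by linarith [hv1.1], hv1.2⟩ ⟨by linarith [hw1.1], hw1.2⟩ (by linarith) hik
        (IH _ le_rfl _ hv1) (fun l hl => IH l hl w hw1)
      rw [hq, sub_sub_cancel] at hstep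
      have h8 : L * 1 * (K * (K * L) * h ^ 2) = D * h * h := by rw [hD]; ring
      rw [h8] at hstep
      have h9 : D * h * h ≤ aLow * η / 2 * h := by gcongr
      have h10 : aLow * h * ‖blkv (adj R q w) i‖ ≤ aLow * h * η := by linarith
      exact le_of_mul_le_mul_left h10 (by positivity)
    · exact (IH i hki w hw1).trans (min_le_left _ _)

/-- Uniform observability of the chain through its first block. -/
theorem observability (n d : ℕ) (hn : 1 ≤ n) {K aLow : ℝ} (haLow : 0 < aLow) (hK : 0 ≤ K)
    {α : ℝ} (hα : 0 < α) : ∃ c > 0, ∀ A R, IsChainFlow n d K aLow A R → ∀ q : ESp n d,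
      c * ‖q‖ ^ α ≤ ∫ v in (0 : ℝ)..1, ‖blkv (adj R q v) ⟨0, hn⟩‖ ^ α := by
  have hn' : (0 : ℝ) < n := by exact_mod_cast hn
  obtain ⟨ε, hε, H⟩ := adj_small n d haLow hK (n - 1) (η := 1 / (2 * n)) (by positivity)
  set L := flowBound n d K * (K * flowBound n d K) with hLdef
  have hL : 0 ≤ L := by have := flowBound_nonneg n d K; positivity
  set δ := min (1 / 2) (ε / (2 * (L + 1))) with hδ
  have hδ0 : 0 < δ := by positivity
  have hδ1 : δ ≤ 1 / 2 := min_le_left _ _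
  have hδL : L * δ ≤ ε / 2 := by
    calc L * δ ≤ (L + 1) * (ε / (2 * (L + 1))) := by
          gcongr
          · linarith
          · exact min_le_right _ _
      _ = ε / 2 := by field_simp
  refine ⟨δ * (ε / 2) ^ α, by positivity, fun A R F => ?_⟩
  have key : ∀ q : ESp n d, ‖q‖ = 1 →
      δ * (ε / 2) ^ α ≤ ∫ v in (0 : ℝ)..1, ‖blkv (adj R q v) ⟨0, hn⟩‖ ^ α := by
    intro q hq
    obtain ⟨v, hv, hvε⟩ : ∃ v ∈ Icc (0 : ℝ) 1, ε < ‖blkv (adj R q v) ⟨0, hn⟩‖ := by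
      by_contra! hcon
      have h1 := H A R F q hq (fun v hv i hi => by
        have : i = ⟨0, hn⟩ := Fin.ext hi
        rw [this]; exact hcon v hv)
      have h2 : ∀ i : Fin n, ‖blkv q i‖ ≤ 1 / (2 * n) := fun i => by
        have h3 := h1 i (by omega) 1 ⟨by
          rw [div_le_one hn']
          exact_mod_cast Nat.sub_le n 1, le_rfl⟩
        have h4 : adj R q 1 = q := by
          rw [adj, F.flow.self ⟨zero_le_one, le_rfl⟩]; simp
        rwa [h4] at h3
      have h3 := (norm_le_sum_blkv q).trans (Finset.sum_le_sum fun i _ => h2 i)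
      rw [hq, Finset.sum_const, Finset.card_univ, Fintype.card_fin, nsmul_eq_mul] at h3
      have : (n : ℝ) * (1 / (2 * n)) = 1 / 2 := by field_simp
      linarith
    have hcont : ContinuousOn (fun v => adj R q v) (Icc 0 1) := by
      refine (LipschitzOnWith.of_dist_le_mul (K := L.toNNReal) fun x hx y hy => ?_).continuousOn
      have := F.norm_adj_sub_le q hx hy
      rw [hq, mul_one] at this
      rwa [dist_eq_norm, Real.coe_toNNReal _ hL]
    have hcb : ContinuousOn (fun v => ‖blkv (adj R q v) ⟨0, hn⟩‖ ^ α) (Icc 0 1) := by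
      have hb : Continuous fun x : ESp n d => blkv x ⟨0, hn⟩ := by
        unfold blkv; fun_prop
      exact (hb.comp_continuousOn hcont).norm.rpow_const fun x _ => Or.inr hα.le
    obtain ⟨a, ha0, ha1, hav⟩ : ∃ a : ℝ, 0 ≤ a ∧ a + δ ≤ 1 ∧ ∀ w ∈ Icc a (a + δ), |w - v| ≤ δ := by
      rcases le_total v (1 / 2) with h | h
      · refine ⟨v, hv.1, by linarith, fun w hw => ?_⟩
        rw [abs_le]; constructor <;> linarith [hw.1, hw.2]
      · refine ⟨v - δ, by linarith, by linarith [hv.2], fun w hw => ?_⟩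
        rw [abs_le]; constructor <;> linarith [hw.1, hw.2]
    have hlow : ∀ w ∈ Icc a (a + δ), ε / 2 ≤ ‖blkv (adj R q w) ⟨0, hn⟩‖ := fun w hw => by
      have hw01 : w ∈ Icc (0 : ℝ) 1 := ⟨ha0.trans hw.1, hw.2.trans ha1⟩
      have h1 := F.norm_adj_sub_le q hw01 hv
      have h2 : L * |w - v| * ‖q‖ ≤ ε / 2 := by
        rw [hq, mul_one]
        exact (mul_le_mul_of_nonneg_left (hav w hw) hL).trans hδL
      have h3 := norm_blkv_le (adj R q v - adj R q w) ⟨0, hn⟩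
      rw [blkv_sub, norm_sub_rev (adj R q v)] at h3
      have h4 := norm_sub_norm_le (blkv (adj R q v) ⟨0, hn⟩) (blkv (adj R q w) ⟨0, hn⟩)
      linarith
    have hint : IntervalIntegrable (fun v => ‖blkv (adj R q v) ⟨0, hn⟩‖ ^ α) volume 0 1 :=
      hcb.intervalIntegrable_of_Icc zero_le_one
    calc δ * (ε / 2) ^ α = ∫ v in a..(a + δ), (ε / 2) ^ α := by simp
      _ ≤ ∫ v in a..(a + δ), ‖blkv (adj R q v) ⟨0, hn⟩‖ ^ α := by
          refine intervalIntegral.integral_mono_on (by linarith) intervalIntegrable_const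
            (hint.mono_set ?_) fun w hw => ?_
          · rw [uIcc_of_le (by linarith), uIcc_of_le zero_le_one]
            exact Icc_subset_Icc ha0 ha1
          · exact Real.rpow_le_rpow (by positivity) (hlow w hw) hα.le
      _ ≤ _ := by
          refine intervalIntegral.integral_mono_interval ha0 (by linarith) ha1 ?_ hint
          exact Eventually.of_forall fun w => by positivity
  intro q
  rcases eq_or_ne q 0 with rfl | hq
  · rw [norm_zero, Real.zero_rpow hα.ne', mul_zero]
    exact intervalIntegral.integral_nonneg zero_le_one fun v _ => by positivity
  have hq0 : 0 < ‖q‖ := norm_pos_iff.2 hq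
  have h1 := key (‖q‖⁻¹ • q) (by rw [norm_smul]; simp [hq0.ne'])
  have h2 : ∀ v, ‖blkv (adj R (‖q‖⁻¹ • q) v) ⟨0, hn⟩‖ ^ α
      = (‖q‖ ^ α)⁻¹ * ‖blkv (adj R q v) ⟨0, hn⟩‖ ^ α := fun v => by
    rw [adj, map_smul, blkv_smul, norm_smul, Real.mul_rpow (norm_nonneg _) (norm_nonneg _),
      norm_inv, norm_norm, Real.inv_rpow hq0.le]
    rfl
  simp only [h2] at h1
  rw [intervalIntegral.integral_const_mul] at h1
  have h3 : 0 < ‖q‖ ^ α := by positivity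
  calc δ * (ε / 2) ^ α * ‖q‖ ^ α ≤ _ := mul_le_mul_of_nonneg_right h1 h3.le
    _ = _ := by field_simp

end IsChainFlow
end StableChain

namespace StableChain
open scoped Matrix.Norms.L2Operator

/-! ### The resolvent as a flow, and its multi-scale normalization -/
section Resolvent
variable {n d : ℕ} {aLow aUp : ℝ} {A : ℝ → Matrix (Fin n × Fin d) (Fin n × Fin d) ℝ}
  {R : ℝ → ℝ → Matrix (Fin n × Fin d) (Fin n × Fin d) ℝ}

/-- A bound on the operator norm of the drift. -/
def driftBound (n d : ℕ) (aUp : ℝ) : ℝ := ((n * d : ℕ) : ℝ) * (((n * d : ℕ) : ℝ) * aUp)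

lemma norm_le_driftBound {M : Matrix (Fin n × Fin d) (Fin n × Fin d) ℝ}
    (h : ∀ p q, |M p q| ≤ aUp) : ‖M‖ ≤ driftBound n d aUp := by
  refine (l2_norm_le_sum_abs M).trans ((Finset.sum_le_sum fun p _ => Finset.sum_le_sum
    fun q _ => h p q).trans (le_of_eq ?_))
  simp [driftBound]

lemma DriftCondition.abs_le (hA : DriftCondition n d aLow aUp A) {t : ℝ} (ht : 0 ≤ t) (p q) :
    |A t p q| ≤ aUp :=
  (abs_entry_le (blk (A t) p.1 q.1) p.2 q.2).trans (hA.bounded t ht p.1 q.1)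

lemma entry_clm (p q : Fin n × Fin d) : ∃ ℓ : Matrix (Fin n × Fin d) (Fin n × Fin d) ℝ →L[ℝ] ℝ,
    ∀ M, ℓ M = M p q :=
  ⟨LinearMap.toContinuousLinearMap (Matrix.entryLinearMap ℝ ℝ p q), fun _ => rfl⟩

lemma aestronglyMeasurable_matrix {μ : Measure ℝ} (h : ∀ p q, Measurable fun t => A t p q) :
    AEStronglyMeasurable A μ := by
  have : A = fun t => ∑ p, ∑ q, A t p q • Matrix.single p q (1 : ℝ) := by
    ext1 t
    conv_lhs => rw [Matrix.matrix_eq_sum_single (A t)]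
    simp [Matrix.smul_single]
  rw [this]
  refine (Finset.stronglyMeasurable_fun_sum _ fun p _ =>
    Finset.stronglyMeasurable_fun_sum _ fun q _ => ?_).aestronglyMeasurable
  exact (h p q).stronglyMeasurable.smul_const _

theorem IsResolvent.isFlow (hR : IsResolvent A R) (hA : DriftCondition n d aLow aUp A) (b : ℝ) :
    IsFlow 0 b (driftBound n d aUp) A R := by
  have hm : AEStronglyMeasurable A (volume.restrict (Icc 0 b)) :=
    aestronglyMeasurable_matrix hA.measurable
  have hb : ∀ u ∈ Icc 0 b, ‖A u‖ ≤ driftBound n d aUp := fun u hu =>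
    norm_le_driftBound fun p q => hA.abs_le hu.1 p q
  have hc : ∀ t ∈ Icc 0 b, ContinuousOn (fun s => R s t) (Icc 0 b) := fun t ht =>
    continuousOn_pi.2 fun i => continuousOn_pi.2 fun j =>
      ((hR t ht.1).1 i j).mono Icc_subset_Ici_self
  refine ⟨hm, hb, hc, fun t ht s hs => ?_⟩
  have hI := IsFlow.intervalIntegrable_mul' hm hb (hc t ht) ht hs
  ext p q
  obtain ⟨ℓ, hℓ⟩ := entry_clm p q
  have h := ℓ.intervalIntegral_comp_comm hI
  simp only [hℓ] at h
  rw [(hR t ht.1).2 s hs.1 p q, h, Matrix.add_apply]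

lemma scaleM_mul_inv {u : ℝ} (hu : u ≠ 0) : scaleM n d u * scaleM n d u⁻¹ = 1 := by
  rw [scaleM, scaleM, Matrix.diagonal_mul_diagonal, ← Matrix.diagonal_one]
  congr 1; ext i
  rw [← mul_pow, mul_inv_cancel₀ hu, one_pow]

lemma scaleM_inv_mul {u : ℝ} (hu : u ≠ 0) : scaleM n d u⁻¹ * scaleM n d u = 1 := by
  simpa using scaleM_mul_inv (n := n) (d := d) (inv_ne_zero hu)

lemma scaleM_inv {u : ℝ} (hu : u ≠ 0) : (scaleM n d u)⁻¹ = scaleM n d u⁻¹ :=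
  Matrix.inv_eq_right_inv (scaleM_mul_inv hu)

/-- The normalized drift `τ 𝕄_τ⁻¹ A_{t+τv} 𝕄_τ`. -/
def scaledDrift (A : ℝ → Matrix (Fin n × Fin d) (Fin n × Fin d) ℝ) (t τ v : ℝ) :
    Matrix (Fin n × Fin d) (Fin n × Fin d) ℝ :=
  τ • (scaleM n d τ⁻¹ * A (t + τ * v) * scaleM n d τ)

/-- The normalized resolvent `𝕄_τ⁻¹ R_{t+τv,t+τw} 𝕄_τ`. -/
def scaledRes (R : ℝ → ℝ → Matrix (Fin n × Fin d) (Fin n × Fin d) ℝ) (t τ v w : ℝ) :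
    Matrix (Fin n × Fin d) (Fin n × Fin d) ℝ :=
  scaleM n d τ⁻¹ * R (t + τ * v) (t + τ * w) * scaleM n d τ

lemma scaledDrift_apply (t τ v : ℝ) (p q) :
    scaledDrift A t τ v p q = τ * ((τ ^ (p.1 : ℕ))⁻¹ * A (t + τ * v) p q * τ ^ (q.1 : ℕ)) := by
  simp [scaledDrift, scaleM, Matrix.diagonal_mul, Matrix.mul_diagonal]

theorem isChainFlow (hA : DriftCondition n d aLow aUp A) (hR : IsResolvent A R) (haUp : 0 < aUp)
    {t τ : ℝ} (ht : 0 ≤ t) (hτ : 0 < τ) (hτ1 : τ ≤ 1) :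
    IsChainFlow n d (driftBound n d aUp) aLow (scaledDrift A t τ) (scaledRes R t τ) := by
  have hpos : ∀ v ∈ Icc (0 : ℝ) 1, 0 ≤ t + τ * v := fun v hv => by
    have := mul_nonneg hτ.le hv.1; linarith
  have hzero : ∀ v ∈ Icc (0 : ℝ) 1, ∀ p q : Fin n × Fin d, (q.1 : ℕ) + 1 < p.1 →
      A (t + τ * v) p q = 0 := fun v hv p q hpq => by
    have := hA.hessenberg _ (hpos v hv) p.1 q.1 hpq
    exact congrFun (congrFun this p.2) q.2
  refine ⟨(hR.isFlow hA (t + τ)).rescale (scaleM_inv_mul hτ.ne') (scaleM_mul_inv hτ.ne') hτ ht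
    le_rfl fun v hv => norm_le_driftBound fun p q => ?_, fun v hv i j hij ξ η => ?_,
    fun v hv i j hij ξ => ?_⟩
  · change |scaledDrift A t τ v p q| ≤ aUp
    rw [scaledDrift_apply]
    rcases lt_or_ge ((q.1 : ℕ) + 1) p.1 with h | h
    · rw [hzero v hv p q h]; simpa using haUp.le
    · have h1 : τ * ((τ ^ (p.1 : ℕ))⁻¹ * A (t + τ * v) p q * τ ^ (q.1 : ℕ))
          = τ ^ ((q.1 : ℕ) + 1 - p.1) * A (t + τ * v) p q := by
        rw [pow_sub₀ _ hτ.ne' h, pow_succ]; ring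
      rw [h1, abs_mul, abs_of_nonneg (by positivity)]
      calc _ ≤ 1 * aUp := mul_le_mul (pow_le_one₀ hτ.le hτ1) (hA.abs_le (hpos v hv) p q)
            (abs_nonneg _) zero_le_one
        _ = aUp := one_mul _
  · rw [matForm_apply, inner_emb_mul_emb]
    have : blk (scaledDrift A t τ v) i j = 0 := by
      ext k l
      change scaledDrift A t τ v (i, k) (j, l) = 0
      rw [scaledDrift_apply, hzero v hv (i, k) (j, l) hij]; simp
    rw [this]; simp
  · rw [matForm_apply, inner_emb_mul_emb]
    have : blk (scaledDrift A t τ v) i j = blk (A (t + τ * v)) i j := by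
      ext k l
      change scaledDrift A t τ v (i, k) (j, l) = A (t + τ * v) (i, k) (j, l)
      rw [scaledDrift_apply]
      simp only [← hij]
      rw [pow_succ]; field_simp
    rw [this, real_inner_comm]
    exact (hA.hormander _ (hpos v hv) i j hij ξ).1

lemma injB_apply (hn : 1 ≤ n) (x : EuclideanSpace ℝ (Fin d)) :
    Matrix.toEuclideanLin (injB n d) x = emb ⟨0, hn⟩ x := by
  ext p
  rw [toEuclideanLin_coord, emb_coord]
  by_cases h : (p.1 : ℕ) = 0
  · have h' : p.1 = ⟨0, hn⟩ := Fin.ext h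
    simp [injB, h']
  · simp [injB, h, Fin.ext_iff]

lemma scaleM_mul_injB (u : ℝ) : scaleM n d u * injB n d = injB n d := by
  ext p l
  rw [scaleM, Matrix.diagonal_mul, injB, Matrix.of_apply]
  by_cases h : (p.1 : ℕ) = 0
  · simp [h]
  · simp [h]

end Resolvent
end StableChain

namespace StableChain

/-! ### Radial integrals -/
section Radial
variable {α : ℝ}

lemma one_sub_cos_nonneg (x : ℝ) : 0 ≤ 1 - Real.cos x := sub_nonneg.2 (Real.cos_le_one x)

lemma one_sub_cos_le (x : ℝ) : 1 - Real.cos x ≤ 2 * min 1 (x ^ 2) := by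
  rw [mul_min_of_nonneg _ _ zero_le_two]
  refine le_min (by linarith [Real.neg_one_le_cos x]) ?_
  have := Real.one_sub_sq_div_two_le_cos (x := x)
  nlinarith [sq_nonneg x]

lemma integrableOn_min_div_rpow (hα : 0 < α) (hα' : α < 2) :
    IntegrableOn (fun r : ℝ => min 1 (r ^ 2) / r ^ (1 + α)) (Ioi 0) := by
  rw [← Ioc_union_Ioi_eq_Ioi zero_le_one, integrableOn_union]
  constructor
  · have h := (intervalIntegral.intervalIntegrable_rpow' (a := 0) (b := 1) (r := 1 - α)
      (by linarith)).1
    refine h.congr_fun (fun r hr => ?_) measurableSet_Ioc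
    have h1 : r ^ 2 ≤ 1 := by nlinarith [hr.1, hr.2]
    simp only [min_eq_right h1]
    rw [show (1 : ℝ) - α = 2 - (1 + α) by ring, Real.rpow_sub hr.1]
    norm_num
  · refine (integrableOn_Ioi_rpow_of_lt (a := -(1 + α)) (by linarith) one_pos).congr_fun
      (fun r hr => ?_) measurableSet_Ioi
    have hr' : (1 : ℝ) < r := hr
    have h1 : 1 ≤ r ^ 2 := by nlinarith
    simp only [min_eq_left h1]
    rw [Real.rpow_neg (by linarith), one_div]

lemma integrableOn_stableConst (hα : 0 < α) (hα' : α < 2) :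
    IntegrableOn (fun r : ℝ => (1 - Real.cos r) / r ^ (1 + α)) (Ioi 0) := by
  refine ((integrableOn_min_div_rpow hα hα').const_mul 2).mono' ?_ ?_
  · exact (Measurable.div (by fun_prop) (by fun_prop)).aestronglyMeasurable
  · refine (ae_restrict_mem measurableSet_Ioi).mono fun r hr => ?_
    have : 0 < r ^ (1 + α) := Real.rpow_pos_of_pos hr _
    rw [Real.norm_eq_abs, abs_of_nonneg (div_nonneg (one_sub_cos_nonneg r) this.le),
      ← mul_div_assoc]
    exact div_le_div_of_nonneg_right (one_sub_cos_le r) this.le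

lemma stableConst_pos (hα : 0 < α) (hα' : α < 2) : 0 < stableConst α := by
  rw [stableConst, setIntegral_pos_iff_support_of_nonneg_ae _ (integrableOn_stableConst hα hα')]
  · refine lt_of_lt_of_le ?_ (measure_mono (s := Ioo 0 1) fun r hr => ⟨?_, hr.1⟩)
    · simp
    · have h1 : Real.cos r < 1 := by
        rw [← Real.cos_zero]
        exact Real.cos_lt_cos_of_nonneg_of_le_pi le_rfl (by linarith [hr.2, Real.pi_gt_three]) hr.1
      exact (div_pos (sub_pos.2 h1) (Real.rpow_pos_of_pos hr.1 _)).ne'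
  · refine (ae_restrict_mem measurableSet_Ioi).mono fun r hr => ?_
    exact div_nonneg (one_sub_cos_nonneg r) (Real.rpow_pos_of_pos hr _).le

lemma lintegral_one_sub_cos (hα : 0 < α) (hα' : α < 2) (b : ℝ) :
    ∫⁻ ρ in Ioi (0 : ℝ), ENNReal.ofReal (1 / ρ ^ (1 + α)) * ENNReal.ofReal (1 - Real.cos (ρ * b))
      = ENNReal.ofReal (stableConst α * |b| ^ α) := by
  have e : ∀ ρ : ℝ, ENNReal.ofReal (1 / ρ ^ (1 + α)) * ENNReal.ofReal (1 - Real.cos (ρ * b))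
      = ENNReal.ofReal ((1 - Real.cos (|b| * ρ)) / ρ ^ (1 + α)) := fun ρ => by
    rw [← ENNReal.ofReal_mul' (one_sub_cos_nonneg _)]
    congr 1
    have : Real.cos (ρ * b) = Real.cos (|b| * ρ) := by
      rcases abs_choice b with h | h
      · rw [h, mul_comm]
      · rw [h, neg_mul, Real.cos_neg, mul_comm]
    rw [this]; ring
  simp only [e]
  rcases eq_or_ne b 0 with rfl | hb
  · simp [Real.zero_rpow hα.ne']
  have hb' : 0 < |b| := abs_pos.2 hb
  have hG := integrableOn_stableConst hα hα'
  have e2 : ∀ ρ ∈ Ioi (0 : ℝ), (1 - Real.cos (|b| * ρ)) / ρ ^ (1 + α)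
      = |b| ^ (1 + α) * ((1 - Real.cos (|b| * ρ)) / (|b| * ρ) ^ (1 + α)) := fun ρ hρ => by
    have h1 : 0 < |b| ^ (1 + α) := by positivity
    have h2 : 0 < ρ ^ (1 + α) := Real.rpow_pos_of_pos hρ _
    rw [Real.mul_rpow hb'.le (le_of_lt hρ)]
    field_simp
  have hint : IntegrableOn (fun ρ => (1 - Real.cos (|b| * ρ)) / ρ ^ (1 + α)) (Ioi 0) := by
    refine IntegrableOn.congr_fun ?_ (fun ρ hρ => (e2 ρ hρ).symm) measurableSet_Ioi
    refine Integrable.const_mul ?_ _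
    have := (integrableOn_Ioi_comp_mul_left_iff
      (fun r : ℝ => (1 - Real.cos r) / r ^ (1 + α)) 0 hb').2 (by simpa using hG)
    exact this
  rw [← ofReal_integral_eq_lintegral_ofReal hint]
  · congr 1
    rw [setIntegral_congr_fun measurableSet_Ioi e2, integral_const_mul,
      integral_comp_mul_left_Ioi (fun r : ℝ => (1 - Real.cos r) / r ^ (1 + α)) 0 hb', mul_zero,
      smul_eq_mul, stableConst, Real.rpow_add hb', Real.rpow_one]
    field_simp
  · refine (ae_restrict_mem measurableSet_Ioi).mono fun r hr => ?_
    exact div_nonneg (one_sub_cos_nonneg _) (Real.rpow_pos_of_pos hr _).le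

/-- The finite constant `∫_0^∞ (1 ∧ ρ²) ρ^{-1-α} dρ`. -/
def radConst (α : ℝ) : ℝ≥0∞ :=
  ∫⁻ ρ in Ioi (0 : ℝ), ENNReal.ofReal (1 / ρ ^ (1 + α)) * ENNReal.ofReal (min 1 (ρ ^ 2))

lemma radConst_lt_top (hα : 0 < α) (hα' : α < 2) : radConst α < ∞ := by
  have := (integrableOn_min_div_rpow hα hα').lintegral_lt_top
  refine lt_of_le_of_lt (le_of_eq ?_) this
  refine lintegral_congr fun ρ => ?_
  rw [← ENNReal.ofReal_mul' (by positivity)]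
  congr 1; ring

end Radial

/-! ### Measures in polar coordinates -/
section Polar
variable {ι : Type} [Fintype ι] {α : ℝ}

lemma polarMeasure_congr {w w' : ℝ → ℝ} (h : ∀ ρ, 0 < ρ → w ρ = w' ρ) (m : Measure (USphere ι)) :
    polarMeasure α w m = polarMeasure α w' m := by
  unfold polarMeasure
  congr 2
  refine withDensity_congr_ae ?_
  refine (ae_restrict_mem measurableSet_Ioi).mono fun ρ hρ => ?_
  simp only [h ρ hρ]

lemma lintegral_polarMeasure {w : ℝ → ℝ} (hw : Measurable w) (m : Measure (USphere ι)) [SFinite m]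
    {f : EuclideanSpace ℝ ι → ℝ≥0∞} (hf : Measurable f) :
    ∫⁻ z, f z ∂polarMeasure α w m = ∫⁻ s, (∫⁻ ρ in Ioi (0 : ℝ),
      ENNReal.ofReal (w ρ / ρ ^ (1 + α)) * f (ρ • (s : EuclideanSpace ℝ ι))) ∂m := by
  have hd : Measurable fun ρ : ℝ => ENNReal.ofReal (w ρ / ρ ^ (1 + α)) := by fun_prop
  have hs : Measurable fun x : ℝ × USphere ι => x.1 • (x.2 : EuclideanSpace ℝ ι) := by fun_prop
  rw [polarMeasure, lintegral_map hf hs, lintegral_prod_symm (fun a : ℝ × USphere ι => f (a.1 • (a.2 : EuclideanSpace ℝ ι)))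
    (hf.comp hs).aemeasurable]
  refine lintegral_congr fun s => ?_
  rw [lintegral_withDensity_eq_lintegral_mul _ hd (by fun_prop)]
  rfl

instance (w : ℝ → ℝ) (m : Measure (USphere ι)) [SFinite m] : SFinite (polarMeasure α w m) := by
  unfold polarMeasure; infer_instance

lemma norm_sphere (s : USphere ι) : ‖(s : EuclideanSpace ℝ ι)‖ = 1 := by
  simp

lemma polarMeasure_withDensity {w : ℝ → ℝ} (hw : Measurable w) (m : Measure (USphere ι))
    [SFinite m] : (polarMeasure α (fun _ => 1) m).withDensity (fun z => ENNReal.ofReal (w ‖z‖))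
      = polarMeasure α w m := by
  refine Measure.ext_of_lintegral _ fun f hf => ?_
  rw [lintegral_withDensity_eq_lintegral_mul _ (by fun_prop) hf,
    lintegral_polarMeasure measurable_const m (by fun_prop), lintegral_polarMeasure hw m hf]
  refine lintegral_congr fun s => setLIntegral_congr_fun measurableSet_Ioi fun ρ hρ => ?_
  have hρ' : (0 : ℝ) < ρ := hρ
  have h1 : 0 ≤ 1 / ρ ^ (1 + α) := by positivity
  simp only [Pi.mul_apply, norm_smul, norm_sphere, mul_one, Real.norm_eq_abs, abs_of_pos hρ']
  rw [← mul_assoc, ← ENNReal.ofReal_mul h1]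
  congr 2; ring

lemma lintegral_comp_neg {m : Measure (USphere ι)} (hm : m.IsNegInvariant) {f : USphere ι → ℝ≥0∞}
    (hf : Measurable f) : ∫⁻ s, f (-s) ∂m = ∫⁻ s, f s ∂m := by
  have h : m.map Neg.neg = m := hm.neg_eq_self
  conv_rhs => rw [← h]
  rw [lintegral_map hf continuous_neg.measurable]

lemma polarMeasure_isNegInvariant {w : ℝ → ℝ} (hw : Measurable w) {m : Measure (USphere ι)}
    [SFinite m] (hm : m.IsNegInvariant) : (polarMeasure α w m).IsNegInvariant := by
  refine ⟨Measure.ext_of_lintegral _ fun f hf => ?_⟩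
  rw [Measure.neg, lintegral_map hf measurable_neg, lintegral_polarMeasure hw m (by fun_prop),
    lintegral_polarMeasure hw m hf, ← lintegral_comp_neg hm]
  · simp
  · exact Measurable.lintegral_prod_right' (ν := volume.restrict (Ioi 0)) (f := fun p : USphere ι × ℝ =>
      ENNReal.ofReal (w p.2 / p.2 ^ (1 + α)) * f (-(p.2 • (p.1 : EuclideanSpace ℝ ι)))) (by fun_prop)

lemma polarMeasure_zero {w : ℝ → ℝ} (hw : Measurable w) (m : Measure (USphere ι))
    [SFinite m] : polarMeasure α w m {0} = 0 := by
  rw [← lintegral_indicator_one (measurableSet_singleton _), lintegral_polarMeasure hw m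
    (measurable_one.indicator (measurableSet_singleton _))]
  rw [lintegral_congr (g := fun _ => 0), lintegral_zero]
  intro s
  rw [setLIntegral_congr_fun (g := fun _ => 0) measurableSet_Ioi, lintegral_zero]
  intro ρ hρ
  have hρ' : (0 : ℝ) < ρ := hρ
  have : ρ • (s : EuclideanSpace ℝ ι) ≠ 0 := by
    rw [← norm_ne_zero_iff, norm_smul, norm_sphere]; simpa using hρ'.ne'
  simp [this]

lemma lintegral_min_polarMeasure_le {w : ℝ → ℝ} (hw : Measurable w) {W : ℝ} (hW : ∀ ρ, w ρ ≤ W)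
    (hW0 : 0 ≤ W) (m : Measure (USphere ι)) [SFinite m] :
    ∫⁻ z, ENNReal.ofReal (min 1 (‖z‖ ^ 2)) ∂polarMeasure α w m
      ≤ ENNReal.ofReal W * radConst α * m univ := by
  rw [lintegral_polarMeasure hw m (by fun_prop), ← lintegral_const]
  refine lintegral_mono fun s => ?_
  rw [radConst, ← lintegral_const_mul _ (by fun_prop)]
  refine setLIntegral_mono' measurableSet_Ioi fun ρ hρ => ?_
  have hρ' : (0 : ℝ) < ρ := hρ
  rw [norm_smul, norm_sphere, mul_one, Real.norm_eq_abs, sq_abs, ← mul_assoc,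
    ← ENNReal.ofReal_mul hW0]
  gcongr
  rw [mul_one_div]
  gcongr
  exact hW ρ

lemma polarMeasure_isLevy (hα : 0 < α) (hα' : α < 2) {w : ℝ → ℝ} (hw : Measurable w) {W : ℝ}
    (hW : ∀ ρ, w ρ ≤ W) (hW0 : 0 ≤ W) (m : Measure (USphere ι)) [IsFiniteMeasure m]
    (hm : m.IsNegInvariant) : IsSymmetricLevyMeasure (polarMeasure α w m) :=
  ⟨polarMeasure_isNegInvariant hw hm, polarMeasure_zero hw m,
    (lintegral_min_polarMeasure_le hw hW hW0 m).trans_lt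
      (ENNReal.mul_lt_top (ENNReal.mul_lt_top ENNReal.ofReal_lt_top (radConst_lt_top hα hα'))
        (measure_lt_top _ _))⟩

end Polar
end StableChain

namespace StableChain

/-! ### Lévy exponents -/
section Exponent
variable {ι : Type} [Fintype ι] {α : ℝ} {N : Measure (EuclideanSpace ℝ ι)}

/-- The exponent `∫ (1 - cos⟨p, z⟩) N(dz)` of a symmetric Lévy measure. -/
def psi (N : Measure (EuclideanSpace ℝ ι)) (p : EuclideanSpace ℝ ι) : ℝ :=
  ∫ z, (1 - Real.cos (inner ℝ p z)) ∂N

lemma psi_nonneg (N : Measure (EuclideanSpace ℝ ι)) (p) : 0 ≤ psi N p :=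
  integral_nonneg fun _ => one_sub_cos_nonneg _

lemma one_sub_cos_inner_le {p z : EuclideanSpace ℝ ι} {r : ℝ} (hr : 1 ≤ r) (hp : ‖p‖ ≤ r) :
    1 - Real.cos (inner ℝ p z) ≤ 2 * r ^ 2 * min 1 (‖z‖ ^ 2) := by
  refine (one_sub_cos_le _).trans ?_
  rw [mul_assoc]
  refine mul_le_mul_of_nonneg_left ?_ zero_le_two
  rw [mul_min_of_nonneg _ _ (by positivity)]
  refine min_le_min (by nlinarith) ?_
  rw [← mul_pow]
  exact sq_le_sq' (abs_le.1 ((abs_real_inner_le_norm p z).trans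
    (mul_le_mul_of_nonneg_right hp (norm_nonneg _)))).1 (abs_le.1 ((abs_real_inner_le_norm p z).trans
    (mul_le_mul_of_nonneg_right hp (norm_nonneg _)))).2

lemma IsSymmetricLevyMeasure.integrable_min (hN : IsSymmetricLevyMeasure N) :
    Integrable (fun z => min 1 (‖z‖ ^ 2)) N := by
  refine ⟨by fun_prop, ?_⟩
  rw [hasFiniteIntegral_iff_ofReal (Eventually.of_forall fun z => by positivity)]
  exact hN.finite

lemma IsSymmetricLevyMeasure.integrable_one_sub_cos (hN : IsSymmetricLevyMeasure N)
    (p : EuclideanSpace ℝ ι) : Integrable (fun z => 1 - Real.cos (inner ℝ p z)) N := by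
  refine (hN.integrable_min.const_mul (2 * (max 1 ‖p‖) ^ 2)).mono'
    (by fun_prop) (Eventually.of_forall fun z => ?_)
  rw [Real.norm_eq_abs, abs_of_nonneg (one_sub_cos_nonneg _)]
  exact one_sub_cos_inner_le (le_max_left _ _) (le_max_right _ _)

lemma IsSymmetricLevyMeasure.continuous_psi (hN : IsSymmetricLevyMeasure N) :
    Continuous (psi N) := by
  refine continuous_iff_continuousAt.2 fun p => ?_
  refine continuousAt_of_dominated (bound := fun z => 2 * (‖p‖ + 1) ^ 2 * min 1 (‖z‖ ^ 2))
    (Eventually.of_forall fun q => by fun_prop) ?_ (hN.integrable_min.const_mul _)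
    (Eventually.of_forall fun z => by fun_prop)
  have : ∀ᶠ q in 𝓝 p, ‖q‖ ≤ ‖p‖ + 1 := by
    have := (continuous_norm (E := EuclideanSpace ℝ ι)).continuousAt (x := p)
    exact (this.eventually (gt_mem_nhds (lt_add_one ‖p‖))).mono fun _ h => le_of_lt h
  refine this.mono fun q hq => Eventually.of_forall fun z => ?_
  rw [Real.norm_eq_abs, abs_of_nonneg (one_sub_cos_nonneg _)]
  exact one_sub_cos_inner_le (by linarith [norm_nonneg p]) hq

lemma IsSymmetricLevyMeasure.ofReal_psi (hN : IsSymmetricLevyMeasure N)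
    (p : EuclideanSpace ℝ ι) :
    ENNReal.ofReal (psi N p) = ∫⁻ z, ENNReal.ofReal (1 - Real.cos (inner ℝ p z)) ∂N :=
  ofReal_integral_eq_lintegral_ofReal (hN.integrable_one_sub_cos p)
    (Eventually.of_forall fun _ => one_sub_cos_nonneg _)

lemma IsSymmetricLevyMeasure.integral_neg (hN : IsSymmetricLevyMeasure N)
    {F : Type*} [NormedAddCommGroup F] [NormedSpace ℝ F] (f : EuclideanSpace ℝ ι → F) :
    ∫ z, f (-z) ∂N = ∫ z, f z ∂N := by
  have h : N.map Neg.neg = N := hN.symmetric.neg_eq_self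
  conv_rhs => rw [← h]
  exact (integral_map_equiv (MeasurableEquiv.neg _) f).symm

lemma norm_exp_sub_one_sub_le (x : ℝ) :
    ‖Complex.exp (Complex.I * x) - 1 - Complex.I * x‖ ≤ 3 * x ^ 2 := by
  have hx : ‖Complex.I * (x : ℂ)‖ = |x| := by simp
  rcases le_total |x| 1 with h | h
  · have := Complex.norm_exp_sub_one_sub_id_le (x := Complex.I * x) (by rwa [hx])
    rw [hx, sq_abs] at this
    nlinarith [sq_nonneg x]
  · have h1 : ‖Complex.exp (Complex.I * x)‖ = 1 := by
      rw [mul_comm]; exact Complex.norm_exp_ofReal_mul_I x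
    have h2 := norm_sub_le (Complex.exp (Complex.I * x) - 1) (Complex.I * x)
    have h3 := norm_sub_le (Complex.exp (Complex.I * x)) 1
    rw [hx] at h2
    rw [h1, norm_one] at h3
    have := sq_abs x
    nlinarith

/-- The integrand of the Lévy–Khintchine exponent. -/
def lkFun (p z : EuclideanSpace ℝ ι) : ℂ :=
  Complex.exp (Complex.I * (inner ℝ p z : ℝ)) - 1
    - Complex.I * (inner ℝ p z / (1 + ‖z‖ ^ 2) : ℝ)

lemma norm_lkFun_le (p z : EuclideanSpace ℝ ι) :
    ‖lkFun p z‖ ≤ (3 * ‖p‖ ^ 2 + ‖p‖ + 2) * min 1 (‖z‖ ^ 2) := by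
  have hx := abs_real_inner_le_norm p z
  set x : ℝ := inner ℝ p z with hxdef
  have hp := norm_nonneg p
  have hz := norm_nonneg z
  have hfrac : ∀ y : ℝ, ‖Complex.I * ((x / y : ℝ) : ℂ)‖ = |x| / |y| := fun y => by
    rw [norm_mul, Complex.norm_I, one_mul, Complex.norm_real, Real.norm_eq_abs, abs_div]
  have hy : |1 + ‖z‖ ^ 2| = 1 + ‖z‖ ^ 2 := abs_of_pos (by positivity)
  rcases le_total ‖z‖ 1 with h | h
  · rw [min_eq_right (by nlinarith)]
    have e : lkFun p z = (Complex.exp (Complex.I * x) - 1 - Complex.I * x)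
        + Complex.I * ((x * ‖z‖ ^ 2 / (1 + ‖z‖ ^ 2) : ℝ) : ℂ) := by
      have : x * ‖z‖ ^ 2 / (1 + ‖z‖ ^ 2) = x - x / (1 + ‖z‖ ^ 2) := by
        field_simp; ring
      rw [this, lkFun, ← hxdef]; push_cast; ring
    rw [e]
    refine (norm_add_le _ _).trans ?_
    have h1 := norm_exp_sub_one_sub_le x
    have h2 : ‖Complex.I * ((x * ‖z‖ ^ 2 / (1 + ‖z‖ ^ 2) : ℝ) : ℂ)‖ ≤ ‖p‖ * ‖z‖ ^ 2 := by
      rw [norm_mul, Complex.norm_I, one_mul, Complex.norm_real, Real.norm_eq_abs, abs_div, hy,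
        abs_mul, abs_of_nonneg (sq_nonneg ‖z‖), div_le_iff₀ (by positivity)]
      have : |x| ≤ ‖p‖ := hx.trans (by nlinarith)
      have h3 : |x| * ‖z‖ ^ 2 ≤ ‖p‖ * ‖z‖ ^ 2 := by gcongr
      nlinarith [mul_nonneg (mul_nonneg hp (sq_nonneg ‖z‖)) (sq_nonneg ‖z‖)]
    have h3 : x ^ 2 ≤ ‖p‖ ^ 2 * ‖z‖ ^ 2 := by
      rw [← sq_abs x, ← mul_pow]
      gcongr
    nlinarith [sq_nonneg ‖z‖]
  · rw [min_eq_left (by nlinarith), mul_one]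
    have h1 : ‖Complex.exp (Complex.I * (x : ℂ))‖ = 1 := by
      rw [mul_comm]; exact Complex.norm_exp_ofReal_mul_I x
    have h2 := norm_sub_le (Complex.exp (Complex.I * x) - 1)
      (Complex.I * ((x / (1 + ‖z‖ ^ 2) : ℝ) : ℂ))
    have h3 := norm_sub_le (Complex.exp (Complex.I * x)) 1
    rw [h1, norm_one] at h3
    rw [hfrac, hy] at h2
    have h4 : |x| / (1 + ‖z‖ ^ 2) ≤ ‖p‖ := by
      rw [div_le_iff₀ (by positivity)]
      refine hx.trans (mul_le_mul_of_nonneg_left ?_ hp)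
      nlinarith
    change ‖Complex.exp (Complex.I * x) - 1 - Complex.I * ((x / (1 + ‖z‖ ^ 2) : ℝ) : ℂ)‖ ≤ _
    nlinarith [sq_nonneg ‖p‖]

/-- For a symmetric Lévy measure, the Lévy–Khintchine exponent is real. -/
lemma IsSymmetricLevyMeasure.integral_lkFun (hN : IsSymmetricLevyMeasure N)
    (p : EuclideanSpace ℝ ι) : ∫ z, lkFun p z ∂N = -(psi N p : ℂ) := by
  have hm : Measurable (lkFun p) := by unfold lkFun; fun_prop
  have hI : Integrable (lkFun p) N :=
    (hN.integrable_min.const_mul _).mono' hm.aestronglyMeasurable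
      (Eventually.of_forall fun z => norm_lkFun_le p z)
  have hI' : Integrable (fun z => lkFun p (-z)) N :=
    (hN.integrable_min.const_mul _).mono' (hm.comp measurable_neg).aestronglyMeasurable
      (Eventually.of_forall fun z => (norm_lkFun_le p (-z)).trans (by rw [norm_neg]))
  have h1 := hN.integral_neg (lkFun p)
  have h2 : ∀ z, lkFun p z + lkFun p (-z) = ((-2 * (1 - Real.cos (inner ℝ p z)) : ℝ) : ℂ) := by
    intro z
    unfold lkFun
    rw [inner_neg_right, norm_neg]
    push_cast
    have h3 := Complex.two_cos ((inner ℝ p z : ℝ) : ℂ)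
    rw [mul_comm Complex.I, mul_comm Complex.I (-((inner ℝ p z : ℝ) : ℂ))]
    linear_combination -h3
  have h3 := integral_add hI hI'
  simp only [h2] at h3
  rw [integral_complex_ofReal, integral_const_mul, h1] at h3
  rw [psi]
  push_cast at h3
  linear_combination -h3 / 2

end Exponent

/-! ### The driving noise -/
section Noise
variable {d : ℕ} {α κ lam : ℝ} {μ : Measure (USphere (Fin d))} {g : ℝ → ℝ}

lemma SpectralCondition.exists_le_toSphere (h : SpectralCondition d α lam μ) :
    ∃ H : ℝ≥0, μ ≤ (H : ℝ≥0∞) • (volume : Measure (EuclideanSpace ℝ (Fin d))).toSphere := by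
  obtain ⟨f, L, hf, rfl⟩ := h.density
  obtain ⟨H, hH⟩ := isCompact_univ.bddAbove_image (f := f) hf.continuous.continuousOn
  refine ⟨H, ?_⟩
  rw [← withDensity_const]
  exact withDensity_mono (Eventually.of_forall fun s =>
    ENNReal.coe_le_coe.2 (hH ⟨s, mem_univ s, rfl⟩))

lemma SpectralCondition.isFiniteMeasure (h : SpectralCondition d α lam μ) :
    IsFiniteMeasure μ := by
  obtain ⟨H, hH⟩ := h.exists_le_toSphere
  refine ⟨(hH univ).trans_lt ?_⟩
  rw [Measure.smul_apply, smul_eq_mul]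
  exact ENNReal.mul_lt_top ENNReal.coe_lt_top (measure_lt_top _ _)

lemma integrable_abs_inner_rpow {ι : Type} [Fintype ι] (hα : 0 < α) (m : Measure (USphere ι))
    [IsFiniteMeasure m] (u : EuclideanSpace ℝ ι) :
    Integrable (fun s : USphere ι => |inner ℝ u (s : EuclideanSpace ℝ ι)| ^ α) m := by
  refine Integrable.of_bound (C := ‖u‖ ^ α) ?_ (Eventually.of_forall fun s => ?_)
  · exact (Measurable.pow_const (by fun_prop) _).aestronglyMeasurable
  · rw [Real.norm_eq_abs, abs_of_nonneg (by positivity)]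
    refine Real.rpow_le_rpow (abs_nonneg _) ?_ hα.le
    simpa [norm_sphere] using abs_real_inner_le_norm u (s : EuclideanSpace ℝ ι)

lemma SpectralCondition.mass_le (h : SpectralCondition d α lam μ) (hα : 0 < α) (hα' : α < 2) :
    μ univ ≤ ENNReal.ofReal (d * lam) := by
  have := h.isFiniteMeasure
  have h1 : ∀ s : USphere (Fin d),
      1 ≤ ∑ i, |inner ℝ (EuclideanSpace.single i (1 : ℝ)) (s : EuclideanSpace ℝ (Fin d))| ^ α := by
    intro s
    have h2 : (1 : ℝ) = ∑ i, |(s : EuclideanSpace ℝ (Fin d)) i| ^ 2 := by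
      have := EuclideanSpace.norm_sq_eq (s : EuclideanSpace ℝ (Fin d))
      rw [norm_sphere] at this
      simpa using this
    conv_lhs => rw [h2]
    refine Finset.sum_le_sum fun i _ => ?_
    have h3 : |(s : EuclideanSpace ℝ (Fin d)) i| ≤ 1 :=
      (abs_coord_le _ i).trans (norm_sphere s).le
    rw [EuclideanSpace.inner_single_left]
    simp only [map_one, one_mul]
    rcases eq_or_lt_of_le (abs_nonneg ((s : EuclideanSpace ℝ (Fin d)) i)) with h4 | h4
    · rw [← h4, Real.zero_rpow hα.ne']; norm_num
    · rw [← Real.rpow_natCast]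
      exact Real.rpow_le_rpow_of_exponent_ge h4 h3 (by exact_mod_cast hα'.le)
  have h2 : ∫ _ : USphere (Fin d), (1 : ℝ) ∂μ ≤ d * lam := by
    refine (integral_mono (integrable_const _)
      (integrable_finsetSum _ fun i _ => integrable_abs_inner_rpow hα μ _) h1).trans ?_
    rw [integral_finsetSum _ fun i _ => integrable_abs_inner_rpow hα μ _]
    refine (Finset.sum_le_sum fun i _ => (h.nondegenerate (EuclideanSpace.single i 1)).2).trans ?_
    simp
  rw [integral_const, smul_eq_mul, mul_one, measureReal_def] at h2
  rw [← ENNReal.ofReal_toReal (measure_ne_top μ univ)]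
  exact ENNReal.ofReal_le_ofReal h2

/-- The part of the assumptions on the tempering function that holds in both cases. -/
structure IsWeight (g : ℝ → ℝ) : Prop where
  pos : ∀ r, 0 ≤ r → 0 < g r
  antitone : AntitoneOn g (Ici 0)

lemma isWeight_of (hg : (∀ r, 0 ≤ r → g r = 1) ∨ TemperingCondition α κ g) : IsWeight g := by
  rcases hg with h | h
  · exact ⟨fun r hr => by rw [h r hr]; exact one_pos, fun a ha b hb _ => by rw [h a ha, h b hb]⟩
  · exact ⟨h.pos, h.antitone⟩

/-- The extension of a weight by its value at `0`. -/
def ext0 (g : ℝ → ℝ) (r : ℝ) : ℝ := g (max r 0)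

namespace IsWeight

lemma antitone_ext (hg : IsWeight g) : Antitone (ext0 g) := fun _ _ h =>
  hg.antitone (mem_Ici.2 (le_max_right _ _)) (mem_Ici.2 (le_max_right _ _)) (max_le_max_right 0 h)

lemma measurable_ext (hg : IsWeight g) : Measurable (ext0 g) := hg.antitone_ext.measurable

lemma ext_le (hg : IsWeight g) (r : ℝ) : ext0 g r ≤ g 0 :=
  hg.antitone (mem_Ici.2 le_rfl) (mem_Ici.2 (le_max_right r 0)) (le_max_right _ _)

end IsWeight

lemma ext0_of_nonneg {r : ℝ} (hr : 0 ≤ r) : ext0 g r = g r := by rw [ext0, max_eq_left hr]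

/-- The spherical part `μ̃` of the Lévy measure. -/
def sphPart (α : ℝ) (μ : Measure (USphere (Fin d))) : Measure (USphere (Fin d)) :=
  (ENNReal.ofReal (stableConst α))⁻¹ • μ

lemma sphPart_isFiniteMeasure (hα : 0 < α) (hα' : α < 2) [IsFiniteMeasure μ] :
    IsFiniteMeasure (sphPart α μ) := by
  refine ⟨?_⟩
  rw [sphPart, Measure.smul_apply, smul_eq_mul]
  exact ENNReal.mul_lt_top (ENNReal.inv_lt_top.2 (ENNReal.ofReal_pos.2 (stableConst_pos hα hα')))
    (measure_lt_top _ _)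

lemma sphPart_isNegInvariant (h : μ.IsNegInvariant) : (sphPart α μ).IsNegInvariant := by
  refine ⟨?_⟩
  rw [Measure.neg, sphPart, Measure.map_smul]
  congr 1
  exact h.neg_eq_self

/-- The Lévy measure `g(|z|) ν(dz)` of the driving noise. -/
def noiseLevy (α : ℝ) (μ : Measure (USphere (Fin d))) (g : ℝ → ℝ) :
    Measure (EuclideanSpace ℝ (Fin d)) :=
  (stableLevy α μ).withDensity fun z => ENNReal.ofReal (g ‖z‖)

lemma noiseLevy_eq (hα : 0 < α) (hα' : α < 2) (hg : IsWeight g) [IsFiniteMeasure μ] :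
    noiseLevy α μ g = polarMeasure α (ext0 g) (sphPart α μ) := by
  have := sphPart_isFiniteMeasure (μ := μ) hα hα'
  rw [← polarMeasure_withDensity hg.measurable_ext, noiseLevy]
  simp only [ext0_of_nonneg (norm_nonneg _)]
  rfl

lemma noiseLevy_isLevy (hα : 0 < α) (hα' : α < 2) (hg : IsWeight g)
    (h : SpectralCondition d α lam μ) : IsSymmetricLevyMeasure (noiseLevy α μ g) := by
  have := h.isFiniteMeasure
  have := sphPart_isFiniteMeasure (μ := μ) hα hα'
  rw [noiseLevy_eq hα hα' hg]
  exact polarMeasure_isLevy hα hα' hg.measurable_ext hg.ext_le (hg.pos 0 le_rfl).le _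
    (sphPart_isNegInvariant h.symmetric)

lemma lintegral_cos_stableLevy (hα : 0 < α) (hα' : α < 2) [IsFiniteMeasure μ]
    (p : EuclideanSpace ℝ (Fin d)) :
    ∫⁻ z, ENNReal.ofReal (1 - Real.cos (inner ℝ p z)) ∂stableLevy α μ
      = ENNReal.ofReal (∫ s : USphere (Fin d),
          |inner ℝ p (s : EuclideanSpace ℝ (Fin d))| ^ α ∂μ) := by
  have := sphPart_isFiniteMeasure (μ := μ) hα hα'
  have hC := stableConst_pos hα hα'
  change ∫⁻ z, _ ∂polarMeasure α (fun _ => 1) (sphPart α μ) = _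
  rw [lintegral_polarMeasure measurable_const _ (by fun_prop),
    ofReal_integral_eq_lintegral_ofReal (integrable_abs_inner_rpow hα μ p)
      (Eventually.of_forall fun s => by positivity)]
  simp only [inner_smul_right, lintegral_one_sub_cos hα hα']
  rw [sphPart, lintegral_smul_measure]
  simp only [ENNReal.ofReal_mul hC.le]
  rw [lintegral_const_mul' _ _ ENNReal.ofReal_ne_top, smul_eq_mul, ← mul_assoc,
    ENNReal.inv_mul_cancel (ENNReal.ofReal_pos.2 hC).ne' ENNReal.ofReal_ne_top, one_mul]

theorem IsDrivingNoise.charFun_eq {Ω : Type*} [MeasurableSpace Ω] {P : Measure Ω}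
    {Z : ℝ≥0 → Ω → EuclideanSpace ℝ (Fin d)} (hα : 0 < α) (hα' : α < 2)
    (h : SpectralCondition d α lam μ) (hZ : IsDrivingNoise P α κ μ g Z) :
    IsLevyProcess P Z ∧ ∀ (t : ℝ≥0) (p), charFun (P.map (Z t)) p
      = Complex.exp (-((t : ℝ) * psi (noiseLevy α μ g) p : ℝ)) := by
  have hfin := h.isFiniteMeasure
  rcases hZ with ⟨hg, hL, hZ⟩ | ⟨hg, hL, hZ⟩
  · refine ⟨hL, fun t p => ?_⟩
    rw [hZ]
    have hN := noiseLevy_isLevy hα hα' (isWeight_of (α := α) (κ := κ) (Or.inl hg)) h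
    have e : noiseLevy α μ g = stableLevy α μ := by
      simp [noiseLevy, hg _ (norm_nonneg _)]
    have h1 := hN.ofReal_psi p
    rw [e, lintegral_cos_stableLevy hα hα', ENNReal.ofReal_eq_ofReal_iff (psi_nonneg _ _)
      (integral_nonneg fun s => by positivity)] at h1
    rw [e, h1]
  · refine ⟨hL, fun t p => ?_⟩
    rw [hZ]
    have hN := noiseLevy_isLevy hα hα' (isWeight_of (Or.inr hg)) h
    have h1 := hN.integral_lkFun p
    simp only [noiseLevy, lkFun] at h1
    rw [h1, noiseLevy]
    push_cast
    ring_nf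

lemma stableLevy_compl_ball_le (hα : 0 < α) (hα' : α < 2) (h : SpectralCondition d α lam μ) :
    stableLevy α μ {z | 1 < ‖z‖}
      ≤ radConst α * ((ENNReal.ofReal (stableConst α))⁻¹ * ENNReal.ofReal (d * lam)) := by
  have := h.isFiniteMeasure
  have := sphPart_isFiniteMeasure (μ := μ) hα hα'
  have hm : MeasurableSet {z : EuclideanSpace ℝ (Fin d) | 1 < ‖z‖} :=
    measurableSet_lt measurable_const measurable_norm
  have h1 := lintegral_min_polarMeasure_le (α := α) (w := fun _ => (1 : ℝ)) measurable_const (W := 1)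
    (fun _ => le_rfl) zero_le_one (sphPart α μ)
  rw [ENNReal.ofReal_one, one_mul] at h1
  refine le_trans ?_ (h1.trans ?_)
  · rw [← lintegral_indicator_one hm]
    refine lintegral_mono fun z => ?_
    by_cases hz : 1 < ‖z‖
    · have : (1 : ℝ) ≤ ‖z‖ ^ 2 := by nlinarith
      simp [hz, this]
    · simp [hz]
  · gcongr
    rw [sphPart, Measure.smul_apply, smul_eq_mul]
    gcongr
    exact h.mass_le hα hα'

/-- Two-sided bounds on the Lévy exponent of the noise, uniform in the spectral measure. -/
theorem exists_psi_bounds (d : ℕ) (hα : 0 < α) (hα' : α < 2) (hlam : 1 ≤ lam) (hg : IsWeight g) :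
    ∃ c C : ℝ, 0 < c ∧ 0 ≤ C ∧ ∀ μ, SpectralCondition d α lam μ → ∀ p,
      c * ‖p‖ ^ α - C ≤ psi (noiseLevy α μ g) p ∧ psi (noiseLevy α μ g) p ≤ C * ‖p‖ ^ α := by
  have hg0 := hg.pos 0 le_rfl
  have hg1 := hg.pos 1 zero_le_one
  set B := radConst α * ((ENNReal.ofReal (stableConst α))⁻¹ * ENNReal.ofReal (d * lam)) with hB
  have hBt : B ≠ ∞ := ENNReal.mul_ne_top (radConst_lt_top hα hα').ne (ENNReal.mul_ne_top
    (ENNReal.inv_ne_top.2 (ENNReal.ofReal_pos.2 (stableConst_pos hα hα')).ne')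
    ENNReal.ofReal_ne_top)
  refine ⟨g 1 * lam⁻¹, max (g 1 * (2 * B.toReal)) (g 0 * lam), by positivity,
    le_max_of_le_right (by positivity), fun μ h p => ?_⟩
  have hfin := h.isFiniteMeasure
  have hN := noiseLevy_isLevy hα hα' hg h
  set I := ∫ s : USphere (Fin d), |inner ℝ p (s : EuclideanSpace ℝ (Fin d))| ^ α ∂μ with hI
  have hI0 : 0 ≤ I := integral_nonneg fun s => by positivity
  have hnd := h.nondegenerate p
  have hst := lintegral_cos_stableLevy (μ := μ) hα hα' p
  have hpsi := hN.ofReal_psi p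
  have hgm : Measurable fun z : EuclideanSpace ℝ (Fin d) => ENNReal.ofReal (g ‖z‖) := by
    have : (fun z : EuclideanSpace ℝ (Fin d) => ENNReal.ofReal (g ‖z‖))
        = fun z => ENNReal.ofReal (ext0 g ‖z‖) := by
      ext1 z; rw [ext0_of_nonneg (norm_nonneg _)]
    rw [this]
    exact (hg.measurable_ext.comp measurable_norm).ennreal_ofReal
  have hcm : Measurable fun z : EuclideanSpace ℝ (Fin d) =>
    ENNReal.ofReal (1 - Real.cos (inner ℝ p z)) := by fun_prop
  rw [noiseLevy, lintegral_withDensity_eq_lintegral_mul _ hgm hcm] at hpsi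
  constructor
  · have hm : MeasurableSet {z : EuclideanSpace ℝ (Fin d) | 1 < ‖z‖} :=
      measurableSet_lt measurable_const measurable_norm
    have h1 : ENNReal.ofReal (g 1) * ENNReal.ofReal I
        ≤ ENNReal.ofReal (psi (noiseLevy α μ g) p) + ENNReal.ofReal (g 1) * (2 * B) := by
      rw [← hst, noiseLevy, hpsi, ← lintegral_const_mul _ hcm]
      refine le_trans (lintegral_mono (g := fun z => ENNReal.ofReal (g ‖z‖) *
        ENNReal.ofReal (1 - Real.cos (inner ℝ p z)) + ENNReal.ofReal (g 1) * (2 *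
          ({z : EuclideanSpace ℝ (Fin d) | 1 < ‖z‖}.indicator 1 z))) fun z => ?_) ?_
      · by_cases hz : 1 < ‖z‖
        · refine le_trans ?_ le_add_self
          simp only [mem_ofPred_eq, hz, indicator_of_mem, Pi.one_apply, mul_one]
          gcongr
          exact ENNReal.ofReal_le_of_le_toReal
            (by simp only [ENNReal.toReal_ofNat]; linarith [Real.neg_one_le_cos (inner ℝ p z)])
        · refine le_trans ?_ le_self_add
          gcongr
          exact hg.antitone (norm_nonneg z) (zero_le_one' ℝ) (not_lt.1 hz)
      · rw [lintegral_add_left (by exact hgm.mul hcm), lintegral_const_mul _ (by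
          exact (measurable_one.indicator hm).const_mul 2), lintegral_const_mul _
          (measurable_one.indicator hm), lintegral_indicator_one hm]
        gcongr
        · rfl
        · exact stableLevy_compl_ball_le hα hα' h
    rw [← ENNReal.ofReal_toReal hBt, show (2 : ℝ≥0∞) = ENNReal.ofReal 2 by simp,
      ← ENNReal.ofReal_mul zero_le_two, ← ENNReal.ofReal_mul hg1.le, ← ENNReal.ofReal_mul hg1.le,
      ← ENNReal.ofReal_add (psi_nonneg _ _) (by positivity),
      ENNReal.ofReal_le_ofReal_iff (by have := psi_nonneg (noiseLevy α μ g) p; positivity)] at h1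
    have h2 : g 1 * (lam⁻¹ * ‖p‖ ^ α) ≤ g 1 * I := by gcongr; exact hnd.1
    have h3 := le_max_left (g 1 * (2 * B.toReal)) (g 0 * lam)
    linarith
  · have h1 : ENNReal.ofReal (psi (noiseLevy α μ g) p)
        ≤ ENNReal.ofReal (g 0) * ENNReal.ofReal I := by
      rw [← hst, noiseLevy, hpsi, ← lintegral_const_mul _ hcm]
      refine lintegral_mono fun z => ?_
      simp only [Pi.mul_apply]
      gcongr
      exact hg.antitone self_mem_Ici (norm_nonneg z) (norm_nonneg z)
    rw [← ENNReal.ofReal_mul hg0.le, ENNReal.ofReal_le_ofReal_iff (by positivity)] at h1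
    refine h1.trans ?_
    calc g 0 * I ≤ g 0 * (lam * ‖p‖ ^ α) := by gcongr; exact hnd.2
      _ = g 0 * lam * ‖p‖ ^ α := by ring
      _ ≤ _ := by gcongr; exact le_max_right _ _

end Noise
end StableChain

namespace StableChain
open scoped Matrix.Norms.L2Operator

/-! ### Images of Lévy measures under time-dependent linear maps -/

lemma lintegral_Ioi_scale {b : ℝ} (hb : 0 < b) {F : ℝ → ℝ≥0∞} (hF : Measurable F) :
    ∫⁻ ρ in Ioi (0 : ℝ), F ρ = ENNReal.ofReal b * ∫⁻ ρ in Ioi (0 : ℝ), F (b * ρ) := by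
  conv_lhs => rw [← lintegral_indicator measurableSet_Ioi,
    ← Real.smul_map_volume_mul_left hb.ne', lintegral_smul_measure,
    lintegral_map (hF.indicator measurableSet_Ioi) (by fun_prop), abs_of_pos hb, smul_eq_mul]
  congr 1
  rw [← lintegral_indicator measurableSet_Ioi]
  refine lintegral_congr fun ρ => ?_
  by_cases h : 0 < ρ
  · have h' : 0 < b * ρ := by positivity
    simp [h, h']
  · have h' : ¬ 0 < b * ρ := fun h' => h (pos_of_mul_pos_right h' hb.le)
    simp [h, h']

section Push
variable {ι ι' : Type} [Fintype ι] [Fintype ι'] [DecidableEq ι] [DecidableEq ι']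

/-- The direction of a vector (with a default value at `0`). -/
def dir (s₀ : USphere ι') (x : EuclideanSpace ℝ ι') : USphere ι' :=
  ⟨if x = 0 then s₀ else ‖x‖⁻¹ • x, by
    split_ifs with h
    · exact s₀.2
    · rw [mem_sphere_zero_iff_norm, norm_smul, norm_inv, norm_norm,
        inv_mul_cancel₀ (norm_ne_zero_iff.2 h)]⟩

lemma dir_coe (s₀ : USphere ι') {x : EuclideanSpace ℝ ι'} (hx : x ≠ 0) :
    (dir s₀ x : EuclideanSpace ℝ ι') = ‖x‖⁻¹ • x := by simp [dir, hx]

lemma dir_neg (s₀ : USphere ι') {x : EuclideanSpace ℝ ι'} (hx : x ≠ 0) :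
    dir s₀ (-x) = -dir s₀ x := by
  ext1
  rw [dir_coe s₀ (neg_ne_zero.2 hx)]
  change _ = -(dir s₀ x : EuclideanSpace ℝ ι')
  rw [dir_coe s₀ hx, norm_neg, smul_neg]

lemma norm_smul_dir (s₀ : USphere ι') (x : EuclideanSpace ℝ ι') :
    ‖x‖ • (dir s₀ x : EuclideanSpace ℝ ι') = x := by
  rcases eq_or_ne x 0 with rfl | h
  · simp
  · rw [dir_coe s₀ h, smul_smul, mul_inv_cancel₀ (norm_ne_zero_iff.2 h), one_smul]

lemma measurable_dir (s₀ : USphere ι') : Measurable (dir s₀) := by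
  refine Measurable.subtype_mk (Measurable.ite (measurableSet_singleton _) measurable_const ?_)
  fun_prop

/-- A measurable family of linear maps `ℝ^ι → ℝ^ι'`, injective and bounded. -/
structure IsLinFamily (K : ℝ) (G : ℝ → Matrix ι' ι ℝ) : Prop where
  meas : ∀ i j, Measurable fun u => G u i j
  inj : ∀ u x, x ≠ 0 → Matrix.toEuclideanLin (G u) x ≠ 0
  bound : ∀ u, ‖G u‖ ≤ K

variable {K : ℝ} {G : ℝ → Matrix ι' ι ℝ} {α : ℝ} (θ : Measure ℝ) (s₀ : USphere ι')

/-- The image of `θ ⊗ N` by `(u, z) ↦ G_u z`. -/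
def pushLevy (G : ℝ → Matrix ι' ι ℝ) (N : Measure (EuclideanSpace ℝ ι)) :
    Measure (EuclideanSpace ℝ ι') :=
  (θ.prod N).map fun p => Matrix.toEuclideanLin (G p.1) p.2

/-- The image of `|G_u s|^α θ(du) m(ds)` by `(u, s) ↦ G_u s / |G_u s|`. -/
def pushSpec (α : ℝ) (G : ℝ → Matrix ι' ι ℝ) (m : Measure (USphere ι)) : Measure (USphere ι') :=
  ((θ.prod m).withDensity fun p => ENNReal.ofReal
    (‖Matrix.toEuclideanLin (G p.1) (p.2 : EuclideanSpace ℝ ι)‖ ^ α)).map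
    fun p => dir s₀ (Matrix.toEuclideanLin (G p.1) (p.2 : EuclideanSpace ℝ ι))

namespace IsLinFamily

lemma measurable_apply (hG : IsLinFamily K G) :
    Measurable fun p : ℝ × EuclideanSpace ℝ ι => Matrix.toEuclideanLin (G p.1) p.2 := by
  refine (MeasurableEquiv.toLp 2 (ι' → ℝ)).symm.measurableEmbedding.measurable_comp_iff.1 ?_
  refine measurable_pi_iff.2 fun i => ?_
  change Measurable fun p : ℝ × EuclideanSpace ℝ ι => ∑ j, G p.1 i j * p.2 j
  refine Finset.measurable_fun_sum _ fun j _ => ?_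
  exact ((hG.meas i j).comp measurable_fst).mul (by fun_prop)

lemma measurable_sphere (hG : IsLinFamily K G) : Measurable fun p : ℝ × USphere ι =>
    Matrix.toEuclideanLin (G p.1) (p.2 : EuclideanSpace ℝ ι) := by
  refine (MeasurableEquiv.toLp 2 (ι' → ℝ)).symm.measurableEmbedding.measurable_comp_iff.1 ?_
  refine measurable_pi_iff.2 fun i => ?_
  change Measurable fun p : ℝ × USphere ι => ∑ j, G p.1 i j * (p.2 : EuclideanSpace ℝ ι) j
  refine Finset.measurable_fun_sum _ fun j _ => ?_
  exact ((hG.meas i j).comp measurable_fst).mul (by fun_prop)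

lemma measurable_toEuclideanLin (M : Matrix ι' ι ℝ) :
    Measurable fun x => Matrix.toEuclideanLin M x :=
  (LinearMap.continuous_of_finiteDimensional (Matrix.toEuclideanLin M)).measurable

lemma measurable_transpose (hG : IsLinFamily K G) (q : EuclideanSpace ℝ ι') :
    Measurable fun u => Matrix.toEuclideanLin (G u)ᵀ q := by
  refine (MeasurableEquiv.toLp 2 (ι → ℝ)).symm.measurableEmbedding.measurable_comp_iff.1 ?_
  refine measurable_pi_iff.2 fun i => ?_
  change Measurable fun u => ∑ j, G u j i * q j
  exact Finset.measurable_fun_sum _ fun j _ => (hG.meas j i).mul_const _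

lemma norm_apply_le (hG : IsLinFamily K G) (u x) :
    ‖Matrix.toEuclideanLin (G u) x‖ ≤ K * ‖x‖ :=
  (norm_toEuclideanLin_le _ _).trans (mul_le_mul_of_nonneg_right (hG.bound u) (norm_nonneg _))

lemma norm_transpose_le (hG : IsLinFamily K G) (u q) :
    ‖Matrix.toEuclideanLin (G u)ᵀ q‖ ≤ K * ‖q‖ := by
  refine (norm_toEuclideanLin_le _ _).trans (mul_le_mul_of_nonneg_right ?_ (norm_nonneg _))
  rw [l2_norm_transpose]
  exact hG.bound u

lemma apply_sphere_ne (hG : IsLinFamily K G) (u) (s : USphere ι) :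
    Matrix.toEuclideanLin (G u) (s : EuclideanSpace ℝ ι) ≠ 0 :=
  hG.inj u _ (by rw [← norm_ne_zero_iff, norm_sphere]; exact one_ne_zero)

lemma lintegral_pushLevy (hG : IsLinFamily K G) [SFinite θ] {N : Measure (EuclideanSpace ℝ ι)}
    [SFinite N] {f : EuclideanSpace ℝ ι' → ℝ≥0∞} (hf : Measurable f) :
    ∫⁻ x, f x ∂pushLevy θ G N = ∫⁻ u, (∫⁻ z, f (Matrix.toEuclideanLin (G u) z) ∂N) ∂θ := by
  rw [pushLevy, lintegral_map hf hG.measurable_apply]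
  exact lintegral_prod _ (hf.comp hG.measurable_apply).aemeasurable

lemma lintegral_pushSpec (hG : IsLinFamily K G) [SFinite θ] {m : Measure (USphere ι)} [SFinite m]
    {f : USphere ι' → ℝ≥0∞} (hf : Measurable f) :
    ∫⁻ η, f η ∂pushSpec θ s₀ α G m = ∫⁻ u, (∫⁻ s : USphere ι,
      ENNReal.ofReal (‖Matrix.toEuclideanLin (G u) (s : EuclideanSpace ℝ ι)‖ ^ α) *
        f (dir s₀ (Matrix.toEuclideanLin (G u) (s : EuclideanSpace ℝ ι))) ∂m) ∂θ := by
  have h1 : Measurable fun p : ℝ × USphere ι => ENNReal.ofReal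
    (‖Matrix.toEuclideanLin (G p.1) (p.2 : EuclideanSpace ℝ ι)‖ ^ α) :=
    (hG.measurable_sphere.norm.pow_const _).ennreal_ofReal
  have h2 : Measurable fun p : ℝ × USphere ι =>
      dir s₀ (Matrix.toEuclideanLin (G p.1) (p.2 : EuclideanSpace ℝ ι)) :=
    (measurable_dir s₀).comp hG.measurable_sphere
  rw [pushSpec, lintegral_map hf h2,
    lintegral_withDensity_eq_lintegral_mul _ h1 (g := fun p => f (dir s₀ (Matrix.toEuclideanLin
      (G p.1) (p.2 : EuclideanSpace ℝ ι)))) (hf.comp h2)]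
  exact lintegral_prod _ (h1.mul (hf.comp h2)).aemeasurable

lemma isFiniteMeasure_pushSpec (hG : IsLinFamily K G) (hα : 0 < α) [IsProbabilityMeasure θ]
    {m : Measure (USphere ι)} [IsFiniteMeasure m] : IsFiniteMeasure (pushSpec θ s₀ α G m) := by
  refine ⟨?_⟩
  rw [← lintegral_one, hG.lintegral_pushSpec θ s₀ measurable_const]
  refine lt_of_le_of_lt (lintegral_mono fun u => lintegral_mono (g := fun _ =>
    ENNReal.ofReal (K ^ α)) fun s => ?_) ?_
  · rw [mul_one]
    refine ENNReal.ofReal_le_ofReal (Real.rpow_le_rpow (norm_nonneg _) ?_ hα.le)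
    simpa [norm_sphere] using hG.norm_apply_le u (s : EuclideanSpace ℝ ι)
  · simp only [lintegral_const]
    exact ENNReal.mul_lt_top (ENNReal.mul_lt_top ENNReal.ofReal_lt_top (measure_lt_top _ _))
      (measure_lt_top _ _)

lemma pushSpec_isNegInvariant (hG : IsLinFamily K G) [SFinite θ]
    {m : Measure (USphere ι)} [SFinite m] (hm : m.IsNegInvariant) :
    (pushSpec θ s₀ α G m).IsNegInvariant := by
  refine ⟨Measure.ext_of_lintegral _ fun f hf => ?_⟩
  have hn : Measurable (Neg.neg : USphere ι' → USphere ι') := continuous_neg.measurable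
  rw [Measure.neg, lintegral_map hf hn,
    hG.lintegral_pushSpec θ s₀ (f := fun η => f (-η)) (hf.comp hn),
    hG.lintegral_pushSpec θ s₀ hf]
  refine lintegral_congr fun u => ?_
  have h1 : Measurable fun s : USphere ι =>
      Matrix.toEuclideanLin (G u) (s : EuclideanSpace ℝ ι) :=
    (measurable_toEuclideanLin (G u)).comp measurable_subtype_coe
  rw [← lintegral_comp_neg hm]
  · refine lintegral_congr fun s => ?_
    rw [show ((-s : USphere ι) : EuclideanSpace ℝ ι) = -(s : EuclideanSpace ℝ ι) from rfl, map_neg,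
      norm_neg, dir_neg s₀ (hG.apply_sphere_ne u s), neg_neg]
  · exact ((h1.norm.pow_const _).ennreal_ofReal).mul (hf.comp (hn.comp ((measurable_dir s₀).comp h1)))

/-- The stable-like measure with spectral measure `pushSpec`, in the coordinates before the
normalization of `G_u s`. -/
lemma lintegral_polar_pushSpec (hG : IsLinFamily K G) [SFinite θ]
    {m : Measure (USphere ι)} [SFinite m] [SFinite (pushSpec θ s₀ α G m)] {w : ℝ → ℝ}
    (hw : Measurable w) {f : EuclideanSpace ℝ ι' → ℝ≥0∞} (hf : Measurable f) :
    ∫⁻ x, f x ∂polarMeasure α w (pushSpec θ s₀ α G m) = ∫⁻ u, (∫⁻ s : USphere ι,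
      (∫⁻ ρ in Ioi (0 : ℝ), ENNReal.ofReal (w (‖Matrix.toEuclideanLin (G u)
        (s : EuclideanSpace ℝ ι)‖ * ρ) / ρ ^ (1 + α)) *
        f (Matrix.toEuclideanLin (G u) (ρ • (s : EuclideanSpace ℝ ι)))) ∂m) ∂θ := by
  rw [lintegral_polarMeasure hw _ hf, hG.lintegral_pushSpec θ s₀]
  swap
  · have hwm : Measurable fun ρ : ℝ => ENNReal.ofReal (w ρ / ρ ^ (1 + α)) := by fun_prop
    exact Measurable.lintegral_prod_right' (ν := volume.restrict (Ioi 0))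
      (f := fun p : USphere ι' × ℝ =>
      ENNReal.ofReal (w p.2 / p.2 ^ (1 + α)) * f (p.2 • (p.1 : EuclideanSpace ℝ ι')))
      ((hwm.comp measurable_snd).mul (hf.comp (by fun_prop)))
  refine lintegral_congr fun u => lintegral_congr fun s => ?_
  set l := Matrix.toEuclideanLin (G u) (s : EuclideanSpace ℝ ι) with hl
  have hb : 0 < ‖l‖ := norm_pos_iff.2 (hG.apply_sphere_ne u s)
  rw [lintegral_Ioi_scale hb (F := fun ρ => ENNReal.ofReal (w ρ / ρ ^ (1 + α)) *
    f (ρ • (dir s₀ l : EuclideanSpace ℝ ι'))) (by fun_prop), ← mul_assoc,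
    ← ENNReal.ofReal_mul (by positivity), ← lintegral_const_mul _ (by fun_prop)]
  refine setLIntegral_congr_fun measurableSet_Ioi fun ρ hρ => ?_
  have hρ' : (0 : ℝ) < ρ := hρ
  have e1 : (‖l‖ * ρ) • (dir s₀ l : EuclideanSpace ℝ ι') = Matrix.toEuclideanLin (G u)
      (ρ • (s : EuclideanSpace ℝ ι)) := by
    rw [mul_comm, mul_smul, norm_smul_dir, map_smul]
  simp only [e1]
  rw [← mul_assoc, ← ENNReal.ofReal_mul (by positivity)]
  congr 2
  rw [Real.mul_rpow hb.le hρ'.le, Real.rpow_add hb, Real.rpow_one]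
  have : 0 < ‖l‖ ^ α := by positivity
  have : 0 < ρ ^ (1 + α) := by positivity
  field_simp

lemma lintegral_pushLevy_polar (hG : IsLinFamily K G) [SFinite θ]
    {m : Measure (USphere ι)} [SFinite m] {w : ℝ → ℝ}
    (hw : Measurable w) {f : EuclideanSpace ℝ ι' → ℝ≥0∞} (hf : Measurable f) :
    ∫⁻ x, f x ∂pushLevy θ G (polarMeasure α w m) = ∫⁻ u, (∫⁻ s : USphere ι,
      (∫⁻ ρ in Ioi (0 : ℝ), ENNReal.ofReal (w ρ / ρ ^ (1 + α)) *
        f (Matrix.toEuclideanLin (G u) (ρ • (s : EuclideanSpace ℝ ι)))) ∂m) ∂θ := by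
  rw [hG.lintegral_pushLevy θ hf]
  refine lintegral_congr fun u => ?_
  rw [lintegral_polarMeasure hw]
  exact hf.comp (measurable_toEuclideanLin (G u))

lemma pushLevy_le (hG : IsLinFamily K G) [SFinite θ] {m : Measure (USphere ι)} [SFinite m]
    [SFinite (pushSpec θ s₀ α G m)] {w : ℝ → ℝ} (hw : Antitone w) {c : ℝ} (hc0 : 0 < c)
    (hc : c * K ≤ 1) : pushLevy θ G (polarMeasure α w m)
      ≤ polarMeasure α (fun ρ => w (c * ρ)) (pushSpec θ s₀ α G m) := by
  refine Measure.le_iff.2 fun s hs => ?_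
  rw [← lintegral_indicator_one hs, ← lintegral_indicator_one hs,
    hG.lintegral_pushLevy_polar θ hw.measurable (measurable_one.indicator hs),
    hG.lintegral_polar_pushSpec θ s₀ (by have := hw.measurable; fun_prop)
      (measurable_one.indicator hs)]
  refine lintegral_mono fun u => lintegral_mono fun s =>
    setLIntegral_mono' measurableSet_Ioi fun ρ hρ => ?_
  have hρ' : (0 : ℝ) < ρ := hρ
  gcongr
  refine hw ?_
  have h1 := hG.norm_apply_le u (s : EuclideanSpace ℝ ι)
  rw [norm_sphere, mul_one] at h1
  calc c * (‖Matrix.toEuclideanLin (G u) (s : EuclideanSpace ℝ ι)‖ * ρ) ≤ c * (K * ρ) := by gcongr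
    _ = c * K * ρ := by ring
    _ ≤ 1 * ρ := by gcongr
    _ = ρ := one_mul ρ

lemma pushLevy_eq (hG : IsLinFamily K G) [SFinite θ] {m : Measure (USphere ι)} [SFinite m]
    [SFinite (pushSpec θ s₀ α G m)] :
    pushLevy θ G (polarMeasure α (fun _ => 1) m)
      = polarMeasure α (fun _ => 1) (pushSpec θ s₀ α G m) := by
  refine Measure.ext_of_lintegral _ fun f hf => ?_
  rw [hG.lintegral_pushLevy_polar θ measurable_const hf,
    hG.lintegral_polar_pushSpec θ s₀ measurable_const hf]

lemma pushLevy_isLevy (hG : IsLinFamily K G) [IsProbabilityMeasure θ]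
    {N : Measure (EuclideanSpace ℝ ι)} [SFinite N] (hN : IsSymmetricLevyMeasure N) :
    IsSymmetricLevyMeasure (pushLevy θ G N) := by
  refine ⟨⟨Measure.ext_of_lintegral _ fun f hf => ?_⟩, ?_, ?_⟩
  · rw [Measure.neg, lintegral_map hf measurable_neg, hG.lintegral_pushLevy θ (by fun_prop),
      hG.lintegral_pushLevy θ hf]
    refine lintegral_congr fun u => ?_
    have h : N.map Neg.neg = N := hN.symmetric.neg_eq_self
    conv_rhs => rw [← h]
    rw [lintegral_map (f := fun z => f (Matrix.toEuclideanLin (G u) z))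
      (hf.comp (measurable_toEuclideanLin (G u))) measurable_neg]
    simp
  · rw [← lintegral_indicator_one (measurableSet_singleton _), hG.lintegral_pushLevy θ
      (measurable_one.indicator (measurableSet_singleton _))]
    rw [lintegral_congr (g := fun _ => 0), lintegral_zero]
    intro u
    have h0 : ∀ z, ({0} : Set (EuclideanSpace ℝ ι')).indicator (1 : EuclideanSpace ℝ ι' → ℝ≥0∞)
        (Matrix.toEuclideanLin (G u) z)
        = ({0} : Set (EuclideanSpace ℝ ι)).indicator (1 : EuclideanSpace ℝ ι → ℝ≥0∞) z := fun z => by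
      rcases eq_or_ne z 0 with rfl | hz
      · simp
      · have := hG.inj u z hz
        simp [hz, this]
    simp only [h0]
    rw [lintegral_indicator_one (measurableSet_singleton _), hN.zero]
  · rw [hG.lintegral_pushLevy θ (by fun_prop)]
    have h1 : ∀ u z, ENNReal.ofReal (min 1 (‖Matrix.toEuclideanLin (G u) z‖ ^ 2))
        ≤ ENNReal.ofReal (max 1 (K ^ 2)) * ENNReal.ofReal (min 1 (‖z‖ ^ 2)) := fun u z => by
      rw [← ENNReal.ofReal_mul (by positivity)]
      refine ENNReal.ofReal_le_ofReal ?_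
      rw [mul_min_of_nonneg _ _ (by positivity), mul_one]
      refine min_le_min (le_max_left _ _) ?_
      calc _ ≤ (K * ‖z‖) ^ 2 := by gcongr; exact hG.norm_apply_le u z
        _ = K ^ 2 * ‖z‖ ^ 2 := mul_pow _ _ _
        _ ≤ _ := by gcongr; exact le_max_right _ _
    refine lt_of_le_of_lt (lintegral_mono fun u => lintegral_mono fun z => h1 u z) ?_
    rw [lintegral_const, measure_univ, mul_one, lintegral_const_mul _ (by fun_prop)]
    exact ENNReal.mul_lt_top ENNReal.ofReal_lt_top hN.finite

lemma psi_transpose_bounded (hG : IsLinFamily K G) {N : Measure (EuclideanSpace ℝ ι)}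
    (hN : IsSymmetricLevyMeasure N) (q : EuclideanSpace ℝ ι') :
    ∃ C, ∀ u, ‖psi N (Matrix.toEuclideanLin (G u)ᵀ q)‖ ≤ C := by
  obtain ⟨C, hC⟩ := (isCompact_closedBall (0 : EuclideanSpace ℝ ι)
    (K * ‖q‖)).exists_bound_of_continuousOn hN.continuous_psi.continuousOn
  exact ⟨C, fun u => hC _ (by simpa using hG.norm_transpose_le u q)⟩

lemma integrable_psi_transpose (hG : IsLinFamily K G) [IsFiniteMeasure θ]
    {N : Measure (EuclideanSpace ℝ ι)} (hN : IsSymmetricLevyMeasure N) (q : EuclideanSpace ℝ ι') :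
    Integrable (fun u => psi N (Matrix.toEuclideanLin (G u)ᵀ q)) θ := by
  obtain ⟨C, hC⟩ := hG.psi_transpose_bounded hN q
  exact Integrable.of_bound (hN.continuous_psi.measurable.comp
    (hG.measurable_transpose q)).aestronglyMeasurable C (Eventually.of_forall hC)

lemma psi_pushLevy (hG : IsLinFamily K G) [IsProbabilityMeasure θ]
    {N : Measure (EuclideanSpace ℝ ι)} [SFinite N] (hN : IsSymmetricLevyMeasure N)
    (q : EuclideanSpace ℝ ι') :
    psi (pushLevy θ G N) q = ∫ u, psi N (Matrix.toEuclideanLin (G u)ᵀ q) ∂θ := by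
  have h1 := (hG.pushLevy_isLevy θ hN).ofReal_psi q
  rw [hG.lintegral_pushLevy θ (by fun_prop)] at h1
  simp only [inner_toEuclideanLin, ← hN.ofReal_psi] at h1
  rw [← ofReal_integral_eq_lintegral_ofReal (hG.integrable_psi_transpose θ hN q)
    (Eventually.of_forall fun u => psi_nonneg _ _)] at h1
  exact (ENNReal.ofReal_eq_ofReal_iff (psi_nonneg _ _)
    (integral_nonneg fun u => psi_nonneg _ _)).1 h1

lemma integral_abs_inner_pushSpec (hG : IsLinFamily K G) (hα : 0 < α) [IsProbabilityMeasure θ]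
    {m : Measure (USphere ι)} [IsFiniteMeasure m] (q : EuclideanSpace ℝ ι') :
    ENNReal.ofReal (∫ η : USphere ι', |inner ℝ q (η : EuclideanSpace ℝ ι')| ^ α
      ∂pushSpec θ s₀ α G m) = ∫⁻ u, ENNReal.ofReal (∫ s : USphere ι,
        |inner ℝ (Matrix.toEuclideanLin (G u)ᵀ q) (s : EuclideanSpace ℝ ι)| ^ α ∂m) ∂θ := by
  have := hG.isFiniteMeasure_pushSpec θ s₀ hα (m := m)
  rw [ofReal_integral_eq_lintegral_ofReal (integrable_abs_inner_rpow hα _ q)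
    (Eventually.of_forall fun s => by positivity), hG.lintegral_pushSpec θ s₀
    ((Measurable.pow_const (by fun_prop) _).ennreal_ofReal)]
  refine lintegral_congr fun u => ?_
  rw [ofReal_integral_eq_lintegral_ofReal (integrable_abs_inner_rpow hα _ _)
    (Eventually.of_forall fun s => by positivity)]
  refine lintegral_congr fun s => ?_
  set l := Matrix.toEuclideanLin (G u) (s : EuclideanSpace ℝ ι) with hl
  rw [← ENNReal.ofReal_mul (by positivity), ← Real.mul_rpow (norm_nonneg _) (abs_nonneg _)]
  congr 2
  rw [← inner_toEuclideanLin, ← hl]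
  nth_rewrite 1 [← abs_of_nonneg (norm_nonneg l)]
  rw [← abs_mul, ← real_inner_smul_right, norm_smul_dir]

end IsLinFamily
end Push
end StableChain

namespace StableChain
open scoped FourierTransform RealInnerProductSpace

/-! ### Densities by Fourier inversion -/
section Inversion
variable {ι : Type} [Fintype ι]

/-- The Gaussian kernel `(π c)^{N/2} exp(-π² c |v - x|²)`. -/
def gaussKer (ι : Type) [Fintype ι] (c : ℝ) (v x : EuclideanSpace ℝ ι) : ℝ :=
  (Real.pi * c) ^ ((Module.finrank ℝ (EuclideanSpace ℝ ι) : ℝ) / 2) *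
    Real.exp (-(Real.pi ^ 2 * c) * ‖v - x‖ ^ 2)

lemma gaussKer_nonneg {c : ℝ} (hc : 0 < c) (v x : EuclideanSpace ℝ ι) : 0 ≤ gaussKer ι c v x := by
  unfold gaussKer; positivity

lemma gaussKer_le {c : ℝ} (hc : 0 < c) (v x : EuclideanSpace ℝ ι) : gaussKer ι c v x ≤
    (Real.pi * c) ^ ((Module.finrank ℝ (EuclideanSpace ℝ ι) : ℝ) / 2) := by
  refine mul_le_of_le_one_right (by positivity) (Real.exp_le_one_iff.2 ?_)
  have : 0 ≤ Real.pi ^ 2 * c * ‖v - x‖ ^ 2 := by positivity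
  linarith

lemma measurable_gaussKer (c : ℝ) : Measurable fun p : EuclideanSpace ℝ ι × EuclideanSpace ℝ ι =>
    gaussKer ι c p.1 p.2 := by
  unfold gaussKer; fun_prop

lemma lintegral_gaussKer {c : ℝ} (hc : 0 < c) (x : EuclideanSpace ℝ ι) :
    ∫⁻ v, ENNReal.ofReal (gaussKer ι c v x) = 1 := by
  have hb : 0 < Real.pi ^ 2 * c := by positivity
  have hI := GaussianFourier.integral_rexp_neg_mul_sq_norm (V := EuclideanSpace ℝ ι) hb
  have hi : Integrable fun v : EuclideanSpace ℝ ι => Real.exp (-(Real.pi ^ 2 * c) * ‖v‖ ^ 2) := by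
    by_contra h
    rw [integral_undef h] at hI
    have : 0 < (Real.pi / (Real.pi ^ 2 * c)) ^
      ((Module.finrank ℝ (EuclideanSpace ℝ ι) : ℝ) / 2) := by positivity
    exact this.ne hI
  have e : ∀ v, gaussKer ι c v x = (Real.pi * c) ^ ((Module.finrank ℝ (EuclideanSpace ℝ ι) : ℝ) / 2)
      * (fun y => Real.exp (-(Real.pi ^ 2 * c) * ‖y‖ ^ 2)) (v - x) := fun v => rfl
  simp only [e]
  rw [← ofReal_integral_eq_lintegral_ofReal ((hi.comp_sub_right x).const_mul _)
    (Eventually.of_forall fun v => by positivity), integral_const_mul,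
    integral_sub_right_eq_self (fun y => Real.exp (-(Real.pi ^ 2 * c) * ‖y‖ ^ 2)), hI,
    ← Real.mul_rpow (by positivity) (by positivity)]
  have : Real.pi * c * (Real.pi / (Real.pi ^ 2 * c)) = 1 := by field_simp
  rw [this, Real.one_rpow, ENNReal.ofReal_one]

lemma gaussKer_eq_fourier {c : ℝ} (hc : 0 < c) (v x : EuclideanSpace ℝ ι) :
    (gaussKer ι c v x : ℂ) = ∫ w : EuclideanSpace ℝ ι, Complex.exp (-(c : ℂ)⁻¹ * ‖w‖ ^ 2
      + 2 * Real.pi * Complex.I * ⟪v, w⟫) * Complex.exp (⟪x, (-(2 * Real.pi)) • w⟫ * Complex.I) := by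
  have h := fourier_gaussian_innerProductSpace' (V := EuclideanSpace ℝ ι) (b := (c : ℂ)⁻¹)
    (by rw [← Complex.ofReal_inv, Complex.ofReal_re]; positivity) v x
  rw [Real.fourier_eq'] at h
  have e : ∀ w : EuclideanSpace ℝ ι, Complex.exp (-(c : ℂ)⁻¹ * ‖w‖ ^ 2
      + 2 * Real.pi * Complex.I * ⟪v, w⟫) * Complex.exp (⟪x, (-(2 * Real.pi)) • w⟫ * Complex.I)
      = Complex.exp (↑(-2 * Real.pi * ⟪w, x⟫) * Complex.I) •
        Complex.exp (-(c : ℂ)⁻¹ * ‖w‖ ^ 2 + 2 * Real.pi * Complex.I * ⟪v, w⟫) := fun w => by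
    rw [smul_eq_mul, mul_comm]
    congr 2
    rw [inner_smul_right, real_inner_comm]
    push_cast; ring
  simp only [e]
  rw [h, gaussKer]
  push_cast
  rw [Complex.ofReal_cpow (by positivity)]
  congr 1
  · push_cast
    congr 1
    rw [div_inv_eq_mul]
  · congr 1
    rw [div_inv_eq_mul]
    ring

variable {ν : Measure (EuclideanSpace ℝ ι)} [IsProbabilityMeasure ν]

lemma integral_gaussKer {c : ℝ} (hc : 0 < c) (v : EuclideanSpace ℝ ι) :
    ((∫ x, gaussKer ι c v x ∂ν : ℝ) : ℂ) = ∫ w : EuclideanSpace ℝ ι,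
      Complex.exp (-(c : ℂ)⁻¹ * ‖w‖ ^ 2 + 2 * Real.pi * Complex.I * ⟪v, w⟫) *
        charFun ν ((-(2 * Real.pi)) • w) := by
  rw [← integral_complex_ofReal]
  simp only [gaussKer_eq_fourier hc, charFun_apply, ← integral_const_mul]
  refine integral_integral_swap ?_
  have hJ : Integrable (fun w : EuclideanSpace ℝ ι => Complex.exp (-(c : ℂ)⁻¹ * ‖w‖ ^ 2
      + 2 * Real.pi * Complex.I * ⟪v, w⟫)) :=
    GaussianFourier.integrable_cexp_neg_mul_sq_norm_add
      (by rw [← Complex.ofReal_inv, Complex.ofReal_re]; positivity) _ _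
  refine ((hJ.comp_snd ν).norm).mono' ?_ (Eventually.of_forall fun p => ?_)
  · exact Measurable.aestronglyMeasurable (by simp only [Function.uncurry_def]; fun_prop)
  · simp only [Function.uncurry_def]
    rw [norm_mul, Complex.norm_exp_ofReal_mul_I, mul_one]

/-- The density obtained by Fourier inversion from the characteristic function `φ`. -/
def invDens (φ : EuclideanSpace ℝ ι → ℝ) (z : EuclideanSpace ℝ ι) : ℝ :=
  ((2 * Real.pi) ^ Fintype.card ι)⁻¹ *
    (∫ q, Complex.exp (-Complex.I * (⟪q, z⟫ : ℝ)) * (φ q : ℂ)).re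

variable {φ : EuclideanSpace ℝ ι → ℝ}

lemma integrable_scaled (hφ : Integrable φ) (h : ∀ q, charFun ν q = φ q) :
    Integrable fun w : EuclideanSpace ℝ ι => charFun ν ((-(2 * Real.pi)) • w) := by
  have h1 : Integrable (charFun ν) := by
    have : charFun ν = fun q => (φ q : ℂ) := funext h
    rw [this]
    exact hφ.ofReal
  exact h1.comp_smul (neg_ne_zero.2 (by positivity))

lemma fourierInv_scaled (h : ∀ q, charFun ν q = φ q) (z : EuclideanSpace ℝ ι) :
    𝓕⁻ (fun w : EuclideanSpace ℝ ι => charFun ν ((-(2 * Real.pi)) • w)) z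
      = (((2 * Real.pi) ^ Fintype.card ι)⁻¹ : ℝ) *
        ∫ q, Complex.exp (-Complex.I * (⟪q, z⟫ : ℝ)) * (φ q : ℂ) := by
  have h1 := Measure.integral_comp_smul (volume : Measure (EuclideanSpace ℝ ι))
    (fun q => Complex.exp (-Complex.I * (⟪q, z⟫ : ℝ)) * (φ q : ℂ)) (-(2 * Real.pi))
  rw [Real.fourierInv_eq']
  have e : |((-(2 * Real.pi)) ^ Module.finrank ℝ (EuclideanSpace ℝ ι))⁻¹|
      = ((2 * Real.pi) ^ Fintype.card ι)⁻¹ := by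
    rw [abs_inv, abs_pow, abs_neg, abs_of_pos (by positivity), finrank_euclideanSpace]
  rw [e, Complex.real_smul] at h1
  rw [← h1]
  refine integral_congr_ae (Eventually.of_forall fun w => ?_)
  simp only [h, smul_eq_mul]
  congr 2
  rw [real_inner_smul_left]
  push_cast; ring

lemma tendsto_gauss (hφ : Integrable φ) (h : ∀ q, charFun ν q = φ q) (z : EuclideanSpace ℝ ι) :
    Tendsto (fun c : ℝ => ((∫ x, gaussKer ι c z x ∂ν : ℝ) : ℂ)) atTop
      (𝓝 (𝓕⁻ (fun w : EuclideanSpace ℝ ι => charFun ν ((-(2 * Real.pi)) • w)) z)) := by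
  have hΦ := integrable_scaled hφ h
  have hf : Integrable fun w : EuclideanSpace ℝ ι =>
      Complex.exp (↑(2 * Real.pi * ⟪w, z⟫) * Complex.I) • charFun ν ((-(2 * Real.pi)) • w) := by
    have hm : Measurable fun w : EuclideanSpace ℝ ι =>
      Complex.exp (↑(2 * Real.pi * ⟪w, z⟫) * Complex.I) := by fun_prop
    refine hΦ.norm.mono' (hm.aestronglyMeasurable.smul hΦ.1) (Eventually.of_forall fun w => ?_)
    rw [norm_smul, Complex.norm_exp_ofReal_mul_I, one_mul]
  rw [Real.fourierInv_eq']
  refine (Real.tendsto_integral_cexp_sq_smul hf).congr' ?_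
  filter_upwards [Ioi_mem_atTop 0] with c hc
  rw [integral_gaussKer hc]
  refine integral_congr_ae (Eventually.of_forall fun w => ?_)
  simp only [smul_eq_mul]
  rw [← mul_assoc, ← Complex.exp_add]
  congr 2
  rw [real_inner_comm z w]
  push_cast; ring

lemma fourierInv_scaled_eq (hφ : Integrable φ) (h : ∀ q, charFun ν q = φ q)
    (z : EuclideanSpace ℝ ι) :
    𝓕⁻ (fun w : EuclideanSpace ℝ ι => charFun ν ((-(2 * Real.pi)) • w)) z = invDens φ z
      ∧ 0 ≤ invDens φ z ∧ Tendsto (fun c : ℝ => ∫ x, gaussKer ι c z x ∂ν) atTop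
        (𝓝 (invDens φ z)) := by
  have ht := tendsto_gauss hφ h z
  have hre := (Complex.continuous_re.tendsto _).comp ht
  have him := (Complex.continuous_im.tendsto _).comp ht
  have e : (𝓕⁻ (fun w : EuclideanSpace ℝ ι => charFun ν ((-(2 * Real.pi)) • w)) z).re
      = invDens φ z := by
    rw [fourierInv_scaled h, Complex.re_ofReal_mul, invDens]
  simp only [Function.comp_def, Complex.ofReal_im] at him
  have him0 := tendsto_nhds_unique him tendsto_const_nhds
  rw [e] at hre
  simp only [Function.comp_def, Complex.ofReal_re] at hre
  refine ⟨?_, ge_of_tendsto hre ?_, hre⟩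
  · rw [← e]
    refine Complex.ext (by simp) ?_
    rw [him0]; simp
  · filter_upwards [Ioi_mem_atTop 0] with c hc using integral_nonneg fun x => gaussKer_nonneg hc z x

lemma measurable_gauss {c : ℝ} : Measurable fun z => ∫ x, gaussKer ι c z x ∂ν :=
  (measurable_gaussKer c).stronglyMeasurable.integral_prod_right'.measurable

lemma measurable_invDens (hφ : Integrable φ) (h : ∀ q, charFun ν q = φ q) :
    Measurable (invDens φ) :=
  measurable_of_tendsto_metrizable (f := fun n : ℕ => fun z => ∫ x, gaussKer ι n z x ∂ν)
    (fun _ => measurable_gauss) (tendsto_pi_nhds.2 fun z =>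
      (fourierInv_scaled_eq hφ h z).2.2.comp tendsto_natCast_atTop_atTop)

lemma lintegral_gauss {c : ℝ} (hc : 0 < c) :
    ∫⁻ z, ENNReal.ofReal (∫ x, gaussKer ι c z x ∂ν) = 1 := by
  have e : ∀ z, ENNReal.ofReal (∫ x, gaussKer ι c z x ∂ν)
      = ∫⁻ x, ENNReal.ofReal (gaussKer ι c z x) ∂ν := fun z =>
    ofReal_integral_eq_lintegral_ofReal (Integrable.of_bound
      ((measurable_gaussKer c).comp (measurable_const.prodMk measurable_id)).aestronglyMeasurable _
      (Eventually.of_forall fun x => by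
        rw [Real.norm_eq_abs, abs_of_nonneg (gaussKer_nonneg hc z x)]
        exact gaussKer_le hc z x)) (Eventually.of_forall fun x => gaussKer_nonneg hc z x)
  simp only [e]
  rw [lintegral_lintegral_swap (measurable_gaussKer c).ennreal_ofReal.aemeasurable]
  simp [lintegral_gaussKer hc]

lemma lintegral_invDens_le (hφ : Integrable φ) (h : ∀ q, charFun ν q = φ q) :
    ∫⁻ z, ENNReal.ofReal (invDens φ z) ≤ 1 := by
  have ht : ∀ z, Tendsto (fun n : ℕ => ENNReal.ofReal (∫ x, gaussKer ι (n + 1 : ℕ) z x ∂ν)) atTop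
      (𝓝 (ENNReal.ofReal (invDens φ z))) := fun z =>
    (ENNReal.continuous_ofReal.tendsto _).comp ((fourierInv_scaled_eq hφ h z).2.2.comp
      (tendsto_natCast_atTop_atTop.comp (tendsto_add_atTop_nat 1)))
  calc ∫⁻ z, ENNReal.ofReal (invDens φ z)
      = ∫⁻ z, liminf (fun n : ℕ => ENNReal.ofReal (∫ x, gaussKer ι (n + 1 : ℕ) z x ∂ν)) atTop :=
        lintegral_congr fun z => (ht z).liminf_eq.symm
    _ ≤ liminf (fun n : ℕ => ∫⁻ z, ENNReal.ofReal (∫ x, gaussKer ι (n + 1 : ℕ) z x ∂ν)) atTop :=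
        lintegral_liminf_le fun n => measurable_gauss.ennreal_ofReal
    _ = 1 := by
        simp only [lintegral_gauss (show (0 : ℝ) < (_ + 1 : ℕ) by positivity)]
        simp

/-- A probability measure with an integrable real characteristic function has a density, given
by Fourier inversion. -/
theorem eq_withDensity_invDens (hφ : Integrable φ) (h : ∀ q, charFun ν q = φ q) :
    ν = volume.withDensity fun z => ENNReal.ofReal (invDens φ z) := by
  have hfin : IsFiniteMeasure (volume.withDensity fun z => ENNReal.ofReal (invDens φ z)) :=
    isFiniteMeasure_withDensity ((lintegral_invDens_le hφ h).trans_lt ENNReal.one_lt_top).ne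
  have hm := measurable_invDens hφ h
  have hΦ := integrable_scaled hφ h
  set Φ := fun w : EuclideanSpace ℝ ι => charFun ν ((-(2 * Real.pi)) • w) with hΦdef
  have hP : Integrable (invDens φ) := by
    refine ⟨hm.aestronglyMeasurable, ?_⟩
    rw [hasFiniteIntegral_iff_ofReal
      (Eventually.of_forall fun z => (fourierInv_scaled_eq hφ h z).2.1)]
    exact (lintegral_invDens_le hφ h).trans_lt ENNReal.one_lt_top
  have hPeq : 𝓕⁻ Φ = fun z => (invDens φ z : ℂ) :=
    funext fun z => (fourierInv_scaled_eq hφ h z).1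
  have hFΦ : Integrable (𝓕 Φ) := by
    have : 𝓕 Φ = fun z => 𝓕⁻ Φ (-z) := by
      ext z
      rw [Real.fourierInv_eq_fourier_neg, neg_neg]
    rw [this, hPeq]
    exact (hP.ofReal (𝕜 := ℂ)).comp_neg
  have hcont : Continuous (charFun ν) := by
    have : charFun ν = fun q => ∫ x, Complex.exp ((⟪x, q⟫ : ℝ) * Complex.I) ∂ν := rfl
    rw [this]
    refine continuous_of_dominated (bound := fun _ => 1) (fun q => by fun_prop)
      (fun q => Eventually.of_forall fun x => by rw [Complex.norm_exp_ofReal_mul_I])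
      (integrable_const _) (Eventually.of_forall fun x => by fun_prop)
  have hinv := Continuous.fourier_fourierInv_eq (f := Φ) (by fun_prop) hΦ hFΦ
  refine Measure.ext_of_charFun (funext fun q => ?_)
  have h1 := congrFun hinv ((-(2 * Real.pi)⁻¹) • q)
  rw [hPeq, Real.fourier_eq', hΦdef] at h1
  simp only [smul_smul] at h1
  rw [show -(2 * Real.pi) * -(2 * Real.pi)⁻¹ = 1 by field_simp, one_smul] at h1
  rw [← h1, charFun_apply, integral_withDensity_eq_integral_toReal_smul (by fun_prop)
    (Eventually.of_forall fun z => ENNReal.ofReal_lt_top)]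
  refine integral_congr_ae (Eventually.of_forall fun z => ?_)
  simp only [ENNReal.toReal_ofReal (fourierInv_scaled_eq hφ h z).2.1, Complex.real_smul, smul_eq_mul]
  rw [mul_comm]
  congr 3
  rw [real_inner_smul_right]
  field_simp

end Inversion
end StableChain

namespace StableChain

/-! ### The law of a stochastic integral -/
section StochInt
variable {m k : Type} [Fintype m] [Fintype k] [DecidableEq k] [DecidableEq m]

lemma stepFun_apply (N : ℕ) {τ : ℕ → ℝ≥0} (hτ : Monotone τ) (F : ℕ → Matrix m k ℝ) {i : ℕ}
    (hi : i < N) {u : ℝ} (hu : u ∈ Ioc (τ i : ℝ) (τ (i + 1))) : stepFun N τ F u = F i := by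
  rw [stepFun, Finset.sum_eq_single i, indicator_of_mem hu]
  · intro j _ hj
    refine indicator_of_notMem (fun h => ?_) _
    rcases lt_or_gt_of_ne hj with h' | h'
    · exact absurd (h.2.trans (NNReal.coe_le_coe.2 (hτ (Nat.succ_le_of_lt h')))) (not_le.2 hu.1)
    · exact absurd (hu.2.trans (NNReal.coe_le_coe.2 (hτ (Nat.succ_le_of_lt h')))) (not_le.2 h.1)
  · intro h
    exact absurd (Finset.mem_range.2 hi) h

lemma stepFun_eq_or (N : ℕ) {τ : ℕ → ℝ≥0} (hτ : Monotone τ) (F : ℕ → Matrix m k ℝ) (u : ℝ) :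
    stepFun N τ F u = 0 ∨ ∃ i, stepFun N τ F u = F i := by
  by_cases h : ∃ i < N, u ∈ Ioc (τ i : ℝ) (τ (i + 1))
  · obtain ⟨i, hi, hu⟩ := h
    exact Or.inr ⟨i, stepFun_apply N hτ F hi hu⟩
  · push Not at h
    exact Or.inl (Finset.sum_eq_zero fun i hi =>
      indicator_of_notMem (h i (Finset.mem_range.1 hi)) _)

lemma continuous_transpose_apply (q : EuclideanSpace ℝ m) :
    Continuous fun M : Matrix m k ℝ => Matrix.toEuclideanLin Mᵀ q := by
  refine (PiLp.continuous_toLp 2 _).comp (continuous_pi fun i => ?_)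
  change Continuous fun M : Matrix m k ℝ => ∑ j, M j i * q j
  exact continuous_finsetSum _ fun j _ => (continuous_id.matrix_elem j i).mul continuous_const

lemma norm_transpose_apply_le {K : ℝ} {M : Matrix m k ℝ} (hM : ∀ i j, |M i j| ≤ K)
    (q : EuclideanSpace ℝ m) :
    ‖Matrix.toEuclideanLin Mᵀ q‖ ≤ Fintype.card k * (Fintype.card m * K) * ‖q‖ := by
  refine (norm_toEuclideanLin_le _ _).trans (mul_le_mul_of_nonneg_right ?_ (norm_nonneg _))
  refine (l2_norm_le_sum_abs _).trans ((Finset.sum_le_sum fun i _ => Finset.sum_le_sum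
    fun j _ => hM j i).trans (by simp))

lemma measurable_transpose_apply {f : ℝ → Matrix m k ℝ} (hf : ∀ i j, Measurable fun u => f u i j)
    (q : EuclideanSpace ℝ m) : Measurable fun u => Matrix.toEuclideanLin (f u)ᵀ q := by
  refine (MeasurableEquiv.toLp 2 (k → ℝ)).symm.measurableEmbedding.measurable_comp_iff.1 ?_
  refine measurable_pi_iff.2 fun i => ?_
  change Measurable fun u => ∑ j, f u j i * q j
  exact Finset.measurable_fun_sum _ fun j _ => (hf j i).mul_const _

lemma measurable_stepFun (N : ℕ) (τ : ℕ → ℝ≥0) (F : ℕ → Matrix m k ℝ) :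
    ∀ i j, Measurable fun u => stepFun N τ F u i j := by
  intro i j
  unfold stepFun
  have : (fun u : ℝ => (∑ l ∈ Finset.range N, (Ioc (τ l : ℝ) (τ (l + 1))).indicator
      (fun _ => F l) u) i j) = fun u => ∑ l ∈ Finset.range N,
        (Ioc (τ l : ℝ) (τ (l + 1))).indicator (fun _ => F l i j) u := by
    ext u
    rw [Matrix.sum_apply]
    refine Finset.sum_congr rfl fun l _ => ?_
    by_cases h : u ∈ Ioc (τ l : ℝ) (τ (l + 1)) <;> simp [h]
  rw [this]
  exact Finset.measurable_fun_sum _ fun l _ => measurable_const.indicator measurableSet_Ioc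

lemma integral_stepFun (ψ : EuclideanSpace ℝ k → ℝ) (N : ℕ) {τ : ℕ → ℝ≥0} (hτ : Monotone τ)
    (F : ℕ → Matrix m k ℝ) (q : EuclideanSpace ℝ m) :
    ∫ u in Ioc (τ 0 : ℝ) (τ N), ψ (Matrix.toEuclideanLin (stepFun N τ F u)ᵀ q)
      = ∑ i ∈ Finset.range N, ((τ (i + 1) : ℝ) - τ i) * ψ (Matrix.toEuclideanLin (F i)ᵀ q) := by
  have hle : ∀ i, (τ i : ℝ) ≤ τ (i + 1) := fun i => NNReal.coe_le_coe.2 (hτ i.le_succ)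
  have hc : ∀ i < N, EqOn (fun u => ψ (Matrix.toEuclideanLin (stepFun N τ F u)ᵀ q))
      (fun _ => ψ (Matrix.toEuclideanLin (F i)ᵀ q)) (Ioc (τ i : ℝ) (τ (i + 1))) :=
    fun i hi u hu => by simp only [stepFun_apply N hτ F hi hu]
  rw [← intervalIntegral.integral_of_le (NNReal.coe_le_coe.2 (hτ N.zero_le)),
    ← intervalIntegral.sum_integral_adjacent_intervals (a := fun i => (τ i : ℝ))]
  · refine Finset.sum_congr rfl fun i hi => ?_
    rw [intervalIntegral.integral_of_le (hle i),
      setIntegral_congr_fun measurableSet_Ioc (hc i (Finset.mem_range.1 hi)), setIntegral_const,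
      smul_eq_mul, Measure.real, Real.volume_Ioc, ENNReal.toReal_ofReal (sub_nonneg.2 (hle i))]
  · intro i hi
    rw [intervalIntegrable_iff_integrableOn_Ioc_of_le (hle i)]
    exact (integrableOn_const (by simp)).congr_fun (hc i hi).symm measurableSet_Ioc

lemma charFun_map_toEuclideanLin (M : Matrix m k ℝ) (ν : Measure (EuclideanSpace ℝ k))
    (q : EuclideanSpace ℝ m) :
    charFun (ν.map (Matrix.toEuclideanLin M)) q = charFun ν (Matrix.toEuclideanLin Mᵀ q) := by
  have hm : Measurable (Matrix.toEuclideanLin M) := IsLinFamily.measurable_toEuclideanLin M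
  rw [charFun_apply, charFun_apply, integral_map hm.aemeasurable]
  · refine integral_congr_ae (Eventually.of_forall fun x => ?_)
    simp only
    rw [real_inner_comm, inner_toEuclideanLin, real_inner_comm]
  · exact Measurable.aestronglyMeasurable (by fun_prop)

variable {Ω : Type*} [MeasurableSpace Ω] {P : Measure Ω} {Z : ℝ≥0 → Ω → EuclideanSpace ℝ k}
  {ψ : EuclideanSpace ℝ k → ℝ}

lemma measurable_stepIntegral (hZ : ∀ u, Measurable (Z u)) (N : ℕ) (τ : ℕ → ℝ≥0)
    (F : ℕ → Matrix m k ℝ) : Measurable (stepIntegral N τ F Z) := by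
  unfold stepIntegral
  exact Finset.measurable_fun_sum _ fun i _ =>
    (IsLinFamily.measurable_toEuclideanLin (F i)).comp ((hZ _).sub (hZ _))

lemma charFun_stepIntegral (hZ : IsLevyProcess P Z)
    (hψ : ∀ (t : ℝ≥0) p, charFun (P.map (Z t)) p = Complex.exp (-((t : ℝ) * ψ p : ℝ)))
    (N : ℕ) {τ : ℕ → ℝ≥0} (hτ : Monotone τ) (F : ℕ → Matrix m k ℝ) (q : EuclideanSpace ℝ m) :
    charFun (P.map (stepIntegral N τ F Z)) q = Complex.exp (-((∫ u in Ioc (τ 0 : ℝ) (τ N),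
      ψ (Matrix.toEuclideanLin (stepFun N τ F u)ᵀ q) : ℝ))) := by
  have hL : ∀ i, Measurable (Matrix.toEuclideanLin (F i)) := fun i =>
    IsLinFamily.measurable_toEuclideanLin (F i)
  have hd : ∀ i, Measurable fun ω => Z (τ (i + 1)) ω - Z (τ i) ω := fun i =>
    (hZ.measurable _).sub (hZ.measurable _)
  have hind : iIndepFun (fun i ω => Matrix.toEuclideanLin (F i) (Z (τ (i + 1)) ω - Z (τ i) ω)) P :=
    (hZ.indep.nat hτ).comp (fun i => Matrix.toEuclideanLin (F i)) hL
  unfold stepIntegral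
  rw [iIndepFun.charFun_map_fun_finsetSum_eq_prod (X := fun i ω => Matrix.toEuclideanLin (F i)
    (Z (τ (i + 1)) ω - Z (τ i) ω)) (fun i _ => ((hL i).comp (hd i)).aemeasurable)
    (hind.restrict _), Finset.prod_apply, integral_stepFun ψ N hτ, Complex.ofReal_sum,
    ← Finset.sum_neg_distrib, Complex.exp_sum]
  refine Finset.prod_congr rfl fun i _ => ?_
  have h1 : P.map (fun ω => Z (τ (i + 1)) ω - Z (τ i) ω) = P.map (Z (τ (i + 1) - τ i)) := by
    have := (hZ.stationary (τ i) (τ (i + 1) - τ i)).map_eq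
    rwa [add_tsub_cancel_of_le (hτ i.le_succ)] at this
  rw [← NNReal.coe_sub (hτ i.le_succ), ← hψ, ← h1, ← charFun_map_toEuclideanLin,
    Measure.map_map (hL i) (hd i)]
  rfl

theorem HasStochIntegral.charFun_eq [IsProbabilityMeasure P] (hZ : IsLevyProcess P Z)
    (hψc : Continuous ψ)
    (hψ : ∀ (t : ℝ≥0) p, charFun (P.map (Z t)) p = Complex.exp (-((t : ℝ) * ψ p : ℝ)))
    {f : ℝ → Matrix m k ℝ} {t s : ℝ≥0} {X : Ω → EuclideanSpace ℝ m}
    (h : HasStochIntegral P Z f t s X) :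
    AEMeasurable X P ∧ ∀ q, charFun (P.map X) q = Complex.exp (-((∫ u in Ioc (t : ℝ) s,
      ψ (Matrix.toEuclideanLin (f u)ᵀ q) : ℝ))) := by
  obtain ⟨N, τ, F, hτ, ⟨K, hK⟩, hf, hX⟩ := h
  have hm : ∀ j, Measurable (stepIntegral (N j) (τ j) (F j) Z) := fun j =>
    measurable_stepIntegral hZ.measurable _ _ _
  have hXm : AEMeasurable X P := hX.aemeasurable fun j => (hm j).aemeasurable
  refine ⟨hXm, fun q => ?_⟩
  obtain ⟨ns, hns, hae⟩ := hX.exists_seq_tendsto_ae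
  have hl1 : Tendsto (fun j => charFun (P.map (stepIntegral (N (ns j)) (τ (ns j)) (F (ns j)) Z)) q)
      atTop (𝓝 (charFun (P.map X) q)) := by
    have e : ∀ {Y : Ω → EuclideanSpace ℝ m}, AEMeasurable Y P → charFun (P.map Y) q
        = ∫ ω, Complex.exp (inner ℝ (Y ω) q * Complex.I) ∂P := fun hY => by
      rw [charFun_apply, integral_map hY (Measurable.aestronglyMeasurable (by fun_prop))]
    rw [e hXm]
    simp only [e (hm _).aemeasurable]
    refine tendsto_integral_of_dominated_convergence (fun _ => 1) (fun j => ?_)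
      (integrable_const _) (fun j => Eventually.of_forall fun ω => ?_) ?_
    · have := hm (ns j)
      exact Measurable.aestronglyMeasurable (by fun_prop)
    · rw [Complex.norm_exp_ofReal_mul_I]
    · filter_upwards [hae] with ω hω
      have hc : Continuous fun x : EuclideanSpace ℝ m => Complex.exp (inner ℝ x q * Complex.I) := by
        fun_prop
      exact (hc.tendsto _).comp hω
  have hl2 : Tendsto (fun j => ∫ u in Ioc (t : ℝ) s,
      ψ (Matrix.toEuclideanLin (stepFun (N j) (τ j) (F j) u)ᵀ q)) atTop
      (𝓝 (∫ u in Ioc (t : ℝ) s, ψ (Matrix.toEuclideanLin (f u)ᵀ q))) := by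
    obtain ⟨C, hC⟩ := (isCompact_closedBall (0 : EuclideanSpace ℝ k)
      (Fintype.card k * (Fintype.card m * |K|) * ‖q‖)).exists_bound_of_continuousOn
      hψc.continuousOn
    have hcont := hψc.comp (continuous_transpose_apply (m := m) (k := k) q)
    refine tendsto_integral_of_dominated_convergence (fun _ => C) (fun j => ?_)
      (integrable_const _) (fun j => Eventually.of_forall fun u => hC _ ?_) ?_
    · exact (hψc.measurable.comp (measurable_transpose_apply
        (measurable_stepFun _ _ _) q)).aestronglyMeasurable
    · rw [mem_closedBall_zero_iff]
      refine norm_transpose_apply_le (fun a b => ?_) q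
      rcases stepFun_eq_or (N j) (hτ j).1 (F j) u with h0 | ⟨i, hi⟩
      · rw [h0]; simp
      · rw [hi]; exact (hK j i a b).trans (le_abs_self K)
    · filter_upwards [hf] with u hu
      exact (hcont.tendsto _).comp hu
  refine tendsto_nhds_unique hl1 ?_
  have e2 : ∀ j, charFun (P.map (stepIntegral (N (ns j)) (τ (ns j)) (F (ns j)) Z)) q
      = Complex.exp (-((∫ u in Ioc (t : ℝ) s,
        ψ (Matrix.toEuclideanLin (stepFun (N (ns j)) (τ (ns j)) (F (ns j)) u)ᵀ q) : ℝ))) := fun j => by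
    rw [charFun_stepIntegral hZ hψ _ (hτ _).1, (hτ _).2.1, (hτ _).2.2]
  simp only [e2]
  have hc : Continuous fun x : ℝ => Complex.exp (-(x : ℂ)) := by fun_prop
  exact (hc.tendsto _).comp (hl2.comp hns.tendsto_atTop)

end StochInt
end StableChain

namespace StableChain
open scoped Matrix.Norms.L2Operator

/-! ### Elliptic matrices -/
section Elliptic
variable {n d : ℕ} {κ : ℝ} {S : Matrix (Fin d) (Fin d) ℝ}

lemma toEuclideanLin_mul {m k l : Type*} [Fintype m] [Fintype k] [Fintype l] [DecidableEq k]
    [DecidableEq l] (M : Matrix m k ℝ) (N : Matrix k l ℝ) (x : EuclideanSpace ℝ l) :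
    Matrix.toEuclideanLin (M * N) x = Matrix.toEuclideanLin M (Matrix.toEuclideanLin N x) := by
  simp [Matrix.toLpLin_apply, Matrix.mulVec_mulVec]

lemma toEuclideanLin_one {k : Type*} [Fintype k] [DecidableEq k] (x : EuclideanSpace ℝ k) :
    Matrix.toEuclideanLin (1 : Matrix k k ℝ) x = x := by
  simp

lemma l2_norm_le {m k : Type*} [Fintype m] [Fintype k] [DecidableEq k] {M : Matrix m k ℝ} {C : ℝ}
    (hC : 0 ≤ C) (h : ∀ x, ‖Matrix.toEuclideanLin M x‖ ≤ C * ‖x‖) : ‖M‖ ≤ C := by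
  rw [Matrix.l2_opNorm_def]
  exact ContinuousLinearMap.opNorm_le_bound _ hC h

namespace IsElliptic

lemma norm_transpose_sq (h : IsElliptic κ S) (ξ : EuclideanSpace ℝ (Fin d)) :
    κ⁻¹ * ‖ξ‖ ^ 2 ≤ ‖Matrix.toEuclideanLin Sᵀ ξ‖ ^ 2 ∧
      ‖Matrix.toEuclideanLin Sᵀ ξ‖ ^ 2 ≤ κ * ‖ξ‖ ^ 2 := by
  have e : inner ℝ ξ (Matrix.toEuclideanCLM (𝕜 := ℝ) (S * Sᵀ) ξ)
      = ‖Matrix.toEuclideanLin Sᵀ ξ‖ ^ 2 := by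
    change inner ℝ ξ (Matrix.toEuclideanLin (S * Sᵀ) ξ) = _
    rw [toEuclideanLin_mul, inner_toEuclideanLin, real_inner_self_eq_norm_sq]
  rw [← e]
  exact h ξ

lemma norm_le (h : IsElliptic κ S) (hκ : 1 ≤ κ) : ‖S‖ ≤ √κ := by
  rw [← l2_norm_transpose]
  refine l2_norm_le (Real.sqrt_nonneg _) fun x => ?_
  rw [← Real.sqrt_sq (norm_nonneg x), ← Real.sqrt_mul (by linarith)]
  exact Real.le_sqrt_of_sq_le (h.norm_transpose_sq x).2

lemma le_norm_transpose (h : IsElliptic κ S) (hκ : 1 ≤ κ) (x : EuclideanSpace ℝ (Fin d)) :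
    ‖x‖ ≤ √κ * ‖Matrix.toEuclideanLin Sᵀ x‖ := by
  rw [← Real.sqrt_sq (norm_nonneg (Matrix.toEuclideanLin Sᵀ x)), ← Real.sqrt_mul (by linarith)]
  refine Real.le_sqrt_of_sq_le ?_
  have := (h.norm_transpose_sq x).1
  rwa [inv_mul_le_iff₀ (by linarith)] at this

lemma isUnit (h : IsElliptic κ S) (hκ : 1 ≤ κ) : IsUnit S.det := by
  rw [← Matrix.det_transpose, ← Matrix.isUnit_iff_isUnit_det, ← Matrix.mulVec_injective_iff_isUnit]
  intro x y hxy
  have h1 := h.le_norm_transpose hκ (WithLp.toLp 2 (x - y))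
  rw [Matrix.toLpLin_toLp, Matrix.toLin'_apply, Matrix.mulVec_sub] at h1
  have hxy' : Sᵀ *ᵥ x = Sᵀ *ᵥ y := hxy
  rw [hxy', sub_self, WithLp.toLp_zero, norm_zero, mul_zero, norm_le_zero_iff] at h1
  have := congrArg (WithLp.ofLp) h1
  exact sub_eq_zero.1 this

lemma le_norm (h : IsElliptic κ S) (hκ : 1 ≤ κ) (x : EuclideanSpace ℝ (Fin d)) :
    ‖x‖ ≤ √κ * ‖Matrix.toEuclideanLin S x‖ := by
  have hu := h.isUnit hκ
  have hn : ‖S⁻¹‖ ≤ √κ := by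
    rw [← l2_norm_transpose]
    refine l2_norm_le (Real.sqrt_nonneg _) fun y => ?_
    refine (h.le_norm_transpose hκ _).trans_eq ?_
    rw [← toEuclideanLin_mul, ← Matrix.transpose_mul, Matrix.nonsing_inv_mul _ hu,
      Matrix.transpose_one, toEuclideanLin_one]
  calc ‖x‖ = ‖Matrix.toEuclideanLin S⁻¹ (Matrix.toEuclideanLin S x)‖ := by
        rw [← toEuclideanLin_mul, Matrix.nonsing_inv_mul _ hu, toEuclideanLin_one]
    _ ≤ _ := (norm_toEuclideanLin_le _ _).trans
        (mul_le_mul_of_nonneg_right hn (norm_nonneg _))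

lemma one (hκ : 1 ≤ κ) : IsElliptic κ (1 : Matrix (Fin d) (Fin d) ℝ) := fun ξ => by
  have e : inner ℝ ξ (Matrix.toEuclideanCLM (𝕜 := ℝ) (1 * (1 : Matrix (Fin d) (Fin d) ℝ)ᵀ) ξ)
      = ‖ξ‖ ^ 2 := by
    simp
  rw [e]
  have := inv_le_one_of_one_le₀ hκ
  constructor <;> nlinarith [sq_nonneg ‖ξ‖]

end IsElliptic
end Elliptic

/-! ### The family of maps carried by a chain -/
section ChainFam
variable {n d : ℕ} {K aLow κ : ℝ} {A : ℝ → Matrix (Fin n × Fin d) (Fin n × Fin d) ℝ}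
  {R : ℝ → ℝ → Matrix (Fin n × Fin d) (Fin n × Fin d) ℝ} {σ : ℝ → Matrix (Fin d) (Fin d) ℝ}

/-- The projection of `ℝ` onto `[0, 1]`. -/
def clamp (v : ℝ) : ℝ := projIcc (0 : ℝ) 1 zero_le_one v

lemma clamp_mem (v : ℝ) : clamp v ∈ Icc (0 : ℝ) 1 := (projIcc (0 : ℝ) 1 zero_le_one v).2

lemma clamp_of_mem {v : ℝ} (hv : v ∈ Icc (0 : ℝ) 1) : clamp v = v := by
  simp [clamp, projIcc_of_mem _ hv]

lemma abs_clamp_sub_le (u v : ℝ) : |clamp u - clamp v| ≤ |u - v| := by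
  have := (LipschitzWith.projIcc (a := (0 : ℝ)) (b := 1) zero_le_one).dist_le_mul u v
  simpa [Subtype.dist_eq, Real.dist_eq, clamp] using this

/-- The maps `R_{1,v} B`. -/
def chainMap (R : ℝ → ℝ → Matrix (Fin n × Fin d) (Fin n × Fin d) ℝ) (v : ℝ) :
    Matrix (Fin n × Fin d) (Fin d) ℝ := R 1 (clamp v) * injB n d

/-- The maps `R_{1,v} B σ_v`. -/
def chainFam (R : ℝ → ℝ → Matrix (Fin n × Fin d) (Fin n × Fin d) ℝ)
    (σ : ℝ → Matrix (Fin d) (Fin d) ℝ) (v : ℝ) : Matrix (Fin n × Fin d) (Fin d) ℝ :=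
  chainMap R v * σ v

/-- A bound for the maps `R_{1,v} B σ_v`. -/
def famBound (n d : ℕ) (K κ : ℝ) : ℝ := flowBound n d K * √κ

lemma norm_injB_apply (hn : 1 ≤ n) (x : EuclideanSpace ℝ (Fin d)) :
    ‖Matrix.toEuclideanLin (injB n d) x‖ = ‖x‖ := by rw [injB_apply hn, norm_emb]

lemma norm_injB_le (hn : 1 ≤ n) : ‖injB n d‖ ≤ 1 :=
  l2_norm_le zero_le_one fun x => by rw [norm_injB_apply hn, one_mul]

lemma injB_transpose_apply (hn : 1 ≤ n) (y : ESp n d) :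
    Matrix.toEuclideanLin (injB n d)ᵀ y = blkv y ⟨0, hn⟩ := by
  refine ext_inner_right ℝ fun x => ?_
  rw [← inner_toEuclideanLin, injB_apply hn, inner_emb]

lemma chainFam_apply (v : ℝ) (x : EuclideanSpace ℝ (Fin d)) :
    Matrix.toEuclideanLin (chainFam R σ v) x
      = Matrix.toEuclideanLin (chainMap R v) (Matrix.toEuclideanLin (σ v) x) :=
  toEuclideanLin_mul _ _ _

lemma chainFam_transpose_apply (hn : 1 ≤ n) (v : ℝ) (q : ESp n d) :
    Matrix.toEuclideanLin (chainFam R σ v)ᵀ q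
      = Matrix.toEuclideanLin (σ v)ᵀ (blkv (IsChainFlow.adj R q (clamp v)) ⟨0, hn⟩) := by
  rw [chainFam, chainMap, Matrix.transpose_mul, Matrix.transpose_mul, toEuclideanLin_mul,
    toEuclideanLin_mul, injB_transpose_apply hn]
  rfl

namespace IsChainFlow

lemma norm_le_flowBound (F : IsChainFlow n d K aLow A R) {v w : ℝ} (hv : v ∈ Icc (0 : ℝ) 1)
    (hw : w ∈ Icc (0 : ℝ) 1) : ‖R v w‖ ≤ flowBound n d K := F.flow.norm_le hw hv

lemma norm_chainMap_le (F : IsChainFlow n d K aLow A R) (hn : 1 ≤ n) (v : ℝ) :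
    ‖chainMap R v‖ ≤ flowBound n d K := by
  refine (Matrix.l2_opNorm_mul _ _).trans ?_
  have h1 := F.norm_le_flowBound (right_mem_Icc.2 zero_le_one) (clamp_mem v)
  have := norm_injB_le (n := n) (d := d) hn
  nlinarith [norm_nonneg (R 1 (clamp v)), norm_nonneg (injB n d)]

lemma norm_chainMap_sub_le (F : IsChainFlow n d K aLow A R) (hn : 1 ≤ n) (u v : ℝ) :
    ‖chainMap R u - chainMap R v‖ ≤ flowBound n d K * (K * flowBound n d K) * |u - v| := by
  rw [chainMap, chainMap, ← Matrix.sub_mul]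
  refine (Matrix.l2_opNorm_mul _ _).trans ?_
  have h1 : ‖R 1 (clamp u) - R 1 (clamp v)‖
      ≤ flowBound n d K * (K * flowBound n d K) * |clamp u - clamp v| :=
    F.flow.norm_sub_le (right_mem_Icc.2 zero_le_one) (clamp_mem u) (clamp_mem v)
  have hK := F.flow.K_nonneg zero_le_one
  have hF := flowBound_nonneg n d K
  calc _ ≤ ‖R 1 (clamp u) - R 1 (clamp v)‖ * 1 :=
        mul_le_mul_of_nonneg_left (norm_injB_le hn) (norm_nonneg _)
    _ ≤ _ := by rw [mul_one]; exact h1.trans (mul_le_mul_of_nonneg_left (abs_clamp_sub_le u v)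
        (by positivity))

lemma le_norm_chainMap (F : IsChainFlow n d K aLow A R) (hn : 1 ≤ n) (v : ℝ)
    (x : EuclideanSpace ℝ (Fin d)) :
    ‖x‖ ≤ flowBound n d K * ‖Matrix.toEuclideanLin (chainMap R v) x‖ := by
  have h1 : (1 : ℝ) ∈ Icc (0 : ℝ) 1 := right_mem_Icc.2 zero_le_one
  have e : Matrix.toEuclideanLin (R (clamp v) 1) (Matrix.toEuclideanLin (chainMap R v) x)
      = Matrix.toEuclideanLin (injB n d) x := by
    rw [← toEuclideanLin_mul, chainMap, ← Matrix.mul_assoc, F.flow.mul_eq_one (clamp_mem v) h1,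
      Matrix.one_mul]
  rw [← norm_injB_apply hn, ← e]
  exact (norm_toEuclideanLin_le _ _).trans (mul_le_mul_of_nonneg_right
    (F.norm_le_flowBound (clamp_mem v) h1) (norm_nonneg _))

lemma measurable_chainMap (F : IsChainFlow n d K aLow A R) (hn : 1 ≤ n) (i j) :
    Measurable fun v => chainMap R v i j := by
  refine Continuous.measurable ?_
  refine (LipschitzWith.of_dist_le_mul (K := (flowBound n d K * (K * flowBound n d K)).toNNReal)
    fun u v => ?_).continuous
  rw [Real.coe_toNNReal _ (by
    have := flowBound_nonneg n d K; have := F.flow.K_nonneg zero_le_one; positivity),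
    Real.dist_eq, Real.dist_eq]
  exact (abs_entry_le (chainMap R u - chainMap R v) i j).trans (F.norm_chainMap_sub_le hn u v)

lemma isLinFamily (F : IsChainFlow n d K aLow A R) (hn : 1 ≤ n) (hκ : 1 ≤ κ)
    (hσm : ∀ i j, Measurable fun v => σ v i j) (hσ : ∀ v, IsElliptic κ (σ v)) :
    IsLinFamily (famBound n d K κ) (chainFam R σ) := by
  refine ⟨fun i j => ?_, fun v x hx h0 => hx ?_, fun v => ?_⟩
  · simp only [chainFam, Matrix.mul_apply]
    exact Finset.measurable_fun_sum _ fun l _ => (F.measurable_chainMap hn i l).mul (hσm l j)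
  · have h1 := (hσ v).le_norm hκ x
    have h2 := F.le_norm_chainMap hn v (Matrix.toEuclideanLin (σ v) x)
    rw [← chainFam_apply, h0, norm_zero, mul_zero] at h2
    have h3 := le_antisymm h2 (norm_nonneg _)
    rw [h3, mul_zero] at h1
    exact norm_le_zero_iff.1 h1
  · exact (Matrix.l2_opNorm_mul _ _).trans (mul_le_mul (F.norm_chainMap_le hn v)
      ((hσ v).norm_le hκ) (norm_nonneg _) (flowBound_nonneg _ _ _))

lemma le_norm_chainFam (F : IsChainFlow n d K aLow A R) (hn : 1 ≤ n) (hκ : 1 ≤ κ)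
    (hσ : ∀ v, IsElliptic κ (σ v)) (v : ℝ) (x : EuclideanSpace ℝ (Fin d)) :
    ‖x‖ ≤ famBound n d K κ * ‖Matrix.toEuclideanLin (chainFam R σ v) x‖ := by
  refine ((hσ v).le_norm hκ x).trans ?_
  rw [chainFam_apply, famBound, mul_comm (flowBound n d K), mul_assoc]
  exact mul_le_mul_of_nonneg_left (F.le_norm_chainMap hn v _) (Real.sqrt_nonneg _)

end IsChainFlow
end ChainFam
end StableChain

namespace StableChain
open scoped Matrix.Norms.L2Operator Pointwise

/-! ### Caps of the sphere -/

lemma exists_toSphere_cap_le (d : ℕ) (hd : 1 ≤ d) : ∃ C : ℝ≥0, ∀ (s : Set (USphere (Fin d))) (δ : ℝ),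
    MeasurableSet s → 0 < δ → δ ≤ 1 →
    (∀ x ∈ s, ∀ y ∈ s, ‖(x : EuclideanSpace ℝ (Fin d)) - y‖ ≤ δ) →
    (volume : Measure (EuclideanSpace ℝ (Fin d))).toSphere s
      ≤ C * ENNReal.ofReal (δ ^ (d - 1)) := by
  set V := (volume : Measure (EuclideanSpace ℝ (Fin d))) (Metric.ball 0 1) with hV
  have hVt : V ≠ ∞ := measure_ball_lt_top.ne
  refine ⟨d * (2 ^ (d + 1) * V.toNNReal), fun s δ hs hδ hδ1 hdist => ?_⟩
  rcases s.eq_empty_or_nonempty with rfl | ⟨x₀, hx₀⟩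
  · simp
  set x : EuclideanSpace ℝ (Fin d) := (x₀ : EuclideanSpace ℝ (Fin d)) with hx
  have hsub : Ioo (0 : ℝ) 1 • ((↑) '' s : Set (EuclideanSpace ℝ (Fin d)))
      ⊆ ⋃ k ∈ Finset.range (⌊1 / δ⌋₊ + 1), Metric.closedBall (((k : ℝ) * δ) • x) (2 * δ) := by
    rintro _ ⟨r, hr, _, ⟨y, hy, rfl⟩, rfl⟩
    have hk : ⌊r / δ⌋₊ ≤ ⌊1 / δ⌋₊ :=
      Nat.floor_le_floor (div_le_div_of_nonneg_right hr.2.le hδ.le)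
    refine mem_biUnion (Finset.mem_coe.2 (Finset.mem_range.2 (Nat.lt_succ_of_le hk))) ?_
    rw [mem_closedBall_iff_norm]
    have h1 := Nat.floor_le (div_nonneg hr.1.le hδ.le)
    have h2 := Nat.lt_floor_add_one (r / δ)
    rw [le_div_iff₀ hδ] at h1
    rw [div_lt_iff₀ hδ] at h2
    have e : r • (y : EuclideanSpace ℝ (Fin d)) - ((⌊r / δ⌋₊ : ℝ) * δ) • x
        = r • ((y : EuclideanSpace ℝ (Fin d)) - x) + (r - (⌊r / δ⌋₊ : ℝ) * δ) • x := by module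
    change ‖r • (y : EuclideanSpace ℝ (Fin d)) - _‖ ≤ _
    rw [e]
    refine (norm_add_le _ _).trans ?_
    rw [norm_smul, norm_smul, Real.norm_eq_abs, Real.norm_eq_abs, abs_of_pos hr.1,
      abs_of_nonneg (by linarith), hx, norm_sphere]
    have h3 := hdist y hy x₀ hx₀
    nlinarith [hr.1, hr.2, norm_nonneg ((y : EuclideanSpace ℝ (Fin d)) - x₀)]
  rw [Measure.toSphere_apply' _ hs, finrank_euclideanSpace, Fintype.card_fin]
  have hball : ∀ k : ℕ, volume (Metric.closedBall (((k : ℝ) * δ) • x) (2 * δ))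
      = ENNReal.ofReal ((2 * δ) ^ d) * V := fun k => by
    rw [Measure.addHaar_closedBall _ _ (by positivity), finrank_euclideanSpace, Fintype.card_fin]
  have h4 : ((⌊1 / δ⌋₊ + 1 : ℕ) : ℝ) * (2 * δ) ^ d ≤ 2 ^ (d + 1) * δ ^ (d - 1) := by
    have h5 : ((⌊1 / δ⌋₊ + 1 : ℕ) : ℝ) ≤ 2 / δ := by
      have h6 := Nat.floor_le (div_nonneg zero_le_one hδ.le)
      have h7 : 1 ≤ 1 / δ := by rw [le_div_iff₀ hδ]; linarith
      push_cast
      calc _ ≤ 1 / δ + 1 / δ := add_le_add h6 h7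
        _ = 2 / δ := by ring
    obtain ⟨e, rfl⟩ : ∃ e, d = e + 1 := ⟨d - 1, by omega⟩
    calc _ ≤ 2 / δ * (2 * δ) ^ (e + 1) := by gcongr
      _ = 2 ^ (e + 1 + 1) * δ ^ (e + 1 - 1) := by
        rw [Nat.add_sub_cancel, mul_pow, pow_succ δ]; field_simp; ring
  calc _ ≤ (d : ℝ≥0∞) * ∑ k ∈ Finset.range (⌊1 / δ⌋₊ + 1),
        volume (Metric.closedBall (((k : ℝ) * δ) • x) (2 * δ)) := by
        gcongr
        exact (measure_mono hsub).trans (measure_biUnion_finset_le _ _)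
    _ = d * (ENNReal.ofReal (((⌊1 / δ⌋₊ + 1 : ℕ) : ℝ) * (2 * δ) ^ d) * V) := by
        simp only [hball, Finset.sum_const, Finset.card_range, nsmul_eq_mul]
        rw [ENNReal.ofReal_mul (by positivity), ENNReal.ofReal_natCast, mul_assoc]
    _ ≤ d * (ENNReal.ofReal (2 ^ (d + 1) * δ ^ (d - 1)) * V) := by gcongr
    _ = _ := by
        rw [ENNReal.ofReal_mul (by positivity), ENNReal.ofReal_pow (by norm_num)]
        push_cast
        rw [ENNReal.coe_toNNReal hVt]
        simp only [ENNReal.ofReal_ofNat]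
        ring

/-! ### Directions -/
section Directions
variable {ι ι' : Type} [Fintype ι] [Fintype ι'] [DecidableEq ι] [DecidableEq ι'] (s₀ : USphere ι')

lemma dir_smul {c : ℝ} (hc : 0 < c) (x : EuclideanSpace ℝ ι') : dir s₀ (c • x) = dir s₀ x := by
  rcases eq_or_ne x 0 with rfl | hx
  · simp
  · ext1
    rw [dir_coe s₀ hx, dir_coe s₀ (smul_ne_zero hc.ne' hx), norm_smul, Real.norm_eq_abs,
      abs_of_pos hc, smul_smul]
    congr 1
    field_simp

lemma norm_mul_dir_sub_le (x y : EuclideanSpace ℝ ι') :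
    ‖x‖ * ‖(dir s₀ x : EuclideanSpace ℝ ι') - dir s₀ y‖ ≤ 2 * ‖x - y‖ := by
  have e : ‖x‖ • ((dir s₀ x : EuclideanSpace ℝ ι') - dir s₀ y)
      = (x - y) + (‖y‖ - ‖x‖) • (dir s₀ y : EuclideanSpace ℝ ι') := by
    rw [smul_sub, sub_smul, norm_smul_dir, norm_smul_dir]; abel
  have h1 : ‖‖x‖ • ((dir s₀ x : EuclideanSpace ℝ ι') - dir s₀ y)‖
      = ‖x‖ * ‖(dir s₀ x : EuclideanSpace ℝ ι') - dir s₀ y‖ := by rw [norm_smul, norm_norm]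
  rw [← h1, e]
  refine (norm_add_le _ _).trans ?_
  rw [norm_smul, norm_sphere, mul_one, Real.norm_eq_abs, abs_sub_comm]
  linarith [abs_norm_sub_norm_le x y]

lemma norm_sub_le_dir_sub {M : Matrix ι' ι ℝ} {C : ℝ}
    (h1 : ∀ x, ‖Matrix.toEuclideanLin M x‖ ≤ C * ‖x‖)
    (h2 : ∀ x, ‖x‖ ≤ C * ‖Matrix.toEuclideanLin M x‖) (x y : USphere ι) :
    ‖(x : EuclideanSpace ℝ ι) - y‖ ≤ 2 * C ^ 2 *
      ‖(dir s₀ (Matrix.toEuclideanLin M (x : EuclideanSpace ℝ ι)) : EuclideanSpace ℝ ι')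
        - dir s₀ (Matrix.toEuclideanLin M (y : EuclideanSpace ℝ ι))‖ := by
  have hp : ∀ z : USphere ι, 0 < ‖Matrix.toEuclideanLin M (z : EuclideanSpace ℝ ι)‖ := fun z => by
    have := h2 z
    rw [norm_sphere] at this
    by_contra h
    rw [le_antisymm (not_lt.1 h) (norm_nonneg _), mul_zero] at this
    linarith
  have hC : 0 < C := by
    have h3 := h1 x
    rw [norm_sphere, mul_one] at h3
    exact (hp x).trans_le h3
  have hdir : ∀ z : USphere ι, dir x (‖Matrix.toEuclideanLin M (z : EuclideanSpace ℝ ι)‖⁻¹ •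
      (z : EuclideanSpace ℝ ι)) = z := fun z => by
    rw [dir_smul x (inv_pos.2 (hp z))]
    ext1
    rw [dir_coe x (by rw [← norm_ne_zero_iff, norm_sphere]; exact one_ne_zero), norm_sphere]
    simp
  have h3 := norm_mul_dir_sub_le x (‖Matrix.toEuclideanLin M (x : EuclideanSpace ℝ ι)‖⁻¹ •
    (x : EuclideanSpace ℝ ι)) (‖Matrix.toEuclideanLin M (y : EuclideanSpace ℝ ι)‖⁻¹ •
    (y : EuclideanSpace ℝ ι))
  rw [hdir, hdir, norm_smul, norm_inv, norm_norm, norm_sphere, mul_one] at h3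
  have h4 := h2 (‖Matrix.toEuclideanLin M (x : EuclideanSpace ℝ ι)‖⁻¹ •
    (x : EuclideanSpace ℝ ι) - ‖Matrix.toEuclideanLin M (y : EuclideanSpace ℝ ι)‖⁻¹ •
    (y : EuclideanSpace ℝ ι))
  rw [map_sub, map_smul, map_smul, ← dir_coe s₀ (norm_pos_iff.1 (hp x)),
    ← dir_coe s₀ (norm_pos_iff.1 (hp y))] at h4
  have h5 := h1 x
  rw [norm_sphere, mul_one] at h5
  rw [inv_mul_le_iff₀ (hp x)] at h3
  set D := ‖(dir s₀ (Matrix.toEuclideanLin M (x : EuclideanSpace ℝ ι)) : EuclideanSpace ℝ ι')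
        - dir s₀ (Matrix.toEuclideanLin M (y : EuclideanSpace ℝ ι))‖
  have hD : 0 ≤ D := norm_nonneg _
  calc _ ≤ ‖Matrix.toEuclideanLin M (x : EuclideanSpace ℝ ι)‖ * (2 * (C * D)) :=
        h3.trans (by gcongr)
    _ ≤ C * (2 * (C * D)) := by gcongr
    _ = _ := by ring

end Directions

/-! ### Dimension of the support: lower bound -/
section Lower
variable {ι' : Type} [Fintype ι'] [DecidableEq ι'] {d : ℕ} {K α : ℝ}
  {G : ℝ → Matrix ι' (Fin d) ℝ} (s₀ : USphere ι')

lemma IsLinFamily.pushSpec_mono (hG : IsLinFamily K G) {θ θ' : Measure ℝ} [SFinite θ] [SFinite θ']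
    (h : θ' ≤ θ) {m : Measure (USphere (Fin d))} [SFinite m] :
    pushSpec θ' s₀ α G m ≤ pushSpec θ s₀ α G m := by
  refine Measure.le_iff.2 fun s hs => ?_
  rw [← lintegral_indicator_one hs, ← lintegral_indicator_one hs,
    hG.lintegral_pushSpec θ' s₀ (measurable_one.indicator hs),
    hG.lintegral_pushSpec θ s₀ (measurable_one.indicator hs)]
  exact lintegral_mono' h le_rfl

lemma IsLinFamily.pushSpec_univ_ne_zero (hG : IsLinFamily K G) {θ : Measure ℝ} [SFinite θ]
    (hθ : θ ≠ 0) {m : Measure (USphere (Fin d))} [SFinite m] (hm : m ≠ 0) :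
    pushSpec θ s₀ α G m univ ≠ 0 := by
  have h1 : Measurable fun p : ℝ × USphere (Fin d) => ENNReal.ofReal
    (‖Matrix.toEuclideanLin (G p.1) (p.2 : EuclideanSpace ℝ (Fin d))‖ ^ α) :=
    (hG.measurable_sphere.norm.pow_const _).ennreal_ofReal
  have h2 : Measurable fun p : ℝ × USphere (Fin d) =>
      dir s₀ (Matrix.toEuclideanLin (G p.1) (p.2 : EuclideanSpace ℝ (Fin d))) :=
    (measurable_dir s₀).comp hG.measurable_sphere
  intro h
  rw [pushSpec, Measure.map_apply h2 MeasurableSet.univ, preimage_univ,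
    withDensity_apply _ MeasurableSet.univ, Measure.restrict_univ, lintegral_eq_zero_iff h1] at h
  have h3 : ∀ᵐ p ∂(θ.prod m), False := by
    filter_upwards [h] with p hp
    have h4 := norm_pos_iff.2 (hG.apply_sphere_ne p.1 p.2)
    have h5 : (0 : ℝ) < ‖Matrix.toEuclideanLin (G p.1) (p.2 : EuclideanSpace ℝ (Fin d))‖ ^ α := by
      positivity
    exact (ENNReal.ofReal_pos.2 h5).ne' hp
  rw [eventually_false_iff_eq_bot, ae_eq_bot] at h3
  have h6 : θ.prod m univ = θ univ * m univ := by
    rw [← univ_prod_univ, Measure.prod_prod]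
  rw [h3, Measure.coe_zero, Pi.zero_apply, eq_comm, mul_eq_zero, Measure.measure_univ_eq_zero,
    Measure.measure_univ_eq_zero] at h6
  exact h6.elim hθ hm

lemma IsLinFamily.pushSpec_le_of_cap (hG : IsLinFamily K G) (hα : 0 < α) {ε C δ : ℝ} (hC : 0 ≤ C)
    (hsep : ∀ u ∈ Ioc 0 ε, ∀ v ∈ Ioc 0 ε, ∀ x y : USphere (Fin d), |u - v| ≤ C *
      ‖(dir s₀ (Matrix.toEuclideanLin (G u) (x : EuclideanSpace ℝ (Fin d))) : EuclideanSpace ℝ ι')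
        - dir s₀ (Matrix.toEuclideanLin (G v) (y : EuclideanSpace ℝ (Fin d)))‖)
    {m : Measure (USphere (Fin d))} [SFinite m] {s : Set (USphere ι')} (hs : MeasurableSet s)
    (hδ : ∀ x ∈ s, ∀ y ∈ s, ‖(x : EuclideanSpace ℝ ι') - y‖ ≤ δ) {B : ℝ≥0∞}
    (hB : ∀ u ∈ Ioc 0 ε, m {x | dir s₀ (Matrix.toEuclideanLin (G u)
      (x : EuclideanSpace ℝ (Fin d))) ∈ s} ≤ B) :
    pushSpec (volume.restrict (Ioc 0 ε)) s₀ α G m s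
      ≤ ENNReal.ofReal (2 * (C * δ)) * (ENNReal.ofReal (K ^ α) * B) := by
  rw [← lintegral_indicator_one hs, hG.lintegral_pushSpec _ s₀ (measurable_one.indicator hs)]
  set f : ℝ → ℝ≥0∞ := fun u => ∫⁻ x : USphere (Fin d),
    ENNReal.ofReal (‖Matrix.toEuclideanLin (G u) (x : EuclideanSpace ℝ (Fin d))‖ ^ α) *
      s.indicator 1 (dir s₀ (Matrix.toEuclideanLin (G u) (x : EuclideanSpace ℝ (Fin d)))) ∂m with hf
  have hle : ∀ u ∈ Ioc 0 ε, f u ≤ ENNReal.ofReal (K ^ α) * B := fun u hu => by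
    have hcm : MeasurableSet {x : USphere (Fin d) | dir s₀ (Matrix.toEuclideanLin (G u)
        (x : EuclideanSpace ℝ (Fin d))) ∈ s} :=
      ((measurable_dir s₀).comp ((IsLinFamily.measurable_toEuclideanLin (G u)).comp
        measurable_subtype_coe)) hs
    calc f u ≤ ∫⁻ x : USphere (Fin d), ENNReal.ofReal (K ^ α) *
          {x : USphere (Fin d) | dir s₀ (Matrix.toEuclideanLin (G u)
            (x : EuclideanSpace ℝ (Fin d))) ∈ s}.indicator 1 x ∂m := by
          refine lintegral_mono fun x => mul_le_mul' (ENNReal.ofReal_le_ofReal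
            (Real.rpow_le_rpow (norm_nonneg _) ?_ hα.le)) le_rfl
          simpa [norm_sphere] using hG.norm_apply_le u (x : EuclideanSpace ℝ (Fin d))
      _ ≤ _ := by
          rw [lintegral_const_mul _ (measurable_one.indicator hcm), lintegral_indicator_one hcm]
          gcongr
          exact hB u hu
  by_cases hU : ∃ u ∈ Ioc 0 ε, ∃ x : USphere (Fin d),
      dir s₀ (Matrix.toEuclideanLin (G u) (x : EuclideanSpace ℝ (Fin d))) ∈ s
  · obtain ⟨v, hv, y, hy⟩ := hU
    calc ∫⁻ u in Ioc 0 ε, f u ≤ ∫⁻ u in Ioc 0 ε, (Icc (v - C * δ) (v + C * δ)).indicator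
          (fun _ => ENNReal.ofReal (K ^ α) * B) u := by
          refine setLIntegral_mono' measurableSet_Ioc fun u hu => ?_
          by_cases hx : ∃ x : USphere (Fin d),
              dir s₀ (Matrix.toEuclideanLin (G u) (x : EuclideanSpace ℝ (Fin d))) ∈ s
          · obtain ⟨x, hx⟩ := hx
            have h1 := (hsep u hu v hv x y).trans (mul_le_mul_of_nonneg_left (hδ _ hx _ hy) hC)
            rw [abs_le] at h1
            rw [indicator_of_mem (mem_Icc.2 ⟨by linarith, by linarith⟩)]
            exact hle u hu
          · push Not at hx
            have : f u = 0 := by simp [hf, hx]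
            rw [this]; exact zero_le
      _ ≤ ∫⁻ u, (Icc (v - C * δ) (v + C * δ)).indicator
          (fun _ => ENNReal.ofReal (K ^ α) * B) u := setLIntegral_le_lintegral _ _
      _ = _ := by
          rw [lintegral_indicator_const measurableSet_Icc, Real.volume_Icc, mul_comm]
          congr 2; ring
  · push Not at hU
    rw [setLIntegral_congr_fun (g := fun _ => 0) measurableSet_Ioc
      (fun u hu => by simp [hU u hu])]
    simp

theorem IsLinFamily.le_dimH_support (hG : IsLinFamily K G) (hd : 1 ≤ d) (hα : 0 < α) {ε C : ℝ}
    (hε : 0 < ε) (hε1 : ε ≤ 1) (hC : 0 < C)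
    (hsep : ∀ u ∈ Ioc 0 ε, ∀ v ∈ Ioc 0 ε, ∀ x y : USphere (Fin d), |u - v| ≤ C *
      ‖(dir s₀ (Matrix.toEuclideanLin (G u) (x : EuclideanSpace ℝ (Fin d))) : EuclideanSpace ℝ ι')
        - dir s₀ (Matrix.toEuclideanLin (G v) (y : EuclideanSpace ℝ (Fin d)))‖)
    (hsep' : ∀ u, ∀ x y : USphere (Fin d), ‖(x : EuclideanSpace ℝ (Fin d)) - y‖ ≤ C *
      ‖(dir s₀ (Matrix.toEuclideanLin (G u) (x : EuclideanSpace ℝ (Fin d))) : EuclideanSpace ℝ ι')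
        - dir s₀ (Matrix.toEuclideanLin (G u) (y : EuclideanSpace ℝ (Fin d)))‖)
    {m : Measure (USphere (Fin d))} [IsFiniteMeasure m] (hm0 : m ≠ 0) {H : ℝ≥0}
    (hm : m ≤ (H : ℝ≥0∞) • (volume : Measure (EuclideanSpace ℝ (Fin d))).toSphere) :
    (d : ℝ≥0∞) ≤ dimH (pushSpec (volume.restrict (Ioc 0 1)) s₀ α G m).support := by
  obtain ⟨C₁, hC₁⟩ := exists_toSphere_cap_le d hd
  set ν := pushSpec (volume.restrict (Ioc 0 1)) s₀ α G m with hν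
  set ν' := pushSpec (volume.restrict (Ioc 0 ε)) s₀ α G m with hν'
  have hle : ν' ≤ ν := hG.pushSpec_mono s₀
    (Measure.restrict_mono (Ioc_subset_Ioc_right hε1) le_rfl)
  have hS : ν' ν.support ≠ 0 := by
    have h0 : ν' ν.supportᶜ = 0 := le_antisymm ((hle _).trans_eq Measure.measure_compl_support)
      zero_le
    rw [measure_of_measure_compl_eq_zero h0]
    refine hG.pushSpec_univ_ne_zero s₀ ?_ hm0
    rw [Ne, Measure.restrict_eq_zero, Real.volume_Ioc]
    simpa using hε
  set D : ℝ≥0 := (2 * C).toNNReal * ((K ^ α).toNNReal * (H * (C₁ * (C ^ (d - 1)).toNNReal))) + 1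
    with hD
  have key : ∀ s : Set (USphere ι'), MeasurableSet s → Metric.ediam s ≤ ENNReal.ofReal C⁻¹ →
      ν' s ≤ D * Metric.ediam s ^ (d : ℝ) := by
    intro s hs hdiam
    set δ := (Metric.ediam s).toReal with hδ
    have hfin : Metric.ediam s ≠ ∞ := ne_top_of_le_ne_top ENNReal.ofReal_ne_top hdiam
    have hδC : C * δ ≤ 1 := by
      have := ENNReal.toReal_mono ENNReal.ofReal_ne_top hdiam
      rw [ENNReal.toReal_ofReal (by positivity)] at this
      calc C * δ ≤ C * C⁻¹ := by gcongr
        _ = 1 := mul_inv_cancel₀ hC.ne'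
    have hdist : ∀ x ∈ s, ∀ y ∈ s, ‖(x : EuclideanSpace ℝ ι') - y‖ ≤ δ := fun x hx y hy => by
      have := ENNReal.toReal_mono hfin (Metric.edist_le_ediam_of_mem hx hy)
      rwa [← dist_edist, Subtype.dist_eq, dist_eq_norm] at this
    have hδ0 : 0 ≤ δ := ENNReal.toReal_nonneg
    rcases hδ0.eq_or_lt with h0 | hpos
    · have := hG.pushSpec_le_of_cap s₀ hα hC.le hsep hs hdist (m := m)
        (fun u _ => measure_mono (subset_univ _))
      rw [← h0, mul_zero, mul_zero, ENNReal.ofReal_zero, zero_mul] at this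
      exact this.trans zero_le
    · have h1 := hG.pushSpec_le_of_cap s₀ hα hC.le hsep hs hdist (m := m)
        (B := H * (C₁ * ENNReal.ofReal ((C * δ) ^ (d - 1)))) (fun u hu => by
          refine (hm _).trans ?_
          rw [Measure.smul_apply, smul_eq_mul]
          gcongr
          refine hC₁ _ _ ?_ (by positivity) hδC fun x hx y hy => (hsep' u x y).trans
            (mul_le_mul_of_nonneg_left (hdist _ hx _ hy) hC.le)
          exact ((measurable_dir s₀).comp ((IsLinFamily.measurable_toEuclideanLin (G u)).comp
            measurable_subtype_coe)) hs)
      refine h1.trans ?_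
      have e1 : Metric.ediam s ^ (d : ℝ) = ENNReal.ofReal (δ ^ d) := by
        rw [ENNReal.rpow_natCast, ENNReal.ofReal_pow hδ0, hδ, ENNReal.ofReal_toReal hfin]
      have e2 : ENNReal.ofReal (δ ^ d) = ENNReal.ofReal δ * ENNReal.ofReal (δ ^ (d - 1)) := by
        rw [← ENNReal.ofReal_mul hδ0, ← pow_succ']
        congr 2; omega
      rw [e1, e2, mul_pow, ← mul_assoc 2 C δ, ENNReal.ofReal_mul (p := 2 * C) (by positivity),
        ENNReal.ofReal_mul (p := C ^ (d - 1)) (by positivity)]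
      calc _ = ((2 * C).toNNReal * ((K ^ α).toNNReal * (H * (C₁ * (C ^ (d - 1)).toNNReal))) : ℝ≥0)
            * (ENNReal.ofReal δ * ENNReal.ofReal (δ ^ (d - 1))) := by
            push_cast
            simp only [ENNReal.ofReal]
            ring
        _ ≤ _ := by
            gcongr
            exact le_self_add
  have hD0 : (D : ℝ≥0∞) ≠ 0 := by
    rw [ENNReal.coe_ne_zero, hD]; positivity
  have hmain : (D : ℝ≥0∞)⁻¹ • ν' ≤ μH[(d : ℝ)] := by
    refine Measure.le_hausdorffMeasure _ _ (ENNReal.ofReal C⁻¹)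
      (ENNReal.ofReal_pos.2 (by positivity)) fun s hs => ?_
    have h1 := key (closure s) isClosed_closure.measurableSet (by rwa [Metric.ediam_closure])
    rw [Metric.ediam_closure] at h1
    rw [Measure.smul_apply, smul_eq_mul, ENNReal.inv_mul_le_iff hD0 ENNReal.coe_ne_top]
    exact (measure_mono subset_closure).trans h1
  have hne : μH[(d : ℝ)] ν.support ≠ 0 := by
    intro h
    have := (hmain ν.support).trans_eq h
    rw [Measure.smul_apply, smul_eq_mul, nonpos_iff_eq_zero, mul_eq_zero] at this
    exact this.elim (ENNReal.inv_ne_zero.2 ENNReal.coe_ne_top) hS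
  have := le_dimH_of_hausdorffMeasure_ne_zero (d := (d : ℝ≥0)) (by simpa using hne)
  simpa using this

end Lower
end StableChain

namespace StableChain
open scoped Matrix.Norms.L2Operator

/-! ### Dimension of the spectral measure of a chain -/
namespace IsChainFlow
variable {n d : ℕ} {K aLow κ α : ℝ} {A : ℝ → Matrix (Fin n × Fin d) (Fin n × Fin d) ℝ}
  {R : ℝ → ℝ → Matrix (Fin n × Fin d) (Fin n × Fin d) ℝ} {σ : ℝ → Matrix (Fin d) (Fin d) ℝ}

/-- Two directions reached from two nearby times are separated, by means of the second block. -/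
lemma mul_sub_le_of_chainMap (F : IsChainFlow n d K aLow A R) (hn : 2 ≤ n) {u v : ℝ}
    (hu : u ∈ Icc (0 : ℝ) 1) (hv : v ∈ Icc (0 : ℝ) 1) (huv : u ≤ v)
    (hε : K * (K * flowBound n d K) * (v - u) ≤ aLow / 2) (x y : EuclideanSpace ℝ (Fin d)) :
    aLow / 2 * (v - u) * ‖x‖ ≤ flowBound n d K *
      ‖Matrix.toEuclideanLin (chainMap R u) x - Matrix.toEuclideanLin (chainMap R v) y‖ := by
  have hn1 : 1 ≤ n := by omega
  have h1 : (1 : ℝ) ∈ Icc (0 : ℝ) 1 := right_mem_Icc.2 zero_le_one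
  set i : Fin n := ⟨1, by omega⟩ with hi
  set j : Fin n := ⟨0, hn1⟩ with hj
  set w := Matrix.toEuclideanLin (R v u) (emb j x) - emb j y with hw
  have hwle : ‖w‖ ≤ flowBound n d K *
      ‖Matrix.toEuclideanLin (chainMap R u) x - Matrix.toEuclideanLin (chainMap R v) y‖ := by
    have e : w = Matrix.toEuclideanLin (R v 1) (Matrix.toEuclideanLin (chainMap R u) x
        - Matrix.toEuclideanLin (chainMap R v) y) := by
      rw [map_sub, ← toEuclideanLin_mul, ← toEuclideanLin_mul, chainMap, chainMap,
        ← Matrix.mul_assoc, ← Matrix.mul_assoc, clamp_of_mem hu, clamp_of_mem hv,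
        F.flow.cocycle hv h1 hu, F.flow.mul_eq_one hv h1, Matrix.one_mul, toEuclideanLin_mul,
        injB_apply hn1, injB_apply hn1]
    rw [e]
    exact (norm_toEuclideanLin_le _ _).trans (mul_le_mul_of_nonneg_right
      (F.norm_le_flowBound hv h1) (norm_nonneg _))
  have h0 : ∀ z : EuclideanSpace ℝ (Fin d), inner ℝ (emb i x) (emb j z) = 0 := fun z => by
    rw [inner_emb]
    have : blkv (emb i x) j = 0 := by
      ext k; simp [blkv_coord, emb_coord, hi, hj]
    rw [this, inner_zero_left]
  have hin : inner ℝ (emb i x) w = matForm (emb i x) (emb j x) (∫ r in u..v, A r)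
      + matForm (emb i x) (emb j x) (R v u - 1 - ∫ r in u..v, A r) := by
    rw [map_sub, map_sub, matForm_apply _ _ 1, toEuclideanLin_one, h0, hw, inner_sub_right, h0,
      ← matForm_apply]
    ring
  have hint := F.horm_integral hu hv huv (i := i) (j := j) (by simp [hi, hj]) x
  have hrem := matForm_le (emb i x) (emb j x) (R v u - 1 - ∫ r in u..v, A r)
  have hR : ‖R v u - 1 - ∫ r in u..v, A r‖ ≤ K * (K * flowBound n d K) * (v - u) ^ 2 := by
    have := F.flow.norm_sub_integral_le hu hv
    rwa [sq_abs] at this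
  rw [norm_emb, norm_emb] at hrem
  have hcs := real_inner_le_norm (emb i x) w
  rw [norm_emb] at hcs
  by_cases hx : x = 0
  · rw [hx, norm_zero, mul_zero]
    exact (norm_nonneg _).trans (hx ▸ hwle)
  have hx0 : 0 < ‖x‖ := norm_pos_iff.2 hx
  refine le_trans ?_ hwle
  refine le_of_mul_le_mul_left ?_ hx0
  have h4 : ‖x‖ * (‖R v u - 1 - ∫ r in u..v, A r‖ * ‖x‖)
      ≤ ‖x‖ * (aLow / 2 * (v - u) * ‖x‖) := by
    refine mul_le_mul_of_nonneg_left (mul_le_mul_of_nonneg_right (hR.trans ?_) hx0.le) hx0.le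
    rw [pow_two, ← mul_assoc]
    exact mul_le_mul_of_nonneg_right hε (sub_nonneg.2 huv)
  have h5 := (abs_le.1 hrem).1
  nlinarith

lemma exists_time_separation (F : IsChainFlow n d K aLow A R) (hn : 2 ≤ n) (haLow : 0 < aLow)
    {L : ℝ} (hG : IsLinFamily L (chainFam R σ)) (s₀ : USphere (Fin n × Fin d)) :
    ∃ ε C : ℝ, 0 < ε ∧ ε ≤ 1 ∧ 0 < C ∧ ∀ u ∈ Ioc 0 ε, ∀ v ∈ Ioc 0 ε, ∀ x y : USphere (Fin d),
      |u - v| ≤ C * ‖(dir s₀ (Matrix.toEuclideanLin (chainFam R σ u)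
        (x : EuclideanSpace ℝ (Fin d))) : ESp n d)
        - dir s₀ (Matrix.toEuclideanLin (chainFam R σ v) (y : EuclideanSpace ℝ (Fin d)))‖ := by
  have hn1 : 1 ≤ n := by omega
  have hK := F.flow.K_nonneg zero_le_one
  have hF := flowBound_nonneg n d K
  set M := K * (K * flowBound n d K) with hM
  have hM0 : 0 ≤ M := by positivity
  set ε := min 1 (aLow / (2 * (M + 1))) with hε
  have hε0 : 0 < ε := lt_min one_pos (by positivity)
  have hMε : M * ε ≤ aLow / 2 := by
    calc M * ε ≤ (M + 1) * (aLow / (2 * (M + 1))) := by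
          gcongr
          · linarith
          · exact min_le_right _ _
      _ = aLow / 2 := by field_simp
  set C := 2 * flowBound n d K ^ 2 / aLow with hC
  have key : ∀ u ∈ Ioc 0 ε, ∀ v ∈ Ioc 0 ε, u ≤ v → ∀ x y : USphere (Fin d),
      v - u ≤ C * ‖(dir s₀ (Matrix.toEuclideanLin (chainFam R σ u)
        (x : EuclideanSpace ℝ (Fin d))) : ESp n d)
        - dir s₀ (Matrix.toEuclideanLin (chainFam R σ v) (y : EuclideanSpace ℝ (Fin d)))‖ := by
    intro u hu v hv huv x y
    have hu' : u ∈ Icc (0 : ℝ) 1 := ⟨hu.1.le, hu.2.trans (min_le_left _ _)⟩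
    have hv' : v ∈ Icc (0 : ℝ) 1 := ⟨hv.1.le, hv.2.trans (min_le_left _ _)⟩
    have e : ∀ (w : ℝ) (z : USphere (Fin d)), (dir s₀ (Matrix.toEuclideanLin (chainFam R σ w)
        (z : EuclideanSpace ℝ (Fin d))) : ESp n d) = Matrix.toEuclideanLin (chainMap R w)
        (‖Matrix.toEuclideanLin (chainFam R σ w) (z : EuclideanSpace ℝ (Fin d))‖⁻¹ •
          Matrix.toEuclideanLin (σ w) (z : EuclideanSpace ℝ (Fin d))) := fun w z => by
      rw [dir_coe s₀ (hG.apply_sphere_ne w z), map_smul, ← chainFam_apply]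
    set D := ‖(dir s₀ (Matrix.toEuclideanLin (chainFam R σ u)
        (x : EuclideanSpace ℝ (Fin d))) : ESp n d)
        - dir s₀ (Matrix.toEuclideanLin (chainFam R σ v) (y : EuclideanSpace ℝ (Fin d)))‖ with hD
    set x' := ‖Matrix.toEuclideanLin (chainFam R σ u) (x : EuclideanSpace ℝ (Fin d))‖⁻¹ •
          Matrix.toEuclideanLin (σ u) (x : EuclideanSpace ℝ (Fin d)) with hx'
    have h1 := F.mul_sub_le_of_chainMap hn hu' hv' huv (by
      refine (mul_le_mul_of_nonneg_left ?_ hM0).trans hMε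
      linarith [hv.2, hu.1]) x' (‖Matrix.toEuclideanLin (chainFam R σ v)
        (y : EuclideanSpace ℝ (Fin d))‖⁻¹ •
          Matrix.toEuclideanLin (σ v) (y : EuclideanSpace ℝ (Fin d)))
    rw [← e, ← e, ← hD] at h1
    have h2 : 1 ≤ flowBound n d K * ‖x'‖ := by
      rw [← norm_sphere (dir s₀ (Matrix.toEuclideanLin (chainFam R σ u)
        (x : EuclideanSpace ℝ (Fin d)))), e]
      exact (norm_toEuclideanLin_le _ _).trans
        (mul_le_mul_of_nonneg_right (F.norm_chainMap_le hn1 u) (norm_nonneg _))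
    have h3 : aLow / 2 * (v - u) ≤ flowBound n d K ^ 2 * D := by
      have h5 : 0 ≤ aLow / 2 * (v - u) := mul_nonneg (by positivity) (sub_nonneg.2 huv)
      calc aLow / 2 * (v - u) ≤ aLow / 2 * (v - u) * (flowBound n d K * ‖x'‖) :=
            le_mul_of_one_le_right h5 h2
        _ = flowBound n d K * (aLow / 2 * (v - u) * ‖x'‖) := by ring
        _ ≤ flowBound n d K * (flowBound n d K * D) := by gcongr
        _ = _ := by ring
    rw [hC, div_mul_eq_mul_div, le_div_iff₀ haLow]
    linarith
  refine ⟨ε, C + 1, hε0, min_le_left _ _, by positivity, fun u hu v hv x y => ?_⟩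
  have hle : ∀ D : ℝ, 0 ≤ D → C * D ≤ (C + 1) * D := fun D hD => by nlinarith
  rcases le_total u v with h | h
  · rw [abs_sub_comm, abs_of_nonneg (sub_nonneg.2 h)]
    exact (key u hu v hv h x y).trans (hle _ (norm_nonneg _))
  · rw [abs_of_nonneg (sub_nonneg.2 h), norm_sub_rev]
    exact (key v hv u hu h y x).trans (hle _ (norm_nonneg _))

theorem dimH_support_le (F : IsChainFlow n d K aLow A R) (hn : 1 ≤ n) {L : ℝ}
    (hG : IsLinFamily L (chainFam R σ)) (s₀ : USphere (Fin n × Fin d))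
    (m : Measure (USphere (Fin d))) [SFinite m] :
    dimH (pushSpec (volume.restrict (Ioc 0 1)) s₀ α (chainFam R σ) m).support ≤ d := by
  set T : EuclideanSpace ℝ (Fin d) → USphere (Fin n × Fin d) := fun x =>
    dir s₀ (Matrix.toEuclideanLin (chainMap R (‖x‖ - 1)) x) with hT
  set S : Set (EuclideanSpace ℝ (Fin d)) := Metric.closedBall 0 2 \ Metric.ball 0 1 with hS
  have hmem : ∀ x ∈ S, 1 ≤ ‖x‖ ∧ ‖x‖ ≤ 2 := fun x hx => by
    simpa [hS, and_comm] using hx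
  have hF := flowBound_nonneg n d K
  have hK := F.flow.K_nonneg zero_le_one
  set M := flowBound n d K * (K * flowBound n d K) with hM
  have hM0 : 0 ≤ M := by positivity
  have hlip : LipschitzOnWith (2 * flowBound n d K * (flowBound n d K + 2 * M)).toNNReal T S := by
    refine LipschitzOnWith.of_dist_le_mul fun x hx y hy => ?_
    rw [Real.coe_toNNReal _ (by positivity), Subtype.dist_eq, dist_eq_norm, dist_eq_norm]
    have h1 := norm_mul_dir_sub_le s₀ (Matrix.toEuclideanLin (chainMap R (‖x‖ - 1)) x)
      (Matrix.toEuclideanLin (chainMap R (‖y‖ - 1)) y)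
    have h2 := (hmem x hx).1.trans (F.le_norm_chainMap hn (‖x‖ - 1) x)
    have h3 : ‖Matrix.toEuclideanLin (chainMap R (‖x‖ - 1)) x
        - Matrix.toEuclideanLin (chainMap R (‖y‖ - 1)) y‖
        ≤ (flowBound n d K + 2 * M) * ‖x - y‖ := by
      have e : Matrix.toEuclideanLin (chainMap R (‖x‖ - 1)) x
          - Matrix.toEuclideanLin (chainMap R (‖y‖ - 1)) y
          = Matrix.toEuclideanLin (chainMap R (‖x‖ - 1)) (x - y)
          + Matrix.toEuclideanLin (chainMap R (‖x‖ - 1) - chainMap R (‖y‖ - 1)) y := by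
        rw [map_sub, map_sub, LinearMap.sub_apply]; abel
      rw [e]
      refine (norm_add_le _ _).trans ?_
      have h4 := (norm_toEuclideanLin_le (chainMap R (‖x‖ - 1)) (x - y)).trans
        (mul_le_mul_of_nonneg_right (F.norm_chainMap_le hn _) (norm_nonneg _))
      have h5 := norm_toEuclideanLin_le (chainMap R (‖x‖ - 1) - chainMap R (‖y‖ - 1)) y
      have h6 := F.norm_chainMap_sub_le hn (‖x‖ - 1) (‖y‖ - 1)
      rw [sub_sub_sub_cancel_right] at h6
      have h7 : ‖chainMap R (‖x‖ - 1) - chainMap R (‖y‖ - 1)‖ * ‖y‖ ≤ M * ‖x - y‖ * 2 := by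
        gcongr
        · exact h6.trans (mul_le_mul_of_nonneg_left (abs_norm_sub_norm_le x y) hM0)
        · exact (hmem y hy).2
      linarith
    set a := ‖Matrix.toEuclideanLin (chainMap R (‖x‖ - 1)) x‖
    change ‖(dir s₀ (Matrix.toEuclideanLin (chainMap R (‖x‖ - 1)) x) : ESp n d)
      - dir s₀ (Matrix.toEuclideanLin (chainMap R (‖y‖ - 1)) y)‖ ≤ _
    set D := ‖(dir s₀ (Matrix.toEuclideanLin (chainMap R (‖x‖ - 1)) x) : ESp n d)
      - dir s₀ (Matrix.toEuclideanLin (chainMap R (‖y‖ - 1)) y)‖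
    have hD : 0 ≤ D := norm_nonneg _
    calc D ≤ flowBound n d K * a * D := le_mul_of_one_le_left hD h2
      _ = flowBound n d K * (a * D) := by ring
      _ ≤ flowBound n d K * (2 * ((flowBound n d K + 2 * M) * ‖x - y‖)) :=
        mul_le_mul_of_nonneg_left (by linarith) hF
      _ = _ := by ring
  have hScpt : IsCompact S := (isCompact_closedBall 0 2).diff Metric.isOpen_ball
  have hclosed : IsClosed (T '' S) := (hScpt.image_of_continuousOn hlip.continuousOn).isClosed
  have hsub : (pushSpec (volume.restrict (Ioc 0 1)) s₀ α (chainFam R σ) m).support ⊆ T '' S := by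
    refine Measure.support_subset_of_isClosed hclosed ?_
    have hms : MeasurableSet (T '' S)ᶜ := hclosed.measurableSet.compl
    rw [mem_ae_iff, ← lintegral_indicator_one hms,
      hG.lintegral_pushSpec _ s₀ (measurable_one.indicator hms),
      setLIntegral_congr_fun (g := fun _ => 0) measurableSet_Ioc, lintegral_zero]
    intro u hu
    refine (lintegral_congr (g := fun _ => 0) fun x => ?_).trans lintegral_zero
    rw [indicator_of_notMem, mul_zero]
    rw [notMem_compl_iff]
    set w := Matrix.toEuclideanLin (σ u) (x : EuclideanSpace ℝ (Fin d)) with hw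
    have hw0 : w ≠ 0 := fun h => by
      have := hG.apply_sphere_ne u x
      rw [chainFam_apply, ← hw, h, map_zero] at this
      exact this rfl
    have hwp : 0 < ‖w‖ := norm_pos_iff.2 hw0
    have hu1 : 0 < 1 + u := by linarith [hu.1]
    have hnorm : ‖((1 + u) * ‖w‖⁻¹) • w‖ = 1 + u := by
      rw [norm_smul, Real.norm_eq_abs, abs_of_pos (by positivity), mul_assoc,
        inv_mul_cancel₀ hwp.ne', mul_one]
    refine ⟨((1 + u) * ‖w‖⁻¹) • w, ?_, ?_⟩
    · simp only [hS, Set.mem_sdiff, mem_closedBall_zero_iff, mem_ball_zero_iff, hnorm]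
      constructor <;> linarith [hu.1, hu.2]
    · simp only [hT, hnorm]
      rw [add_sub_cancel_left, map_smul, dir_smul s₀ (by positivity), chainFam_apply]
  refine (dimH_mono hsub).trans ((hlip.dimH_image_le).trans ?_)
  refine (dimH_mono (subset_univ _)).trans_eq ?_
  rw [Real.dimH_univ_eq_finrank, finrank_euclideanSpace, Fintype.card_fin]

theorem dimH_support_eq (F : IsChainFlow n d K aLow A R) (hn : 2 ≤ n) (hd : 1 ≤ d)
    (haLow : 0 < aLow) (hκ : 1 ≤ κ) (hα : 0 < α)
    (hσm : ∀ i j, Measurable fun v => σ v i j) (hσ : ∀ v, IsElliptic κ (σ v))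
    (s₀ : USphere (Fin n × Fin d)) {m : Measure (USphere (Fin d))} [IsFiniteMeasure m]
    (hm0 : m ≠ 0) {H : ℝ≥0}
    (hm : m ≤ (H : ℝ≥0∞) • (volume : Measure (EuclideanSpace ℝ (Fin d))).toSphere) :
    dimH (pushSpec (volume.restrict (Ioc 0 1)) s₀ α (chainFam R σ) m).support = d := by
  have hn1 : 1 ≤ n := by omega
  have hG := F.isLinFamily hn1 hκ hσm hσ
  obtain ⟨ε, C, hε, hε1, hC, hsep⟩ := F.exists_time_separation hn haLow hG s₀
  refine le_antisymm (F.dimH_support_le hn1 hG s₀ m) ?_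
  refine hG.le_dimH_support s₀ hd hα (C := max C (2 * famBound n d K κ ^ 2)) hε hε1
    (lt_max_of_lt_left hC) (fun u hu v hv x y => (hsep u hu v hv x y).trans ?_)
    (fun u x y => (norm_sub_le_dir_sub s₀ (hG.norm_apply_le u)
      (F.le_norm_chainFam hn1 hκ hσ u) x y).trans ?_) hm0 hm
  · exact mul_le_mul_of_nonneg_right (le_max_left _ _) (norm_nonneg _)
  · exact mul_le_mul_of_nonneg_right (le_max_right _ _) (norm_nonneg _)

end IsChainFlow
end StableChain

namespace StableChain

/-! ### The multi-scale density -/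
section MultiScale
variable {ι : Type} [Fintype ι] {n d : ℕ} {α : ℝ}

lemma integrable_exp_neg_norm_rpow [Nonempty ι] (hα : 0 < α) :
    Integrable fun q : EuclideanSpace ℝ ι => Real.exp (-‖q‖ ^ α) := by
  by_contra h
  have h1 := measure_unitBall_eq_integral_div_gamma (E := EuclideanSpace ℝ ι) volume hα
  rw [integral_undef h, zero_div, ENNReal.ofReal_zero] at h1
  exact (Metric.measure_ball_pos volume (0 : EuclideanSpace ℝ ι) one_pos).ne' h1

lemma exp_neg_mul_rpow {c : ℝ} (hc : 0 < c) (hα : 0 < α) (q : EuclideanSpace ℝ ι) :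
    Real.exp (-(c * ‖q‖ ^ α)) = Real.exp (-‖(c ^ (1 / α)) • q‖ ^ α) := by
  rw [norm_smul, Real.norm_eq_abs, abs_of_pos (by positivity),
    Real.mul_rpow (by positivity) (norm_nonneg _), ← Real.rpow_mul hc.le, one_div_mul_cancel hα.ne',
    Real.rpow_one]

lemma integrable_exp_neg_mul_rpow [Nonempty ι] {c : ℝ} (hc : 0 < c) (hα : 0 < α) :
    Integrable fun q : EuclideanSpace ℝ ι => Real.exp (-(c * ‖q‖ ^ α)) := by
  simp only [exp_neg_mul_rpow hc hα]
  exact (integrable_exp_neg_norm_rpow (ι := ι) hα).comp_smul (by positivity)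

lemma integral_exp_neg_mul_rpow {c : ℝ} (hc : 0 < c) (hα : 0 < α) :
    ∫ q : EuclideanSpace ℝ ι, Real.exp (-(c * ‖q‖ ^ α))
      = ((c ^ (1 / α)) ^ Fintype.card ι)⁻¹ * ∫ q : EuclideanSpace ℝ ι, Real.exp (-‖q‖ ^ α) := by
  simp only [exp_neg_mul_rpow hc hα]
  rw [Measure.integral_comp_smul volume (fun q : EuclideanSpace ℝ ι => Real.exp (-‖q‖ ^ α)),
    finrank_euclideanSpace, abs_of_pos (by positivity), smul_eq_mul]

lemma det_scaleM_pos {u : ℝ} (hu : 0 < u) : 0 < (scaleM n d u).det := by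
  rw [scaleM, Matrix.det_diagonal]
  exact Finset.prod_pos fun i _ => by positivity

lemma det_scaleT {u : ℝ} (hu : 0 < u) :
    (scaleT n d α u).det = (u ^ (1 / α)) ^ (n * d) * (scaleM n d u).det := by
  rw [scaleT, scaleM, Matrix.det_diagonal, Matrix.det_diagonal]
  simp only [Real.rpow_add hu, Real.rpow_natCast]
  rw [Finset.prod_mul_distrib, Finset.prod_const, mul_comm]
  simp

lemma inner_scaleM_inv {u : ℝ} (hu : u ≠ 0) (q z : ESp n d) :
    inner ℝ (Matrix.toEuclideanLin (scaleM n d u) q)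
      (Matrix.toEuclideanCLM (𝕜 := ℝ) (scaleM n d u)⁻¹ z) = inner ℝ q z := by
  change inner ℝ _ (Matrix.toEuclideanLin (scaleM n d u)⁻¹ z) = _
  rw [inner_toEuclideanLin, scaleM_inv hu, ← toEuclideanLin_mul, scaleM, scaleM,
    Matrix.diagonal_transpose]
  change inner ℝ (Matrix.toEuclideanLin (scaleM n d u⁻¹ * scaleM n d u) q) z = _
  rw [scaleM_inv_mul hu, toEuclideanLin_one]

lemma map_scaleM {u : ℝ} (hu : 0 < u) :
    (volume : Measure (ESp n d)).map (Matrix.toEuclideanLin (scaleM n d u))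
      = ENNReal.ofReal (scaleM n d u).det⁻¹ • volume := by
  have h0 := det_scaleM_pos (n := n) (d := d) hu
  have hdet : LinearMap.det (Matrix.toEuclideanLin (scaleM n d u)) = (scaleM n d u).det :=
    LinearMap.det_toLpLin _ _
  rw [Measure.map_linearMap_addHaar_eq_smul_addHaar volume (by rw [hdet]; exact h0.ne'), hdet,
    abs_of_pos (inv_pos.2 h0)]

lemma measurableEmbedding_scaleM {u : ℝ} (hu : 0 < u) :
    MeasurableEmbedding fun q : ESp n d => Matrix.toEuclideanLin (scaleM n d u) q := by
  refine (IsLinFamily.measurable_toEuclideanLin (scaleM n d u)).measurableEmbedding ?_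
  intro x y hxy
  have h : ∀ z : ESp n d, Matrix.toEuclideanLin (scaleM n d u⁻¹)
      (Matrix.toEuclideanLin (scaleM n d u) z) = z := fun z => by
    rw [← toEuclideanLin_mul, scaleM_inv_mul hu.ne', toEuclideanLin_one]
  rw [← h x, ← h y]
  exact congrArg _ hxy

lemma integral_comp_scaleM {E : Type*} [NormedAddCommGroup E] [NormedSpace ℝ E] {u : ℝ} (hu : 0 < u)
    (f : ESp n d → E) :
    ∫ q, f (Matrix.toEuclideanLin (scaleM n d u) q) = (scaleM n d u).det⁻¹ • ∫ q, f q := by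
  rw [← (measurableEmbedding_scaleM hu).integral_map (μ := volume) (g := f)]
  change ∫ y, f y ∂(volume : Measure (ESp n d)).map (Matrix.toEuclideanLin (scaleM n d u)) = _
  rw [map_scaleM hu, integral_smul_measure,
    ENNReal.toReal_ofReal (inv_pos.2 (det_scaleM_pos hu)).le]

lemma integrable_comp_scaleM {f : ESp n d → ℝ} (hf : Integrable f) {u : ℝ} (hu : 0 < u) :
    Integrable fun q => f (Matrix.toEuclideanLin (scaleM n d u) q) := by
  refine ((measurableEmbedding_scaleM hu).integrable_map_iff (μ := volume) (g := f)).1 ?_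
  change Integrable f ((volume : Measure (ESp n d)).map (Matrix.toEuclideanLin (scaleM n d u)))
  rw [map_scaleM hu]
  exact hf.smul_measure ENNReal.ofReal_ne_top

lemma im_integral_eq_zero {φ : EuclideanSpace ℝ ι → ℝ} (h : ∀ q, φ (-q) = φ q)
    (z : EuclideanSpace ℝ ι) :
    (∫ q, Complex.exp (-Complex.I * (inner ℝ q z : ℝ)) * (φ q : ℂ)).im = 0 := by
  rw [← Complex.conj_eq_iff_im, ← integral_conj, ← integral_neg_eq_self]
  refine integral_congr_ae (Eventually.of_forall fun q => ?_)
  simp only [map_mul, ← Complex.exp_conj, Complex.conj_ofReal, h, inner_neg_left]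
  simp

lemma levyFourier_eq (u : ℝ) (ν : Measure (EuclideanSpace ℝ ι)) (q : EuclideanSpace ℝ ι) :
    levyFourier u ν q = Real.exp (-u * psi ν q) := rfl

lemma psi_neg (ν : Measure (EuclideanSpace ℝ ι)) (q) : psi ν (-q) = psi ν q := by
  simp [psi, inner_neg_left]

lemma levyFourier_le {ν : Measure (EuclideanSpace ℝ ι)} {c C : ℝ} (hC : 0 ≤ C)
    (h : ∀ q, c * ‖q‖ ^ α - C ≤ psi ν q) {u : ℝ} (hu : 0 < u) (hu1 : u ≤ 1)
    (q : EuclideanSpace ℝ ι) :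
    levyFourier u ν q ≤ Real.exp C * Real.exp (-(c * u * ‖q‖ ^ α)) := by
  rw [levyFourier_eq, ← Real.exp_add]
  refine Real.exp_le_exp.2 ?_
  nlinarith [mul_le_mul_of_nonneg_left (h q) hu.le, mul_le_mul_of_nonneg_right hu1 hC]

lemma integrable_levyFourier [Nonempty ι] {ν : Measure (EuclideanSpace ℝ ι)}
    (hν : IsSymmetricLevyMeasure ν) (hα : 0 < α) {c C : ℝ} (hc : 0 < c) (hC : 0 ≤ C)
    (h : ∀ q, c * ‖q‖ ^ α - C ≤ psi ν q) {u : ℝ} (hu : 0 < u) (hu1 : u ≤ 1) :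
    Integrable (levyFourier u ν) := by
  refine ((integrable_exp_neg_mul_rpow (ι := ι) (mul_pos hc hu) hα).const_mul (Real.exp C)).mono'
    ?_ (Eventually.of_forall fun q => ?_)
  · have := hν.continuous_psi
    have h1 : Continuous fun q => Real.exp (-u * psi ν q) := by fun_prop
    exact h1.aestronglyMeasurable
  · rw [Real.norm_eq_abs, abs_of_pos (by rw [levyFourier_eq]; positivity)]
    exact levyFourier_le hC h hu hu1 q

/-- The constant of the diagonal bound. -/
def diagConst (n d : ℕ) (α c C : ℝ) : ℝ :=
  ((2 * Real.pi) ^ (n * d))⁻¹ * (Real.exp C *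
    (((c ^ (1 / α)) ^ (n * d))⁻¹ * ∫ q : ESp n d, Real.exp (-‖q‖ ^ α)))

lemma diagConst_nonneg (n d : ℕ) {α c C : ℝ} (hc : 0 < c) : 0 ≤ diagConst n d α c C := by
  unfold diagConst
  have : 0 ≤ ∫ q : ESp n d, Real.exp (-‖q‖ ^ α) := integral_nonneg fun q => (Real.exp_pos _).le
  positivity

theorem isMultiScaleDensity_invDens [Nonempty (Fin n × Fin d)] {ν : Measure (ESp n d)}
    (hν : IsSymmetricLevyMeasure ν) (hα : 0 < α) {c C : ℝ} (hc : 0 < c) (hC : 0 ≤ C)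
    (h : ∀ q, c * ‖q‖ ^ α - C ≤ psi ν q) {u : ℝ} (hu : 0 < u) (hu1 : u ≤ 1)
    {D : ℝ} (hD : diagConst n d α c C ≤ D) :
    IsMultiScaleDensity n d α D u ν
      (invDens fun q => levyFourier u ν (Matrix.toEuclideanLin (scaleM n d u) q)) := by
  have hint := integrable_levyFourier hν hα hc hC h hu hu1
  have hdet := det_scaleM_pos (n := n) (d := d) hu
  have hcard : Fintype.card (Fin n × Fin d) = n * d := by simp
  set Φ : ESp n d → ℝ := fun q => levyFourier u ν (Matrix.toEuclideanLin (scaleM n d u) q) with hΦ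
  have hsymm : ∀ q, Φ (-q) = Φ q := fun q => by
    simp only [hΦ, map_neg, levyFourier_eq, psi_neg]
  have hcv : ∀ z, ∫ q, Complex.exp (-Complex.I * (inner ℝ q z : ℝ)) * (Φ q : ℂ)
      = ((scaleM n d u).det⁻¹ : ℝ) * ∫ q : ESp n d, Complex.exp (-Complex.I *
          (inner ℝ q (Matrix.toEuclideanCLM (𝕜 := ℝ) (scaleM n d u)⁻¹ z) : ℝ)) *
        (levyFourier u ν q : ℂ) := fun z => by
    rw [← Complex.real_smul, ← integral_comp_scaleM hu]
    simp only [inner_scaleM_inv hu.ne']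
    rfl
  refine ⟨hint, fun z => ?_, fun z => ?_⟩
  · have h1 : ((∫ q, Complex.exp (-Complex.I * (inner ℝ q z : ℝ)) * (Φ q : ℂ)).re : ℂ)
        = ∫ q, Complex.exp (-Complex.I * (inner ℝ q z : ℝ)) * (Φ q : ℂ) :=
      Complex.ext (by simp) (by rw [im_integral_eq_zero hsymm]; simp)
    rw [invDens, Complex.ofReal_mul, h1, hcv, hcard]
    push_cast
    ring
  · have h2 : (∫ q, Complex.exp (-Complex.I * (inner ℝ q z : ℝ)) * (Φ q : ℂ)).re
        ≤ (scaleM n d u).det⁻¹ * (Real.exp C * ((((c * u) ^ (1 / α)) ^ (n * d))⁻¹ *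
          ∫ q : ESp n d, Real.exp (-‖q‖ ^ α))) := by
      refine (Complex.re_le_norm _).trans ((norm_integral_le_integral_norm _).trans ?_)
      have e : ∀ q : ESp n d, ‖Complex.exp (-Complex.I * (inner ℝ q z : ℝ)) * (Φ q : ℂ)‖ = Φ q :=
        fun q => by
          rw [norm_mul, show -Complex.I * ((inner ℝ q z : ℝ) : ℂ)
            = ((-inner ℝ q z : ℝ) : ℂ) * Complex.I by push_cast; ring,
            Complex.norm_exp_ofReal_mul_I, one_mul, Complex.norm_real, Real.norm_eq_abs,
            abs_of_pos (by simp only [hΦ, levyFourier_eq]; positivity)]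
      simp only [e]
      rw [hΦ, integral_comp_scaleM hu, smul_eq_mul, ← hcard, ← integral_exp_neg_mul_rpow
        (mul_pos hc hu) hα]
      refine mul_le_mul_of_nonneg_left ?_ (inv_pos.2 hdet).le
      rw [← integral_const_mul]
      exact integral_mono hint ((integrable_exp_neg_mul_rpow (mul_pos hc hu) hα).const_mul _)
        (levyFourier_le hC h hu hu1)
    rw [det_scaleT hu]
    have hT : 0 < (u ^ (1 / α)) ^ (n * d) * (scaleM n d u).det := by positivity
    refine le_trans ?_ (mul_le_mul_of_nonneg_right hD (inv_pos.2 hT).le)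
    rw [invDens, hcard, diagConst, mul_assoc]
    refine mul_le_mul_of_nonneg_left (h2.trans_eq ?_) (by positivity)
    rw [Real.mul_rpow hc.le hu.le, mul_pow]
    simp only [mul_inv]
    ring

end MultiScale
end StableChain

namespace StableChain

/-! ### The stable-like measure of a chain -/
section StableLike
variable {n d : ℕ} {K aLow κ α lam : ℝ} {g : ℝ → ℝ}

instance isProbabilityMeasure_unitInterval :
    IsProbabilityMeasure ((volume : Measure ℝ).restrict (Ioc 0 1)) := ⟨by simp⟩

lemma IsLinFamily.integrable_norm_transpose_rpow {ι ι' : Type} [Fintype ι] [Fintype ι']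
    [DecidableEq ι] [DecidableEq ι'] {G : ℝ → Matrix ι' ι ℝ} (hG : IsLinFamily K G) (hα : 0 < α)
    (θ : Measure ℝ) [IsFiniteMeasure θ] (q : EuclideanSpace ℝ ι') :
    Integrable (fun v => ‖Matrix.toEuclideanLin (G v)ᵀ q‖ ^ α) θ := by
  refine Integrable.of_bound ((hG.measurable_transpose q).norm.pow_const _).aestronglyMeasurable
    ((K * ‖q‖) ^ α) (Eventually.of_forall fun v => ?_)
  rw [Real.norm_eq_abs, abs_of_nonneg (by positivity)]
  exact Real.rpow_le_rpow (norm_nonneg _) (hG.norm_transpose_le v q) hα.le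

theorem exists_le_integral_chainFam (n d : ℕ) (hn : 1 ≤ n) (haLow : 0 < aLow) (hK : 0 ≤ K)
    (hα : 0 < α) (hκ : 1 ≤ κ) : ∃ c > 0, ∀ A R (σ : ℝ → Matrix (Fin d) (Fin d) ℝ),
      IsChainFlow n d K aLow A R → (∀ i j, Measurable fun v => σ v i j) →
      (∀ v, IsElliptic κ (σ v)) → ∀ q : ESp n d,
      c * ‖q‖ ^ α ≤ ∫ v in Ioc 0 1, ‖Matrix.toEuclideanLin (chainFam R σ v)ᵀ q‖ ^ α := by
  obtain ⟨c, hc, H⟩ := IsChainFlow.observability n d hn haLow hK hα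
  have hs : 0 < √κ ^ α := by
    have : 0 < √κ := Real.sqrt_pos.2 (by linarith)
    positivity
  refine ⟨(√κ ^ α)⁻¹ * c, by positivity, fun A R σ F hσm hσ q => ?_⟩
  have hG := F.isLinFamily hn hκ hσm hσ
  rw [mul_assoc, inv_mul_le_iff₀ hs, ← integral_const_mul]
  refine (H A R F q).trans ?_
  rw [intervalIntegral.integral_of_le zero_le_one]
  refine integral_mono_of_nonneg (Eventually.of_forall fun v => by positivity)
    ((hG.integrable_norm_transpose_rpow hα _ q).const_mul _) ?_
  refine (ae_restrict_mem measurableSet_Ioc).mono fun v hv => ?_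
  simp only
  rw [chainFam_transpose_apply hn, clamp_of_mem (Ioc_subset_Icc_self hv),
    ← Real.mul_rpow (Real.sqrt_nonneg _) (norm_nonneg _)]
  exact Real.rpow_le_rpow (norm_nonneg _) ((hσ v).le_norm_transpose hκ _) hα.le

lemma integral_sphPart (hα : 0 < α) (hα' : α < 2) {μ : Measure (USphere (Fin d))}
    (f : USphere (Fin d) → ℝ) : ∫ s, f s ∂sphPart α μ = (stableConst α)⁻¹ * ∫ s, f s ∂μ := by
  rw [sphPart, integral_smul_measure, ENNReal.toReal_inv,
    ENNReal.toReal_ofReal (stableConst_pos hα hα').le, smul_eq_mul]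

lemma SpectralCondition.sphPart_ne_zero {μ : Measure (USphere (Fin d))}
    (h : SpectralCondition d α lam μ) (hd : 1 ≤ d) (hlam : 1 ≤ lam) : sphPart α μ ≠ 0 := by
  intro h0
  have h1 : μ = 0 := by
    rw [sphPart] at h0
    refine Measure.measure_univ_eq_zero.1 ?_
    have h2 := congrArg (fun ν : Measure (USphere (Fin d)) => ν univ) h0
    simp only [Measure.smul_apply, smul_eq_mul, Measure.coe_zero, Pi.zero_apply, mul_eq_zero] at h2
    exact h2.resolve_left (ENNReal.inv_ne_zero.2 ENNReal.ofReal_ne_top)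
  have h2 := (h.nondegenerate (EuclideanSpace.single ⟨0, hd⟩ 1)).1
  rw [h1, integral_zero_measure, PiLp.norm_single, norm_one, Real.one_rpow,
    mul_one] at h2
  have : 0 < lam⁻¹ := by positivity
  linarith

lemma SpectralCondition.exists_sphPart_le {μ : Measure (USphere (Fin d))}
    (h : SpectralCondition d α lam μ) (hα : 0 < α) (hα' : α < 2) : ∃ H : ℝ≥0,
      sphPart α μ ≤ (H : ℝ≥0∞) • (volume : Measure (EuclideanSpace ℝ (Fin d))).toSphere := by
  obtain ⟨H, hH⟩ := h.exists_le_toSphere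
  have ht : (ENNReal.ofReal (stableConst α))⁻¹ ≠ ∞ :=
    ENNReal.inv_ne_top.2 (ENNReal.ofReal_pos.2 (stableConst_pos hα hα')).ne'
  refine ⟨(ENNReal.ofReal (stableConst α))⁻¹.toNNReal * H, Measure.le_iff.2 fun s hs => ?_⟩
  rw [sphPart, Measure.smul_apply, Measure.smul_apply, smul_eq_mul, smul_eq_mul, ENNReal.coe_mul,
    ENNReal.coe_toNNReal ht, mul_assoc]
  gcongr
  exact hH s

theorem exists_isStableLike (hn : 1 ≤ n) (hd : 1 ≤ d) (haLow : 0 < aLow) (hK : 0 ≤ K)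
    (hα : 0 < α) (hα' : α < 2) (hκ : 1 ≤ κ) (hlam : 1 ≤ lam) (hg : IsWeight g) :
    ∃ c lam' c₁ C₁ : ℝ, 0 < c ∧ 1 ≤ lam' ∧ 0 < c₁ ∧ 0 ≤ C₁ ∧
      ∀ A R (σ : ℝ → Matrix (Fin d) (Fin d) ℝ) (μ : Measure (USphere (Fin d))),
      IsChainFlow n d K aLow A R → (∀ i j, Measurable fun v => σ v i j) →
      (∀ v, IsElliptic κ (σ v)) → SpectralCondition d α lam μ → ∀ s₀,
      IsStableLike n d α g c lam'
        (pushLevy (volume.restrict (Ioc 0 1)) (chainFam R σ) (noiseLevy α μ g))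
        (pushSpec (volume.restrict (Ioc 0 1)) s₀ α (chainFam R σ) (sphPart α μ)) ∧
      ∀ q, c₁ * ‖q‖ ^ α - C₁ ≤
        psi (pushLevy (volume.restrict (Ioc 0 1)) (chainFam R σ) (noiseLevy α μ g)) q := by
  obtain ⟨c₂, hc₂, hobs⟩ := exists_le_integral_chainFam n d hn haLow hK hα hκ
  obtain ⟨c₃, C₃, hc₃, hC₃, hpsi⟩ := exists_psi_bounds d hα hα' hlam hg
  set L := famBound n d K κ with hL
  have hL0 : 0 ≤ L := mul_nonneg (flowBound_nonneg _ _ _) (Real.sqrt_nonneg _)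
  have hb := stableConst_pos hα hα'
  set b := (stableConst α)⁻¹ with hbdef
  have hb0 : 0 < b := inv_pos.2 hb
  have hlam0 : 0 < lam := by linarith
  set lam' := max 1 (max (b * lam * L ^ α) (b * lam⁻¹ * c₂)⁻¹) with hlam'
  have hlo : lam'⁻¹ ≤ b * lam⁻¹ * c₂ :=
    inv_le_of_inv_le₀ (by positivity) ((le_max_right _ _).trans (le_max_right _ _))
  have hup : b * lam * L ^ α ≤ lam' := (le_max_left _ _).trans (le_max_right _ _)
  refine ⟨(L + 1)⁻¹, lam', c₃ * c₂, C₃, by positivity, le_max_left _ _, by positivity, hC₃,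
    fun A R σ μ F hσm hσ hμ s₀ => ?_⟩
  have hG := F.isLinFamily hn hκ hσm hσ
  have hfin := hμ.isFiniteMeasure
  have hsfin := sphPart_isFiniteMeasure (μ := μ) hα hα'
  have hN := noiseLevy_isLevy hα hα' hg hμ
  have hNeq := noiseLevy_eq (μ := μ) hα hα' hg
  have hNs : SFinite (noiseLevy α μ g) := by rw [hNeq]; infer_instance
  have hpfin := hG.isFiniteMeasure_pushSpec (volume.restrict (Ioc 0 1)) s₀ hα (m := sphPart α μ)
  have hJ : ∀ w : EuclideanSpace ℝ (Fin d), b * lam⁻¹ * ‖w‖ ^ α ≤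
      ∫ s : USphere (Fin d), |inner ℝ w (s : EuclideanSpace ℝ (Fin d))| ^ α ∂sphPart α μ ∧
      ∫ s : USphere (Fin d), |inner ℝ w (s : EuclideanSpace ℝ (Fin d))| ^ α ∂sphPart α μ
        ≤ b * lam * ‖w‖ ^ α := fun w => by
    rw [integral_sphPart hα hα', mul_assoc, mul_assoc]
    exact ⟨mul_le_mul_of_nonneg_left (hμ.nondegenerate w).1 hb0.le,
      mul_le_mul_of_nonneg_left (hμ.nondegenerate w).2 hb0.le⟩
  refine ⟨⟨hG.pushLevy_isLevy _ hN, ?_, fun h1 => ?_, hpfin,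
    hG.pushSpec_isNegInvariant _ s₀ (sphPart_isNegInvariant hμ.symmetric), fun q => ?_,
    fun hn2 => ?_⟩, fun q => ?_⟩
  · rw [hNeq]
    refine (hG.pushLevy_le _ s₀ hg.antitone_ext (c := (L + 1)⁻¹) (by positivity) ?_).trans_eq ?_
    · rw [inv_mul_le_iff₀ (by positivity)]; linarith
    · exact polarMeasure_congr (fun ρ hρ => ext0_of_nonneg (by positivity)) _
  · rw [hNeq, polarMeasure_congr (w' := fun _ => 1)
      (fun ρ hρ => by rw [ext0_of_nonneg hρ.le, h1 _ hρ.le]) _, hG.pushLevy_eq _ s₀]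
    exact (polarMeasure_congr (fun ρ hρ => h1 _ (by positivity)) _).symm
  · have hI := hG.integral_abs_inner_pushSpec (volume.restrict (Ioc 0 1)) s₀ hα
      (m := sphPart α μ) q
    set I := ∫ η : USphere (Fin n × Fin d), |inner ℝ q (η : ESp n d)| ^ α
      ∂pushSpec (volume.restrict (Ioc 0 1)) s₀ α (chainFam R σ) (sphPart α μ) with hIdef
    have hI0 : 0 ≤ I := integral_nonneg fun η => by positivity
    constructor
    · calc lam'⁻¹ * ‖q‖ ^ α ≤ b * lam⁻¹ * c₂ * ‖q‖ ^ α := by gcongr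
        _ ≤ I := by
          rw [← ENNReal.ofReal_le_ofReal_iff hI0, hI]
          calc ENNReal.ofReal (b * lam⁻¹ * c₂ * ‖q‖ ^ α)
              ≤ ENNReal.ofReal (∫ v in Ioc 0 1, b * lam⁻¹ *
                ‖Matrix.toEuclideanLin (chainFam R σ v)ᵀ q‖ ^ α) := by
                refine ENNReal.ofReal_le_ofReal ?_
                rw [integral_const_mul, mul_assoc]
                exact mul_le_mul_of_nonneg_left (hobs A R σ F hσm hσ q) (by positivity)
            _ = ∫⁻ v in Ioc 0 1, ENNReal.ofReal (b * lam⁻¹ *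
                ‖Matrix.toEuclideanLin (chainFam R σ v)ᵀ q‖ ^ α) :=
                ofReal_integral_eq_lintegral_ofReal
                  ((hG.integrable_norm_transpose_rpow hα _ q).const_mul _)
                  (Eventually.of_forall fun v => by positivity)
            _ ≤ _ := lintegral_mono fun v => ENNReal.ofReal_le_ofReal (hJ _).1
    · calc I ≤ b * lam * (L * ‖q‖) ^ α := by
            rw [← ENNReal.ofReal_le_ofReal_iff (by positivity), hI]
            calc _ ≤ ∫⁻ _ in Ioc (0 : ℝ) 1, ENNReal.ofReal (b * lam * (L * ‖q‖) ^ α) := by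
                  refine lintegral_mono fun v => ENNReal.ofReal_le_ofReal ((hJ _).2.trans ?_)
                  gcongr
                  exact hG.norm_transpose_le v q
              _ = _ := by simp
        _ = b * lam * L ^ α * ‖q‖ ^ α := by rw [Real.mul_rpow hL0 (norm_nonneg _)]; ring
        _ ≤ lam' * ‖q‖ ^ α := by gcongr
  · obtain ⟨H, hH⟩ := hμ.exists_sphPart_le hα hα'
    exact F.dimH_support_eq hn2 hd haLow hκ hα hσm hσ s₀ (hμ.sphPart_ne_zero hd hlam) hH
  · rw [hG.psi_pushLevy _ hN]
    have hi := hG.integrable_norm_transpose_rpow hα (volume.restrict (Ioc 0 1)) q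
    calc c₃ * c₂ * ‖q‖ ^ α - C₃ ≤ ∫ v in Ioc (0 : ℝ) 1,
          (c₃ * ‖Matrix.toEuclideanLin (chainFam R σ v)ᵀ q‖ ^ α - C₃) := by
          rw [integral_sub (hi.const_mul _) (integrable_const _), integral_const_mul,
            integral_const]
          rw [probReal_univ, one_smul]
          rw [mul_assoc]
          exact sub_le_sub_right (mul_le_mul_of_nonneg_left (hobs A R σ F hσm hσ q) hc₃.le) _
      _ ≤ _ := integral_mono ((hi.const_mul _).sub (integrable_const _))
          (hG.integrable_psi_transpose _ hN q) fun v => (hpsi μ hμ _).1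

end StableLike
end StableChain

namespace StableChain

/-! ### The density of the stochastic integral -/
section Density
variable {n d : ℕ} {α κ lam aLow aUp : ℝ} {g : ℝ → ℝ}
  {A : ℝ → Matrix (Fin n × Fin d) (Fin n × Fin d) ℝ}
  {R : ℝ → ℝ → Matrix (Fin n × Fin d) (Fin n × Fin d) ℝ} {μ : Measure (USphere (Fin d))}

/-- The characteristic function of `∫_t^s f(u) dZ_u`, for a symmetric Lévy process `Z` with Lévy
measure `N`. -/
def intFourier (N : Measure (EuclideanSpace ℝ (Fin d)))
    (f : ℝ → Matrix (Fin n × Fin d) (Fin d) ℝ) (t s : ℝ) (q : ESp n d) : ℝ :=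
  Real.exp (-∫ u in Ioc t s, psi N (Matrix.toEuclideanLin (f u)ᵀ q))

lemma intFourier_congr (N : Measure (EuclideanSpace ℝ (Fin d)))
    {f f' : ℝ → Matrix (Fin n × Fin d) (Fin d) ℝ} {t s : ℝ} (h : EqOn f f' (Ioc t s)) :
    intFourier N f t s = intFourier N f' t s := by
  ext q
  rw [intFourier, intFourier, setIntegral_congr_fun measurableSet_Ioc fun u hu => by rw [h hu]]

theorem HasStochIntegral.hasDensity {Ω : Type*} [MeasurableSpace Ω] {P : Measure Ω}
    [IsProbabilityMeasure P] {Z : ℝ≥0 → Ω → EuclideanSpace ℝ (Fin d)} {Λ : Ω → ESp n d}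
    {f : ℝ → Matrix (Fin n × Fin d) (Fin d) ℝ} {t s : ℝ≥0} (hα : 0 < α) (hα' : α < 2)
    (hg : IsWeight g) (hμ : SpectralCondition d α lam μ) (hZ : IsDrivingNoise P α κ μ g Z)
    (hΛ : HasStochIntegral P Z f t s Λ)
    (hint : Integrable (intFourier (noiseLevy α μ g) f t s)) :
    HasDensity P Λ (invDens (intFourier (noiseLevy α μ g) f t s)) := by
  obtain ⟨hL, hc⟩ := hZ.charFun_eq hα hα' hμ
  obtain ⟨hm, hΛc⟩ := hΛ.charFun_eq hL (noiseLevy_isLevy hα hα' hg hμ).continuous_psi hc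
  have hP : IsProbabilityMeasure (P.map Λ) := Measure.isProbabilityMeasure_map hm
  have h : ∀ q, charFun (P.map Λ) q = intFourier (noiseLevy α μ g) f t s q := fun q => by
    rw [hΛc, intFourier]; push_cast; rfl
  exact ⟨hm, measurable_invDens hint h, fun z => (fourierInv_scaled_eq hint h z).2.1,
    eq_withDensity_invDens hint h⟩

lemma HasDensity.const_add {ι : Type} [Fintype ι] {Ω : Type*} [MeasurableSpace Ω] {P : Measure Ω}
    {X : Ω → EuclideanSpace ℝ ι} {p : EuclideanSpace ℝ ι → ℝ} (h : HasDensity P X p)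
    (a : EuclideanSpace ℝ ι) : HasDensity P (fun ω => a + X ω) (fun z => p (z - a)) := by
  obtain ⟨hm, hp, h0, hmap⟩ := h
  refine ⟨hm.const_add a, hp.comp (by fun_prop), fun z => h0 _, ?_⟩
  have e : P.map (fun ω => a + X ω) = (P.map X).map (fun x => a + x) :=
    (AEMeasurable.map_map_of_aemeasurable (by fun_prop) hm).symm
  rw [e, hmap]
  refine Measure.ext_of_lintegral _ fun f hf => ?_
  rw [lintegral_map hf (by fun_prop), lintegral_withDensity_eq_lintegral_mul _ (by fun_prop)
    (by fun_prop), lintegral_withDensity_eq_lintegral_mul _ (by fun_prop) hf]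
  simp only [Pi.mul_apply]
  rw [← lintegral_add_left_eq_self (fun z => ENNReal.ofReal (p (z - a)) * f z) a]
  simp

theorem exists_multiScale (hn : 1 ≤ n) (hd : 1 ≤ d) (hα : 0 < α) (hα' : α < 2) (hκ : 1 ≤ κ)
    (haLow : 0 < aLow) (haUp : 0 < aUp) (hlam : 1 ≤ lam) (hg : IsWeight g) :
    ∃ C c lam' : ℝ, 0 < C ∧ 0 < c ∧ 1 ≤ lam' ∧ ∀ A R (μ : Measure (USphere (Fin d))),
      DriftCondition n d aLow aUp A → IsResolvent A R → SpectralCondition d α lam μ →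
      ∀ (t s : ℝ) (σ : ℝ → Matrix (Fin d) (Fin d) ℝ), 0 ≤ t → t < s → s ≤ t + 1 →
      (∀ i j, Measurable fun u => σ u i j) → (∀ u ∈ Icc t s, IsElliptic κ (σ u)) →
      Integrable (intFourier (noiseLevy α μ g) (fun u => R s u * injB n d * σ u) t s) ∧
      ∃ (ν : Measure (ESp n d)) (m : Measure (USphere (Fin n × Fin d))),
        IsStableLike n d α g c lam' ν m ∧ IsMultiScaleDensity n d α C (s - t) ν
          (invDens (intFourier (noiseLevy α μ g) (fun u => R s u * injB n d * σ u) t s)) := by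
  have hK : 0 ≤ driftBound n d aUp := by unfold driftBound; positivity
  obtain ⟨c, lam', c₁, C₁, hc, hlam', hc₁, hC₁, H⟩ :=
    exists_isStableLike hn hd haLow hK hα hα' hκ hlam hg
  have hnonempty : Nonempty (Fin n × Fin d) := ⟨(⟨0, hn⟩, ⟨0, hd⟩)⟩
  have hD := diagConst_nonneg n d (α := α) (C := C₁) hc₁
  refine ⟨diagConst n d α c₁ C₁ + 1, c, lam', by positivity, hc, hlam',
    fun A R μ hA hR hμ t s σ ht hts hs1 hσm hσ => ?_⟩
  set τ := s - t with hτdef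
  have hτ : 0 < τ := sub_pos.2 hts
  have hτ1 : τ ≤ 1 := by linarith
  have F := isChainFlow hA hR haUp ht hτ hτ1
  set σ' : ℝ → Matrix (Fin d) (Fin d) ℝ := fun v =>
    if v ∈ Icc (0 : ℝ) 1 then σ (t + τ * v) else 1 with hσ'
  have hσ'm : ∀ i j, Measurable fun v => σ' v i j := fun i j => by
    have : (fun v => σ' v i j) = fun v => if v ∈ Icc (0 : ℝ) 1 then σ (t + τ * v) i j
        else (1 : Matrix (Fin d) (Fin d) ℝ) i j := by
      ext v; simp only [hσ']; split_ifs <;> rfl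
    rw [this]
    exact Measurable.ite measurableSet_Icc ((hσm i j).comp (by fun_prop)) measurable_const
  have hσ'e : ∀ v, IsElliptic κ (σ' v) := fun v => by
    simp only [hσ']
    split_ifs with hv
    · refine hσ _ ⟨?_, ?_⟩
      · have := mul_nonneg hτ.le hv.1; linarith
      · have := mul_le_mul_of_nonneg_left hv.2 hτ.le; linarith
    · exact IsElliptic.one hκ
  have hG := F.isLinFamily hn hκ hσ'm hσ'e
  have hNs : SFinite (noiseLevy α μ g) := by
    have := hμ.isFiniteMeasure
    have := sphPart_isFiniteMeasure (μ := μ) hα hα'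
    rw [noiseLevy_eq hα hα' hg]; infer_instance
  have hN := noiseLevy_isLevy hα hα' hg hμ
  set s₀ : USphere (Fin n × Fin d) := ⟨EuclideanSpace.single (⟨0, hn⟩, ⟨0, hd⟩) 1, by simp⟩
  obtain ⟨hst, hpsi⟩ := H _ _ σ' μ F hσ'm hσ'e hμ s₀
  set ν := pushLevy (volume.restrict (Ioc 0 1)) (chainFam (scaledRes R t τ) σ')
    (noiseLevy α μ g) with hν
  have hφ : intFourier (noiseLevy α μ g) (fun u => R s u * injB n d * σ u) t s
      = fun q => levyFourier τ ν (Matrix.toEuclideanLin (scaleM n d τ) q) := by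
    ext q
    have h1 := intervalIntegral.smul_integral_comp_add_mul (a := 0) (b := 1)
      (fun u => psi (noiseLevy α μ g) (Matrix.toEuclideanLin (R s u * injB n d * σ u)ᵀ q)) τ t
    rw [mul_zero, add_zero, mul_one, hτdef, add_sub_cancel, ← hτdef,
      intervalIntegral.integral_of_le hts.le, intervalIntegral.integral_of_le zero_le_one,
      smul_eq_mul] at h1
    rw [intFourier, levyFourier_eq, hν, hG.psi_pushLevy _ hN, ← h1, neg_mul]
    congr 3
    refine setIntegral_congr_fun measurableSet_Ioc fun v hv => ?_
    congr 1
    have e : R s (t + τ * v) * injB n d * σ (t + τ * v)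
        = scaleM n d τ * chainFam (scaledRes R t τ) σ' v := by
      have h2 : σ' v = σ (t + τ * v) := if_pos (Ioc_subset_Icc_self hv)
      rw [chainFam, chainMap, scaledRes, clamp_of_mem (Ioc_subset_Icc_self hv), h2, mul_one,
        hτdef, add_sub_cancel, ← hτdef]
      simp only [Matrix.mul_assoc]
      rw [← Matrix.mul_assoc (scaleM n d τ) (scaleM n d τ⁻¹), scaleM_mul_inv hτ.ne',
        Matrix.one_mul, ← Matrix.mul_assoc (scaleM n d τ) (injB n d), scaleM_mul_injB]
    rw [e, Matrix.transpose_mul, toEuclideanLin_mul, scaleM, Matrix.diagonal_transpose]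
  rw [hφ]
  refine ⟨integrable_comp_scaleM (integrable_levyFourier hst.levy hα hc₁ hC₁ hpsi hτ hτ1) hτ,
    ν, _, hst, isMultiScaleDensity_invDens hst.levy hα hc₁ hC₁ hpsi hτ hτ1 (by linarith)⟩

end Density

/-! ### Long time intervals -/
section Long
open scoped Matrix.Norms.L2Operator
variable {n d : ℕ} {α κ lam aLow aUp : ℝ} {g : ℝ → ℝ}
  {A : ℝ → Matrix (Fin n × Fin d) (Fin n × Fin d) ℝ}
  {R : ℝ → ℝ → Matrix (Fin n × Fin d) (Fin n × Fin d) ℝ}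

lemma exists_bounded_extension (hn : 1 ≤ n) (hκ : 1 ≤ κ) (hA : DriftCondition n d aLow aUp A)
    (hR : IsResolvent A R) {t s : ℝ} (ht : 0 ≤ t) (hts : t ≤ s) {σ : ℝ → Matrix (Fin d) (Fin d) ℝ}
    (hσm : ∀ i j, Measurable fun u => σ u i j) (hσ : ∀ u ∈ Icc t s, IsElliptic κ (σ u)) :
    ∃ f : ℝ → Matrix (Fin n × Fin d) (Fin d) ℝ, (∀ i j, Measurable fun u => f u i j) ∧
      (∃ K, ∀ u i j, |f u i j| ≤ K) ∧ EqOn f (fun u => R s u * injB n d * σ u) (Icc t s) := by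
  have F := hR.isFlow hA s
  have hs : s ∈ Icc 0 s := right_mem_Icc.2 (ht.trans hts)
  set π : ℝ → ℝ := fun u => projIcc t s hts u with hπ
  have hπm : ∀ u, π u ∈ Icc 0 s := fun u =>
    ⟨ht.trans (projIcc t s hts u).2.1, (projIcc t s hts u).2.2⟩
  have hπe : ∀ u ∈ Icc t s, π u = u := fun u hu => by simp [hπ, projIcc_of_mem hts hu]
  have hRm : ∀ i j, Measurable fun u => R s (π u) i j := fun i j => by
    have hK := F.K_nonneg (ht.trans hts)
    refine (LipschitzWith.continuous (K := (‖(1 : Matrix (Fin n × Fin d) (Fin n × Fin d) ℝ)‖ *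
      Real.exp (driftBound n d aUp * (s - 0)) * (driftBound n d aUp *
      (‖(1 : Matrix (Fin n × Fin d) (Fin n × Fin d) ℝ)‖ *
        Real.exp (driftBound n d aUp * (s - 0))))).toNNReal)
      (LipschitzWith.of_dist_le_mul fun u v => ?_)).measurable
    rw [Real.coe_toNNReal _ (by positivity), Real.dist_eq, Real.dist_eq]
    refine (abs_entry_le (R s (π u) - R s (π v)) i j).trans
      ((F.norm_sub_le hs (hπm u) (hπm v)).trans (mul_le_mul_of_nonneg_left ?_ (by positivity)))
    have := (LipschitzWith.projIcc hts).dist_le_mul u v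
    simpa [Subtype.dist_eq, Real.dist_eq, hπ] using this
  set σ' : ℝ → Matrix (Fin d) (Fin d) ℝ := fun u => if u ∈ Icc t s then σ u else 1 with hσ'
  have hσ'm : ∀ i j, Measurable fun u => σ' u i j := fun i j => by
    have : (fun u => σ' u i j) = fun u => if u ∈ Icc t s then σ u i j
        else (1 : Matrix (Fin d) (Fin d) ℝ) i j := by
      ext u; simp only [hσ']; split_ifs <;> rfl
    rw [this]
    exact Measurable.ite measurableSet_Icc (hσm i j) measurable_const
  have hσ'e : ∀ u, IsElliptic κ (σ' u) := fun u => by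
    simp only [hσ']
    split_ifs with hu
    · exact hσ u hu
    · exact IsElliptic.one hκ
  refine ⟨fun u => R s (π u) * injB n d * σ' u, fun i j => ?_, ?_, fun u hu => ?_⟩
  · simp only [Matrix.mul_apply]
    exact Finset.measurable_fun_sum _ fun l _ => (Finset.measurable_fun_sum _ fun k _ =>
      (hRm i k).mul_const _).mul (hσ'm l j)
  · refine ⟨‖(1 : Matrix (Fin n × Fin d) (Fin n × Fin d) ℝ)‖ *
      Real.exp (driftBound n d aUp * (s - 0)) * 1 * √κ, fun u i j => (abs_entry_le _ i j).trans ?_⟩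
    refine (Matrix.l2_opNorm_mul _ _).trans (mul_le_mul ((Matrix.l2_opNorm_mul _ _).trans
      (mul_le_mul (F.norm_le (hπm u) hs) (norm_injB_le hn) (norm_nonneg _) (by positivity)))
      ((hσ'e u).norm_le hκ) (norm_nonneg _) (by positivity))
  · simp only [hπe u hu, hσ', if_pos hu]

lemma integrable_intFourier_of_subset {N : Measure (EuclideanSpace ℝ (Fin d))}
    (hN : IsSymmetricLevyMeasure N) {f : ℝ → Matrix (Fin n × Fin d) (Fin d) ℝ}
    (hf : ∀ i j, Measurable fun u => f u i j) {K : ℝ} (hK : ∀ u i j, |f u i j| ≤ K)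
    {t r s : ℝ} (htr : t ≤ r) (h : Integrable (intFourier N f r s)) :
    Integrable (intFourier N f t s) := by
  have hjoint : Measurable fun p : ESp n d × ℝ => psi N (Matrix.toEuclideanLin (f p.2)ᵀ p.1) := by
    refine hN.continuous_psi.measurable.comp ?_
    refine (MeasurableEquiv.toLp 2 (Fin d → ℝ)).symm.measurableEmbedding.measurable_comp_iff.1 ?_
    refine measurable_pi_iff.2 fun i => ?_
    change Measurable fun p : ESp n d × ℝ => ∑ j, f p.2 j i * p.1 j
    exact Finset.measurable_fun_sum _ fun j _ => ((hf j i).comp measurable_snd).mul (by fun_prop)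
  refine h.mono' ?_ (Eventually.of_forall fun q => ?_)
  · have h1 := hjoint.stronglyMeasurable.integral_prod_right' (ν := volume.restrict (Ioc t s))
    exact (Real.continuous_exp.measurable.comp h1.measurable.neg).aestronglyMeasurable
  · rw [Real.norm_eq_abs, intFourier, intFourier, abs_of_pos (Real.exp_pos _)]
    refine Real.exp_le_exp.2 (neg_le_neg ?_)
    refine setIntegral_mono_set ?_ (Eventually.of_forall fun u => psi_nonneg _ _)
      (Ioc_subset_Ioc_left htr).eventuallyLE
    obtain ⟨C, hC⟩ := (isCompact_closedBall (0 : EuclideanSpace ℝ (Fin d))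
      (Fintype.card (Fin d) * (Fintype.card (Fin n × Fin d) * K) * ‖q‖)).exists_bound_of_continuousOn
      hN.continuous_psi.continuousOn
    refine Integrable.of_bound (C := C) ?_ (Eventually.of_forall fun u => hC _ ?_)
    · exact (hN.continuous_psi.measurable.comp (measurable_transpose_apply hf q)).aestronglyMeasurable
    · rw [mem_closedBall_zero_iff]
      exact norm_transpose_apply_le (hK u) q

lemma SigmaCondition.measurable_frozen {σ : ℝ → ESp n d → Matrix (Fin d) (Fin d) ℝ}
    (hσ : SigmaCondition n d κ σ) {x : ℝ → ESp n d} (hx : ContinuousOn x (Ici 0)) (i j) :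
    Measurable fun u => σ (max u 0) (x (max u 0)) i j := by
  obtain ⟨H, hH, η, hη, -, hhol⟩ := hσ.holder
  have hc : ∀ u : ℝ, Continuous fun y => σ (max u 0) y i j := fun u => by
    refine continuous_iff_continuousAt.2 fun y => ?_
    rw [ContinuousAt, tendsto_iff_dist_tendsto_zero]
    have h0 : Tendsto (fun y' => H * ‖y' - y‖ ^ η) (𝓝 y) (𝓝 0) := by
      have : Continuous fun y' => H * ‖y' - y‖ ^ η :=
        continuous_const.mul ((continuous_id.sub continuous_const).norm.rpow_const
          fun _ => Or.inr hη.le)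
      simpa [Real.zero_rpow hη.ne'] using this.tendsto y
    refine squeeze_zero (fun _ => dist_nonneg) (fun y' => ?_) h0
    rw [Real.dist_eq]
    exact (abs_entry_le (σ (max u 0) y' - σ (max u 0) y) i j).trans
      (hhol y' y _ (le_max_right _ _))
  have hm : ∀ y, Measurable fun u : ℝ => σ (max u 0) y i j := fun y =>
    (hσ.measurable y i j).comp (by fun_prop)
  have hxc : Continuous fun u : ℝ => x (max u 0) :=
    hx.comp_continuous (by fun_prop) fun u => mem_Ici.2 (le_max_right _ _)
  have hjoint := measurable_uncurry_of_continuous_of_measurable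
    (u := fun (y : ESp n d) (u : ℝ) => σ (max u 0) y i j) hc hm
  exact hjoint.comp (hxc.measurable.prodMk measurable_id)

end Long
end StableChain

end

theorem mainTheorem3 (n d : ℕ) (hn : 1 ≤ n) (hd : 1 ≤ d)
    (α κ aLow aUp lam : ℝ) (hα : 0 < α) (hα' : α < 2) (hκ : 1 ≤ κ)
    (haLow : 0 < aLow) (haUp : 0 < aUp) (hlam : 1 ≤ lam)
    (g : ℝ → ℝ) (hg : (∀ r, 0 ≤ r → g r = 1) ∨ StableChain.TemperingCondition α κ g) :
    ∃ T₀ C c lam' : ℝ, 0 < T₀ ∧ T₀ ≤ 1 ∧ 0 < C ∧ 0 < c ∧ 1 ≤ lam' ∧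
      ∀ (A : ℝ → Matrix (Fin n × Fin d) (Fin n × Fin d) ℝ)
        (R : ℝ → ℝ → Matrix (Fin n × Fin d) (Fin n × Fin d) ℝ)
        (μ : Measure (StableChain.USphere (Fin d))),
        StableChain.DriftCondition n d aLow aUp A →
        StableChain.IsResolvent A R →
        StableChain.SpectralCondition d α lam μ →
        -- the process `Λ_s = ∫_t^s R_{s,u} B σ_u dZ_u`
        (∀ (t s : ℝ≥0) (σ : ℝ → Matrix (Fin d) (Fin d) ℝ),
          (∀ i j, Measurable fun u => σ u i j) →
          (∀ u, (t : ℝ) ≤ u → StableChain.IsElliptic κ (σ u)) →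
          t < s → (s : ℝ) ≤ t + T₀ →
          ∃ (ν : Measure (StableChain.ESp n d))
            (m : Measure (StableChain.USphere (Fin n × Fin d)))
            (p : StableChain.ESp n d → ℝ),
            StableChain.IsStableLike n d α g c lam' ν m ∧
            StableChain.IsMultiScaleDensity n d α C ((s : ℝ) - t) ν p ∧
            ∀ (Ω : Type*) [MeasurableSpace Ω] (P : Measure Ω) [IsProbabilityMeasure P]
              (Z : ℝ≥0 → Ω → EuclideanSpace ℝ (Fin d)) (Λ : Ω → StableChain.ESp n d),
              StableChain.IsDrivingNoise P α κ μ g Z →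
              StableChain.HasStochIntegral P Z
                (fun u => R s u * StableChain.injB n d * σ u) t s Λ →
              StableChain.HasDensity P Λ p) ∧
        -- the frozen process `X_s = R_{s,t} x + ∫_t^s R_{s,u} B σ(u, R_{u,T} y) dZ_u`
        (∀ (σ : ℝ → StableChain.ESp n d → Matrix (Fin d) (Fin d) ℝ) (t s T : ℝ≥0)
          (x y : StableChain.ESp n d),
          StableChain.SigmaCondition n d κ σ → t < s →
          ∃ p : StableChain.ESp n d → ℝ,
            ((s : ℝ) ≤ t + T₀ →
              ∃ (ν : Measure (StableChain.ESp n d))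
                (m : Measure (StableChain.USphere (Fin n × Fin d))),
                StableChain.IsStableLike n d α g c lam' ν m ∧
                StableChain.IsMultiScaleDensity n d α C ((s : ℝ) - t) ν p) ∧
            ∀ (Ω : Type*) [MeasurableSpace Ω] (P : Measure Ω) [IsProbabilityMeasure P]
              (Z : ℝ≥0 → Ω → EuclideanSpace ℝ (Fin d)) (Λ : Ω → StableChain.ESp n d),
              StableChain.IsDrivingNoise P α κ μ g Z →
              StableChain.HasStochIntegral P Z
                (fun u => R s u * StableChain.injB n d *
                  σ u (Matrix.toEuclideanCLM (𝕜 := ℝ) (R u T) y)) t s Λ →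
              StableChain.HasDensity P
                (fun ω => Matrix.toEuclideanCLM (𝕜 := ℝ) (R s t) x + Λ ω)
                (fun z => p (z - Matrix.toEuclideanCLM (𝕜 := ℝ) (R s t) x))) := by
  have hw := StableChain.isWeight_of hg
  obtain ⟨C, c, lam', hC, hc, hlam', H⟩ :=
    StableChain.exists_multiScale hn hd hα hα' hκ haLow haUp hlam hw
  refine ⟨1, C, c, lam', one_pos, le_rfl, hC, hc, hlam',
    fun A R μ hA hR hμ => ⟨fun t s σ hσm hσ hts hs => ?_, fun σ t s T x y hσ hts => ?_⟩⟩
  · obtain ⟨hint, ν, m, hst, hms⟩ := H A R μ hA hR hμ t s σ t.coe_nonneg (NNReal.coe_lt_coe.2 hts) hs hσm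
      fun u hu => hσ u hu.1
    exact ⟨ν, m, _, hst, hms, fun Ω _ P _ Z Λ hZ hΛ => hΛ.hasDensity hα hα' hw hμ hZ hint⟩
  · have hts' : (t : ℝ) < s := NNReal.coe_lt_coe.2 hts
    set z : ℝ → StableChain.ESp n d := fun u => Matrix.toEuclideanCLM (𝕜 := ℝ) (R u T) y with hz
    have hzc : ContinuousOn z (Ici 0) := by
      refine (PiLp.continuous_toLp 2 _).comp_continuousOn (continuousOn_pi.2 fun i => ?_)
      change ContinuousOn (fun u => ∑ j, R u T i j * y j) (Ici 0)
      exact continuousOn_finsetSum _ fun j _ => ((hR T T.coe_nonneg).1 i j).mul continuousOn_const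
    set σ' : ℝ → Matrix (Fin d) (Fin d) ℝ := fun u => σ (max u 0) (z (max u 0)) with hσ'
    have hσ'm : ∀ i j, Measurable fun u => σ' u i j := hσ.measurable_frozen hzc
    have hσ'e : ∀ u, StableChain.IsElliptic κ (σ' u) := fun u =>
      hσ.elliptic _ (le_max_right _ _) _
    have hEq : EqOn (fun u => R s u * StableChain.injB n d * σ' u)
        (fun u => R s u * StableChain.injB n d * σ u (z u)) (Ioc t s) := fun u hu => by
      simp only [hσ', max_eq_left (t.coe_nonneg.trans hu.1.le)]
    have hint : Integrable (StableChain.intFourier (StableChain.noiseLevy α μ g)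
        (fun u => R s u * StableChain.injB n d * σ u (z u)) t s) := by
      rw [← StableChain.intFourier_congr _ hEq]
      rcases le_or_gt (s : ℝ) (t + 1) with hs | hs
      · exact (H A R μ hA hR hμ t s σ' t.coe_nonneg hts' hs hσ'm fun u _ => hσ'e u).1
      · have hr : (0 : ℝ) ≤ s - 1 := by linarith [t.coe_nonneg]
        obtain ⟨f, hf, ⟨K, hK⟩, hfe⟩ := StableChain.exists_bounded_extension hn hκ hA hR t.coe_nonneg
          hts'.le hσ'm fun u _ => hσ'e u
        have h1 := (H A R μ hA hR hμ (s - 1) s σ' hr (by linarith) (by linarith) hσ'm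
          fun u _ => hσ'e u).1
        rw [← StableChain.intFourier_congr _ (hfe.mono Ioc_subset_Icc_self)]
        refine StableChain.integrable_intFourier_of_subset
          (StableChain.noiseLevy_isLevy hα hα' hw hμ) hf hK (r := s - 1) (by linarith) ?_
        rwa [StableChain.intFourier_congr _ (hfe.mono
          (Ioc_subset_Icc_self.trans (Icc_subset_Icc_left (by linarith))))]
    refine ⟨StableChain.invDens (StableChain.intFourier (StableChain.noiseLevy α μ g)
      (fun u => R s u * StableChain.injB n d * σ u (z u)) t s), fun hs => ?_,
      fun Ω _ P _ Z Λ hZ hΛ => (hΛ.hasDensity hα hα' hw hμ hZ hint).const_add _⟩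
    rw [← StableChain.intFourier_congr _ hEq]
    exact (H A R μ hA hR hμ t s σ' t.coe_nonneg hts' hs hσ'm fun u _ => hσ'e u).2
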